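/- Let $N\ge 2$, $q\ge 2$, $t\ge 1$ be integers and $\epsilon>0$. Consider $N$ qudits of dimension $q$ on a line, with Hilbert space $\mathcal H=(\mathbb C^q)^{\otimes N}$. For a random unitary $U_\varepsilon$ on $\mathcal H$ the $t$-th moment operator is the linear map on $L(\mathcal H^{\otimes t})$ $$\Phi_\varepsilon[\rho]=\mathbb E\big[(U_\varepsilon^\dagger)^{\otimes t}\rho\,U_\varepsilon^{\otimes t}\big],$$ and $\Psi_\varepsilon$ denotes its Choi matrix; $\Phi_{\rm Haar},\Psi_{\rm Haar}$ are those of a Haar-random unitary on $\mathcal H$. The ensemble is an additive-error $\epsilon$-approximate $t$-design if $\|\Phi_\varepsilon-\Phi_{\rm Haar}\|_\diamond\le\epsilon$, and a multiplicative-error $\epsilon$-approximate $t$-design if $(1-\epsilon)\Psi_{\rm Haar}\preceq\Psi_\varepsilon\preceq(1+\epsilon)\Psi_{\rm Haar}$. The $\ell$-layer 1D brickwork applies layers $1,\dots,\ell$ in turn, where an odd (even) layer consists of independent Haar-random two-qudit gates on sites $i,i+1$ for all odd (even) $i$ with $1\le i<N$; gates of different layers are independent. The staircase applies independent Haar-random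 two-qudit gates on sites $(1,2),(2,3),\dots,(N-1,N)$ in turn; let $\lambda_{\rm stair}=\lambda_{\rm stair}(N,q,t)$ be the largest magnitude of an eigenvalue different from $1$ of the $t$-th moment operator of the staircase. Then $\lambda_{\rm stair}<1$. If $\lambda_{\rm stair}>0$, then the $N$-site brickwork * is an additive-error $\epsilon$-approximate $t$-design after at most $$1+\frac{2}{\log\frac1{\lambda_{\rm stair}}}\Big(2Nt\log q+\log\frac1\epsilon\Big)$$ layers, that is, for every number of layers $\ell\ge 0$ which is at least the integer part (floor) of this number; and * is a multiplicative-error $\epsilon$-approximate $t$-design for every number of layers $$\ell\ge 2\left\lceil\frac{1}{\log\frac1{\lambda_{\rm stair}}}\Big(2Nt\log q+\log\frac1\epsilon\Big)\right\rceil .$$ In the degenerate case $\lambda_{\rm stair}=0$ both properties hold for every $\ell\ge 2$. -/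

import Mathlib

open MeasureTheory Matrix
open scoped ENNReal Kronecker ComplexOrder

noncomputable section

namespace RandomCircuit

section UnitaryGroup

variable {n : Type*} [Fintype n] [DecidableEq n]

instance unitaryMeasurableSpace : MeasurableSpace (unitaryGroup n ℂ) := borel _

instance unitaryBorelSpace : BorelSpace (unitaryGroup n ℂ) := ⟨rfl⟩

instance unitaryCompactSpace : CompactSpace (unitaryGroup n ℂ) := by
  refine isCompact_iff_compactSpace.mp ?_
  have hK : IsCompact (Set.univ.pi fun _ : n => Set.univ.pi fun _ : n =>
      Metric.closedBall (0 : ℂ) 1) :=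
    isCompact_univ_pi fun _ => isCompact_univ_pi fun _ => isCompact_closedBall 0 1
  refine IsCompact.of_isClosed_subset (X := Matrix n n ℂ) hK isClosed_unitary ?_
  intro U hU i _ j _
  simpa using entry_norm_bound_of_unitary hU i j

instance unitaryTopologicalGroup : IsTopologicalGroup (unitaryGroup n ℂ) :=
  inferInstanceAs (IsTopologicalGroup (unitary (Matrix n n ℂ)))

instance unitarySecondCountable : SecondCountableTopology (unitaryGroup n ℂ) := by
  have : SecondCountableTopology (Matrix n n ℂ) :=
    inferInstanceAs (SecondCountableTopology (n → n → ℂ))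
  exact (Topology.IsInducing.subtypeVal (t := {U : Matrix n n ℂ |
    U ∈ unitaryGroup n ℂ})).secondCountableTopology

/-- The Haar probability measure on the unitary group. -/
def haar (n : Type*) [Fintype n] [DecidableEq n] : Measure (unitaryGroup n ℂ) :=
  Measure.haarMeasure ⊤

instance haar_isProbabilityMeasure : IsProbabilityMeasure (haar n) :=
  ⟨by simpa [haar] using Measure.haarMeasure_self (K₀ := (⊤ : TopologicalSpace.PositiveCompacts
    (unitaryGroup n ℂ)))⟩

end UnitaryGroup

section Moments

variable {n : Type*} [Fintype n] [DecidableEq n]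

/-- The `t`-fold tensor power `A^{⊗t}`, as a matrix indexed by `t`-tuples of basis labels. -/
def tensorPow (t : ℕ) (A : Matrix n n ℂ) : Matrix (Fin t → n) (Fin t → n) ℂ :=
  Matrix.of fun x y => ∏ s, A (x s) (y s)

/-- `(U†)^{⊗t} ρ U^{⊗t}`. -/
def twirl (t : ℕ) (U : unitaryGroup n ℂ) (ρ : Matrix (Fin t → n) (Fin t → n) ℂ) :
    Matrix (Fin t → n) (Fin t → n) ℂ :=
  tensorPow t (U : Matrix n n ℂ)ᴴ * ρ * tensorPow t (U : Matrix n n ℂ)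

theorem continuous_twirl_apply (t : ℕ) (ρ : Matrix (Fin t → n) (Fin t → n) ℂ) (x y : Fin t → n) :
    Continuous fun U : unitaryGroup n ℂ => twirl t U ρ x y := by
  have h : ∀ i j : n, Continuous fun U : unitaryGroup n ℂ => (U : Matrix n n ℂ) i j :=
    fun i j => continuous_subtype_val.matrix_elem i j
  simp only [twirl, tensorPow, Matrix.mul_apply, Matrix.of_apply, Matrix.conjTranspose_apply]
  refine continuous_finsetSum _ fun j _ => (continuous_finsetSum _ fun k _ => ?_).mul ?_
  · exact (continuous_finsetProd _ fun s _ => (h _ _).star).mul continuous_const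
  · exact continuous_finsetProd _ fun s _ => h _ _

theorem integrable_twirl_apply (t : ℕ) (μ : Measure (unitaryGroup n ℂ)) [IsFiniteMeasure μ]
    (ρ : Matrix (Fin t → n) (Fin t → n) ℂ) (x y : Fin t → n) :
    Integrable (fun U => twirl t U ρ x y) μ :=
  (continuous_twirl_apply t ρ x y).integrable_of_hasCompactSupport
    (HasCompactSupport.of_compactSpace _)

/-- The `t`-th moment operator `Φ[ρ] = ∫ (U†)^{⊗t} ρ U^{⊗t} dμ(U)` of the ensemble `μ`; the
integral is taken entry by entry. -/
def momentOperator (t : ℕ) (μ : Measure (unitaryGroup n ℂ)) [IsFiniteMeasure μ] :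
    Matrix (Fin t → n) (Fin t → n) ℂ →ₗ[ℂ] Matrix (Fin t → n) (Fin t → n) ℂ where
  toFun ρ := Matrix.of fun x y => ∫ U, twirl t U ρ x y ∂μ
  map_add' ρ σ := by
    ext x y
    have h : ∀ U : unitaryGroup n ℂ, twirl t U (ρ + σ) x y = twirl t U ρ x y + twirl t U σ x y :=
      fun U => by simp [twirl, Matrix.mul_add, Matrix.add_mul]
    simp only [Matrix.of_apply, Matrix.add_apply, h]
    exact integral_add (integrable_twirl_apply t μ ρ x y) (integrable_twirl_apply t μ σ x y)
  map_smul' c ρ := by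
    ext x y
    have h : ∀ U : unitaryGroup n ℂ, twirl t U (c • ρ) x y = c * twirl t U ρ x y :=
      fun U => by simp [twirl]
    simp only [Matrix.of_apply, Matrix.smul_apply, h, RingHom.id_apply, smul_eq_mul]
    exact integral_const_mul c _

end Moments

section Superoperators

variable {d : Type*} [Fintype d] [DecidableEq d]

/-- The trace norm: the sum of the singular values, i.e. of the square roots of the eigenvalues
of `Aᴴ A`. -/
def traceNorm (A : Matrix d d ℂ) : ℝ :=
  ∑ i, √((isHermitian_conjTranspose_mul_self A).eigenvalues i)

/-- `Φ ⊗ id_k`, acting on matrices over `ℂ^d ⊗ ℂ^k`: apply `Φ` to each `d × d` block. -/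
def ampliation (Φ : Matrix d d ℂ →ₗ[ℂ] Matrix d d ℂ) (k : ℕ)
    (ρ : Matrix (d × Fin k) (d × Fin k) ℂ) : Matrix (d × Fin k) (d × Fin k) ℂ :=
  Matrix.of fun x y => Φ (Matrix.of fun i j => ρ (i, x.2) (j, y.2)) x.1 y.1

/-- The diamond norm: the supremum of `‖(Φ ⊗ id_k)(ρ)‖₁` over all `k` and all `ρ` with
`‖ρ‖₁ ≤ 1`. -/
def diamondNorm (Φ : Matrix d d ℂ →ₗ[ℂ] Matrix d d ℂ) : ℝ≥0∞ :=
  ⨆ (k : ℕ) (ρ : Matrix (d × Fin k) (d × Fin k) ℂ) (_ : traceNorm ρ ≤ 1),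
    ENNReal.ofReal (traceNorm (ampliation Φ k ρ))

/-- The Choi matrix `∑_{a,b} Φ(|a⟩⟨b|) ⊗ |a⟩⟨b|`. -/
def choi (Φ : Matrix d d ℂ →ₗ[ℂ] Matrix d d ℂ) : Matrix (d × d) (d × d) ℂ :=
  Matrix.of fun x y => Φ (Matrix.single x.2 y.2 1) x.1 y.1

end Superoperators

section Designs

variable {n : Type*} [Fintype n] [DecidableEq n]

/-- Additive-error `ε`-approximate `t`-design: `‖Φ_μ - Φ_Haar‖_⋄ ≤ ε`. -/
def IsAdditiveDesign (t : ℕ) (ε : ℝ) (μ : Measure (unitaryGroup n ℂ)) [IsFiniteMeasure μ] : Prop :=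
  diamondNorm (momentOperator t μ - momentOperator t (haar n)) ≤ ENNReal.ofReal ε

/-- Multiplicative-error `ε`-approximate `t`-design: `(1-ε)Ψ_Haar ≼ Ψ_μ ≼ (1+ε)Ψ_Haar` for the
Choi matrices `Ψ` of the moment operators. -/
def IsMultiplicativeDesign (t : ℕ) (ε : ℝ) (μ : Measure (unitaryGroup n ℂ)) [IsFiniteMeasure μ] :
    Prop :=
  (choi (momentOperator t μ) - (1 - ε) • choi (momentOperator t (haar n))).PosSemidef ∧
  ((1 + ε) • choi (momentOperator t (haar n)) - choi (momentOperator t μ)).PosSemidef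

end Designs

section Circuits

variable {N q : ℕ}

/-- The left site of the `i`-th pair of neighbouring sites (sites are numbered from `0`). -/
def leftSite (i : Fin (N - 1)) : Fin N := ⟨i, by omega⟩

/-- The right site of the `i`-th pair of neighbouring sites. -/
def rightSite (i : Fin (N - 1)) : Fin N := ⟨i + 1, by omega⟩

theorem rightSite_ne_leftSite (i : Fin (N - 1)) : rightSite i ≠ leftSite i := by
  simp [rightSite, leftSite, Fin.ext_iff]

/-- Split a computational basis label of `N` qudits into the labels of sites `i, i+1` and the
labels of the other sites. -/
def splitSites (q : ℕ) (i : Fin (N - 1)) :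
    (Fin N → Fin q) ≃
      (Fin q × Fin q) × ({k : Fin N // k ≠ leftSite i ∧ k ≠ rightSite i} → Fin q) where
  toFun x := ((x (leftSite i), x (rightSite i)), fun k => x k)
  invFun p k :=
    if hl : k = leftSite i then p.1.1
    else if hr : k = rightSite i then p.1.2
    else p.2 ⟨k, hl, hr⟩
  left_inv x := by
    funext k
    by_cases hl : k = leftSite i
    · simp [hl]
    · by_cases hr : k = rightSite i
      · simp [hr, rightSite_ne_leftSite]
      · simp [hl, hr]
  right_inv p := by
    refine Prod.ext (Prod.ext ?_ ?_) (funext fun k => ?_)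
    · simp
    · simp [rightSite_ne_leftSite]
    · simp [k.2.1, k.2.2]

/-- The two-qudit gate `u` acting on sites `i, i+1` and as the identity on all other sites. -/
def gate (i : Fin (N - 1)) (u : unitaryGroup (Fin q × Fin q) ℂ) :
    unitaryGroup (Fin N → Fin q) ℂ :=
  ⟨((u : Matrix _ _ ℂ) ⊗ₖ (1 : Matrix ({k : Fin N // k ≠ leftSite i ∧ k ≠ rightSite i} → Fin q)
      ({k : Fin N // k ≠ leftSite i ∧ k ≠ rightSite i} → Fin q) ℂ)).submatrix
      (splitSites q i) (splitSites q i), by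
    rw [mem_unitaryGroup_iff, star_eq_conjTranspose, conjTranspose_submatrix,
      submatrix_mul_equiv, conjTranspose_kronecker, ← mul_kronecker_mul, conjTranspose_one,
      Matrix.one_mul, ← star_eq_conjTranspose, mem_unitaryGroup_iff.mp u.2, one_kronecker_one,
      submatrix_one_equiv]⟩

theorem measurable_gate (i : Fin (N - 1)) : Measurable (gate (q := q) i) := by
  refine Continuous.measurable (Continuous.subtype_mk ?_ _)
  refine Continuous.matrix_submatrix ?_ _ _
  refine continuous_matrix fun x y => ?_
  simp only [kroneckerMap_apply]
  exact (continuous_subtype_val.matrix_elem _ _).mul continuous_const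

/-- The law of a Haar-random two-qudit gate on sites `i, i+1`. -/
def gateEnsemble (q : ℕ) (i : Fin (N - 1)) : Measure (unitaryGroup (Fin N → Fin q) ℂ) :=
  (haar (Fin q × Fin q)).map (gate i)

instance gateEnsemble_isProbabilityMeasure (i : Fin (N - 1)) :
    IsProbabilityMeasure (gateEnsemble q i) :=
  Measure.isProbabilityMeasure_map (measurable_gate i).aemeasurable

/-- The random circuit ensemble of an architecture, given as the list of its gate positions in
the order in which they are applied: the law of the product of independent Haar-random gates,
the first gate of the list standing rightmost in the product. -/
def circuitEnsemble (q : ℕ) : List (Fin (N - 1)) → Measure (unitaryGroup (Fin N → Fin q) ℂ)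
  | [] => Measure.dirac 1
  | i :: c => (circuitEnsemble q c).mconv (gateEnsemble q i)

instance circuitEnsemble_isProbabilityMeasure (c : List (Fin (N - 1))) :
    IsProbabilityMeasure (circuitEnsemble q c) := by
  induction c with
  | nil => exact Measure.dirac.isProbabilityMeasure
  | cons i c ih =>
    exact Measure.isProbabilityMeasure_map measurable_mul.aemeasurable

/-- Layer `j` of the brickwork, layers being numbered from `0`: one gate on each pair `i, i+1`
with `i ≡ j mod 2`. With sites and layers numbered from `1` this puts gates on the odd `i` in odd
layers and on the even `i` in even layers. -/
def brickworkLayer (N j : ℕ) : List (Fin (N - 1)) :=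
  (List.finRange (N - 1)).filter fun i => i.val % 2 = j % 2

/-- The `ℓ`-layer 1D brickwork architecture on `N` sites. -/
def brickwork (N ℓ : ℕ) : List (Fin (N - 1)) :=
  (List.range ℓ).flatMap (brickworkLayer N)

/-- The staircase architecture on `N` sites: gates on sites `(0,1), (1,2), …, (N-2,N-1)`. -/
def staircase (N : ℕ) : List (Fin (N - 1)) := List.finRange (N - 1)

/-- `λ_stair(N,q,t)`: the largest magnitude of a non-unit eigenvalue of the `t`-th moment operator
of the staircase. -/
def stairEigenvalue (N q t : ℕ) : ℝ :=
  sSup {r : ℝ | ∃ μ : ℂ,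
    Module.End.HasEigenvalue (momentOperator t (circuitEnsemble q (staircase N))) μ ∧
      μ ≠ 1 ∧ r = ‖μ‖}

end Circuits

end RandomCircuit

end

/-! Write `D = q^(N t)`, `λ` for the staircase eigenvalue and `H` for the Haar moment operator. For
the inner product `tr(Aᴴ B)`, the moment operator of one Haar-random gate is the orthogonal
projection onto the commutant of the operators `U^{⊗t}`, with `U` running over the gates at that
position (`groupTwirl_eq_self_iff`, `isSymmetricProjection_groupTwirl`). The gates of one layer
commute, so a layer is again a projection: `O` for even and `E` for odd layer index, counted from 0.
The brickwork is the alternating product `O E O ⋯`. Two-site matrices generate all matrices under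
brackets, so the ranges of `O` and `E` meet exactly in the range of `H` (`groupTwirl_id_eq_self`).

The staircase is the product of all gate projections in order. Only neighbours may fail to commute,
so moves that preserve the nonzero spectrum turn it into `O E`, just as Coxeter elements of a path
are conjugate (`hasEigenvalue_stair_iff`). The nonzero eigenvalues of `O E` are squared cosines of
the angles between the two ranges, hence `‖E O - H‖² ≤ λ` (`norm_sq_mul_sub_le`). Iteration in
Hilbert–Schmidt norm bounds the squared distance of `ℓ ≥ 1` layers from `H` by `λ^(ℓ-1) ‖O - H‖²`
(`hsNormSq_alternating_le`).

One factor `λ` is still missing. The squared norm of `O - H` is at most the rank of a single gate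
projection, which is at most `D² / q⁴` (`hsNormSq_gate_le`). For `N ≥ 3` and `t ≥ 2`, explicit
domain wall operators show `q⁻⁴ ≤ λ` (`one_le_stairEigenvalue_mul`). If `N = 2` or `t = 1`, the gate
projections commute and `λ = 0`. So for `λ > 0` the squared distance is at most `D² λ^ℓ`; for `λ =
0` two layers already give `H` exactly.

The Hilbert–Schmidt norm of a superoperator is the Frobenius norm of its Choi matrix. Both the
diamond norm and the multiplicative error are at most `D` times this norm (`diamondNorm_le`,
`isMultiplicativeDesign_of_frobSq_le`), the latter because the Haar Choi matrix is at least `1/D` on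
the span of the `U^{⊗t}`. Hence `D⁴ λ^ℓ ≤ ε²` suffices, and its logarithm is the stated layer count.
-/

set_option linter.unusedSectionVars false

namespace RandomCircuit

/-! ### Haar measure on the compact unitary group is bi-invariant and inversion invariant -/

section HaarInvariance

variable {n : Type*} [Fintype n] [DecidableEq n]

instance haar_isHaarMeasure : (haar n).IsHaarMeasure := by
  unfold haar; infer_instance

instance haar_isMulRightInvariant : (haar n).IsMulRightInvariant := by
  refine ⟨fun g => ?_⟩
  have : IsProbabilityMeasure ((haar n).map (· * g)) :=
    Measure.isProbabilityMeasure_map (measurable_mul_const g).aemeasurable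
  exact Measure.isHaarMeasure_eq_of_isProbabilityMeasure _ _

instance haar_isInvInvariant : (haar n).IsInvInvariant := by
  refine ⟨?_⟩
  have : IsProbabilityMeasure (haar n).inv :=
    Measure.isProbabilityMeasure_map measurable_inv.aemeasurable
  have : (haar n).inv.IsHaarMeasure := by
    have h : (haar n).inv.IsMulLeftInvariant := inferInstance
    have := Measure.isHaarMeasure_of_isCompact_nonempty_interior (haar n).inv Set.univ isCompact_univ
      (by simp) (by simp) (by simp)
    exact this
  exact Measure.isHaarMeasure_eq_of_isProbabilityMeasure _ _

end HaarInvariance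

/-! ### Tensor products and tensor powers of matrices -/

section PiTensor

variable {ι n : Type*} [Fintype ι] [DecidableEq ι] [Fintype n] [DecidableEq n]

/-- The tensor product of a family of square matrices. -/
def piTensor (A : ι → Matrix n n ℂ) : Matrix (ι → n) (ι → n) ℂ :=
  Matrix.of fun x y => ∏ s, A s (x s) (y s)

theorem piTensor_mul (A B : ι → Matrix n n ℂ) :
    piTensor A * piTensor B = piTensor fun s => A s * B s := by
  ext x y
  simp only [piTensor, Matrix.mul_apply, Matrix.of_apply, Finset.prod_univ_sum, Fintype.piFinset_univ,
    Finset.prod_mul_distrib]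

theorem piTensor_one : piTensor (fun _ : ι => (1 : Matrix n n ℂ)) = 1 := by
  ext x y
  simp only [piTensor, Matrix.of_apply, Matrix.one_apply, Finset.prod_boole, Finset.mem_univ,
    true_implies, funext_iff]

theorem piTensor_eq_zero {A : ι → Matrix n n ℂ} (s : ι) (h : A s = 0) : piTensor A = 0 := by
  ext x y
  simp only [piTensor, Matrix.of_apply, Matrix.zero_apply]
  exact Finset.prod_eq_zero (Finset.mem_univ s) (by simp [h])

theorem conjTranspose_piTensor (A : ι → Matrix n n ℂ) :
    (piTensor A)ᴴ = piTensor fun s => (A s)ᴴ := by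
  ext x y
  simp [piTensor, Matrix.conjTranspose_apply, star_prod]

theorem piTensor_single (x y : ι → n) :
    piTensor (fun s => Matrix.single (x s) (y s) (1 : ℂ)) = Matrix.single x y 1 := by
  ext u v
  simp only [piTensor, Matrix.of_apply, Matrix.single_apply, Finset.prod_boole, Finset.mem_univ,
    true_implies, funext_iff, forall_and]

end PiTensor

section TensorPow

variable {n : Type*} [Fintype n] [DecidableEq n] {t : ℕ}

theorem tensorPow_eq_piTensor (A : Matrix n n ℂ) : tensorPow t A = piTensor fun _ => A := rfl

theorem tensorPow_mul (A B : Matrix n n ℂ) :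
    tensorPow t (A * B) = tensorPow t A * tensorPow t B := by
  simp only [tensorPow_eq_piTensor, piTensor_mul]

theorem tensorPow_one : tensorPow t (1 : Matrix n n ℂ) = 1 := piTensor_one

theorem conjTranspose_tensorPow (A : Matrix n n ℂ) : (tensorPow t A)ᴴ = tensorPow t Aᴴ := by
  simp only [tensorPow_eq_piTensor, conjTranspose_piTensor]

theorem tensorPow_mul_star (U : unitaryGroup n ℂ) :
    tensorPow t (U : Matrix n n ℂ) * tensorPow t (U : Matrix n n ℂ)ᴴ = 1 := by
  rw [← tensorPow_mul, ← star_eq_conjTranspose, Unitary.mul_star_self_of_mem U.2, tensorPow_one]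

theorem star_tensorPow_mul (U : unitaryGroup n ℂ) :
    tensorPow t (U : Matrix n n ℂ)ᴴ * tensorPow t (U : Matrix n n ℂ) = 1 := by
  rw [← tensorPow_mul, ← star_eq_conjTranspose, Unitary.star_mul_self_of_mem U.2, tensorPow_one]

theorem trace_tensorPow (A : Matrix n n ℂ) : (tensorPow t A).trace = A.trace ^ t := by
  simp only [Matrix.trace, tensorPow, Matrix.diag_apply, Matrix.of_apply]
  have h := Finset.prod_univ_sum (fun _ : Fin t => (Finset.univ : Finset n)) fun _ i => A i i
  rw [Fintype.piFinset_univ] at h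
  rw [← h]
  simp

/-- Conjugation by `U^{⊗t}` as a linear map. -/
def twirlMap (t : ℕ) (U : unitaryGroup n ℂ) :
    Module.End ℂ (Matrix (Fin t → n) (Fin t → n) ℂ) where
  toFun := twirl t U
  map_add' ρ σ := by simp [twirl, Matrix.mul_add, Matrix.add_mul]
  map_smul' c ρ := by simp [twirl]

@[simp] theorem twirlMap_apply (U : unitaryGroup n ℂ) (ρ : Matrix (Fin t → n) (Fin t → n) ℂ) :
    twirlMap t U ρ = twirl t U ρ := rfl

theorem twirl_mul (U V : unitaryGroup n ℂ) (ρ : Matrix (Fin t → n) (Fin t → n) ℂ) :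
    twirl t (U * V) ρ = twirl t V (twirl t U ρ) := by
  simp [twirl, tensorPow_mul, Matrix.conjTranspose_mul, Matrix.mul_assoc]

theorem twirl_one (ρ : Matrix (Fin t → n) (Fin t → n) ℂ) : twirl t 1 ρ = ρ := by
  simp [twirl, tensorPow_one]

theorem twirl_eq_self_iff (U : unitaryGroup n ℂ) (ρ : Matrix (Fin t → n) (Fin t → n) ℂ) :
    twirl t U ρ = ρ ↔ Commute ρ (tensorPow t (U : Matrix n n ℂ)) := by
  rw [twirl, commute_iff_eq]
  constructor
  · intro h
    conv_rhs => rw [← h]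
    rw [← Matrix.mul_assoc, ← Matrix.mul_assoc, tensorPow_mul_star, Matrix.one_mul]
  · intro h
    rw [Matrix.mul_assoc, h, ← Matrix.mul_assoc, star_tensorPow_mul, Matrix.one_mul]

end TensorPow

/-! ### Moment operators of convolutions and of images of Haar measure -/

section MomentOperator

variable {n : Type*} [Fintype n] [DecidableEq n] {t : ℕ}

/-- Linear functionals pass through the entrywise integral of the moment operator. -/
theorem apply_momentOperator (μ : Measure (unitaryGroup n ℂ)) [IsFiniteMeasure μ]
    (f : Matrix (Fin t → n) (Fin t → n) ℂ →ₗ[ℂ] ℂ) (ρ : Matrix (Fin t → n) (Fin t → n) ℂ) :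
    f (momentOperator t μ ρ) = ∫ U, f (twirl t U ρ) ∂μ := by
  have key : ∀ σ : Matrix (Fin t → n) (Fin t → n) ℂ,
      f σ = ∑ x, ∑ y, σ x y * f (Matrix.single x y 1) := by
    intro σ
    conv_lhs => rw [Matrix.matrix_eq_sum_single σ]
    simp only [map_sum]
    refine Finset.sum_congr rfl fun x _ => Finset.sum_congr rfl fun y _ => ?_
    rw [← smul_eq_mul, ← map_smul, Matrix.smul_single, smul_eq_mul, mul_one]
  rw [key]
  simp_rw [key (twirl _ _ _)]
  have hi : ∀ x y, Integrable (fun U => twirl t U ρ x y * f (Matrix.single x y 1)) μ :=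
    fun x y => (integrable_twirl_apply t μ ρ x y).mul_const _
  rw [integral_finsetSum _ fun x _ => integrable_finsetSum _ fun y _ => hi x y]
  refine Finset.sum_congr rfl fun x _ => ?_
  rw [integral_finsetSum _ fun y _ => hi x y]
  refine Finset.sum_congr rfl fun y _ => ?_
  rw [integral_mul_const]
  rfl

theorem momentOperator_apply (μ : Measure (unitaryGroup n ℂ)) [IsFiniteMeasure μ]
    (ρ : Matrix (Fin t → n) (Fin t → n) ℂ) (x y : Fin t → n) :
    momentOperator t μ ρ x y = ∫ U, twirl t U ρ x y ∂μ := rfl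

theorem linearMap_momentOperator_apply {m m' : Type*} (μ : Measure (unitaryGroup n ℂ))
    [IsFiniteMeasure μ] (f : Matrix (Fin t → n) (Fin t → n) ℂ →ₗ[ℂ] Matrix m m' ℂ)
    (ρ : Matrix (Fin t → n) (Fin t → n) ℂ) (x : m) (y : m') :
    f (momentOperator t μ ρ) x y = ∫ U, f (twirl t U ρ) x y ∂μ :=
  apply_momentOperator μ (Matrix.entryLinearMap ℂ ℂ x y ∘ₗ f) ρ

/-- The order is reversed because `ρ ↦ U† ρ U` is an anti-homomorphism in `U`. With the convention
of `circuitEnsemble`, circuits therefore become products of gate twirls in list order. -/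
theorem momentOperator_mconv (μ ν : Measure (unitaryGroup n ℂ)) [IsProbabilityMeasure μ]
    [IsProbabilityMeasure ν] [IsFiniteMeasure (μ.mconv ν)] :
    momentOperator t (μ.mconv ν) = momentOperator t ν * momentOperator t μ := by
  ext1 ρ
  ext x y
  rw [Module.End.mul_apply, linearMap_momentOperator_apply, momentOperator_apply,
    integral_mconv (integrable_twirl_apply t _ ρ x y)]
  simp only [twirl_mul, momentOperator_apply]

theorem momentOperator_dirac_one : momentOperator t (Measure.dirac (1 : unitaryGroup n ℂ)) = 1 := by
  ext1 ρ
  ext x y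
  rw [momentOperator_apply, integral_dirac, twirl_one]
  rfl

end MomentOperator

section GroupTwirl

variable {m n : Type*} [Fintype m] [DecidableEq m] [Fintype n] [DecidableEq n] {t : ℕ}

/-- The moment operator of the image of the Haar measure under a group homomorphism. -/
noncomputable def groupTwirl (t : ℕ) (φ : unitaryGroup m ℂ →* unitaryGroup n ℂ) :
    Module.End ℂ (Matrix (Fin t → n) (Fin t → n) ℂ) :=
  momentOperator t ((haar m).map φ)

variable {φ : unitaryGroup m ℂ →* unitaryGroup n ℂ}

theorem apply_groupTwirl (hφ : Measurable φ) (f : Matrix (Fin t → n) (Fin t → n) ℂ →ₗ[ℂ] ℂ)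
    (ρ : Matrix (Fin t → n) (Fin t → n) ℂ) :
    f (groupTwirl t φ ρ) = ∫ u, f (twirl t (φ u) ρ) ∂(haar m) := by
  rw [groupTwirl, apply_momentOperator, integral_map hφ.aemeasurable]
  have h : Continuous fun U : unitaryGroup n ℂ => f (twirl t U ρ) := by
    have := f.continuous_of_finiteDimensional
    refine this.comp (continuous_matrix fun x y => continuous_twirl_apply t ρ x y)
  exact h.aestronglyMeasurable

theorem groupTwirl_apply (hφ : Measurable φ) (ρ : Matrix (Fin t → n) (Fin t → n) ℂ) (x y : Fin t → n) :
    groupTwirl t φ ρ x y = ∫ u, twirl t (φ u) ρ x y ∂(haar m) :=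
  apply_groupTwirl hφ (Matrix.entryLinearMap ℂ ℂ x y) ρ

/-- The factor `φ v` is absorbed by right invariance of the Haar measure. -/
theorem twirl_groupTwirl (hφ : Measurable φ) (v : unitaryGroup m ℂ) (ρ : Matrix (Fin t → n) (Fin t → n) ℂ) :
    twirl t (φ v) (groupTwirl t φ ρ) = groupTwirl t φ ρ := by
  ext x y
  have := apply_groupTwirl hφ (Matrix.entryLinearMap ℂ ℂ x y ∘ₗ twirlMap t (φ v)) ρ
  simp only [LinearMap.comp_apply, twirlMap_apply, Matrix.entryLinearMap_apply, ← twirl_mul,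
    ← map_mul] at this
  rw [this, groupTwirl_apply hφ,
    integral_mul_right_eq_self (fun u => twirl t (φ u) ρ x y) v]

/-- This translates questions about ranges of gate projections into questions about commutants. -/
theorem groupTwirl_eq_self_iff (hφ : Measurable φ) (ρ : Matrix (Fin t → n) (Fin t → n) ℂ) :
    groupTwirl t φ ρ = ρ ↔ ∀ u, Commute ρ (tensorPow t (φ u : Matrix n n ℂ)) := by
  simp only [← twirl_eq_self_iff]
  constructor
  · intro h u
    rw [← h, twirl_groupTwirl hφ]
  · intro h
    ext x y
    simp [groupTwirl_apply hφ, h]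

theorem groupTwirl_mul_self (hφ : Measurable φ) : groupTwirl t φ * groupTwirl t φ = groupTwirl t φ := by
  refine LinearMap.ext fun ρ => ?_
  rw [Module.End.mul_apply, groupTwirl_eq_self_iff hφ]
  simp only [← twirl_eq_self_iff]
  exact fun u => twirl_groupTwirl hφ u ρ

theorem commute_groupTwirl (hφ : Measurable φ) (T : Module.End ℂ (Matrix (Fin t → n) (Fin t → n) ℂ))
    (h : ∀ u, Commute T (twirlMap t (φ u))) : Commute T (groupTwirl t φ) := by
  refine LinearMap.ext fun ρ => ?_
  ext x y
  have := apply_groupTwirl hφ (Matrix.entryLinearMap ℂ ℂ x y ∘ₗ T) ρ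
  simp only [LinearMap.comp_apply, Matrix.entryLinearMap_apply] at this
  rw [Module.End.mul_apply, Module.End.mul_apply, this, groupTwirl_apply hφ]
  refine integral_congr_ae (Filter.Eventually.of_forall fun u => ?_)
  exact congrFun (congrFun (LinearMap.congr_fun (h u).eq ρ) x) y

/-- Substitute `u ↦ u⁻¹` and cycle the trace. Together with `conjTranspose_groupTwirl` this gives
self-adjointness for the Hilbert–Schmidt inner product. -/
theorem trace_mul_groupTwirl (hφ : Measurable φ) (ρ σ : Matrix (Fin t → n) (Fin t → n) ℂ) :
    (σ * groupTwirl t φ ρ).trace = (groupTwirl t φ σ * ρ).trace := by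
  have h1 := apply_groupTwirl hφ (Matrix.traceLinearMap _ ℂ ℂ ∘ₗ LinearMap.mulLeft ℂ σ) ρ
  have h2 := apply_groupTwirl hφ (Matrix.traceLinearMap _ ℂ ℂ ∘ₗ LinearMap.mulRight ℂ ρ) σ
  simp only [LinearMap.comp_apply, Matrix.traceLinearMap_apply, LinearMap.mulLeft_apply,
    LinearMap.mulRight_apply] at h1 h2
  rw [h1, h2, ← integral_inv_eq_self]
  refine integral_congr_ae (Filter.Eventually.of_forall fun u => ?_)
  simp only [twirl, map_inv, UnitaryGroup.inv_val, star_eq_conjTranspose, conjTranspose_conjTranspose]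
  simp only [← Matrix.mul_assoc]
  rw [Matrix.trace_mul_comm]
  simp only [← Matrix.mul_assoc]

theorem conjTranspose_groupTwirl (hφ : Measurable φ) (ρ : Matrix (Fin t → n) (Fin t → n) ℂ) :
    (groupTwirl t φ ρ)ᴴ = groupTwirl t φ ρᴴ := by
  ext x y
  rw [conjTranspose_apply, groupTwirl_apply hφ, groupTwirl_apply hφ]
  simp only [Complex.star_def, ← integral_conj]
  refine integral_congr_ae (Filter.Eventually.of_forall fun u => ?_)
  simp only [← Complex.star_def, ← conjTranspose_apply]
  simp only [twirl, conjTranspose_mul, conjTranspose_tensorPow, conjTranspose_conjTranspose,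
    Matrix.mul_assoc]

end GroupTwirl

end RandomCircuit

namespace RandomCircuit

/-! ### From commuting with unitaries to commuting with a Lie algebra, and back -/

section SecondQuantization

variable {n : Type*} [Fintype n] [DecidableEq n] {t : ℕ}

/-- The matrix `A` acting on the tensor factor `s`. -/
def slot (s : Fin t) (A : Matrix n n ℂ) : Matrix (Fin t → n) (Fin t → n) ℂ :=
  piTensor (Function.update (fun _ => 1) s A)

theorem slot_apply (s : Fin t) (A : Matrix n n ℂ) (x y : Fin t → n) :
    slot s A x y = (∏ r ∈ Finset.univ.erase s, (1 : Matrix n n ℂ) (x r) (y r)) * A (x s) (y s) := by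
  rw [slot, piTensor, Matrix.of_apply, ← Finset.prod_erase_mul _ _ (Finset.mem_univ s)]
  rw [Function.update_self]
  congr 1
  refine Finset.prod_congr rfl fun r hr => ?_
  rw [Function.update_of_ne (Finset.ne_of_mem_erase hr)]

theorem slot_mul (s : Fin t) (A B : Matrix n n ℂ) : slot s (A * B) = slot s A * slot s B := by
  rw [slot, slot, slot, piTensor_mul]
  congr 1
  funext r
  by_cases h : r = s
  · subst h; simp
  · simp [h]

theorem slot_one (s : Fin t) : slot s (1 : Matrix n n ℂ) = 1 := by
  rw [slot, Function.update_eq_self_iff.mpr rfl, piTensor_one]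

theorem slot_add (s : Fin t) (A B : Matrix n n ℂ) : slot s (A + B) = slot s A + slot s B := by
  ext x y
  simp [slot_apply, mul_add]

theorem slot_smul (s : Fin t) (c : ℂ) (A : Matrix n n ℂ) : slot s (c • A) = c • slot s A := by
  ext x y
  simp [slot_apply, mul_left_comm]

theorem slot_pow (s : Fin t) (A : Matrix n n ℂ) (k : ℕ) : slot s (A ^ k) = slot s A ^ k := by
  induction k with
  | zero => simp [slot_one]
  | succ k ih => rw [pow_succ, pow_succ, slot_mul, ih]

theorem commute_slot {s r : Fin t} (h : s ≠ r) (A B : Matrix n n ℂ) :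
    Commute (slot s A) (slot r B) := by
  rw [commute_iff_eq, slot, slot, piTensor_mul, piTensor_mul]
  congr 1
  funext k
  by_cases hs : k = s
  · subst hs; simp [h]
  · simp [hs]

/-- The derivation `∑ₛ 1 ⊗ ⋯ ⊗ A ⊗ ⋯ ⊗ 1` on the `t`-fold tensor power. -/
def dGamma (t : ℕ) : Matrix n n ℂ →ₗ[ℂ] Matrix (Fin t → n) (Fin t → n) ℂ where
  toFun A := ∑ s, slot s A
  map_add' A B := by simp [slot_add, Finset.sum_add_distrib]
  map_smul' c A := by simp [slot_smul, Finset.smul_sum]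

theorem dGamma_apply (A : Matrix n n ℂ) : dGamma t A = ∑ s, slot s A := rfl

theorem dGamma_one : dGamma t (1 : Matrix n n ℂ) = (t : ℂ) • 1 := by
  simp [dGamma_apply, slot_one, Nat.cast_smul_eq_nsmul]

theorem dGamma_bracket (A B : Matrix n n ℂ) :
    dGamma t (A * B - B * A) = dGamma t A * dGamma t B - dGamma t B * dGamma t A := by
  rw [map_sub]
  simp only [dGamma_apply, Finset.sum_mul_sum]
  rw [Finset.sum_comm (f := fun i j => slot i B * slot j A), ← Finset.sum_sub_distrib,
    ← Finset.sum_sub_distrib]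
  refine Finset.sum_congr rfl fun s _ => ?_
  rw [← Finset.sum_sub_distrib, Finset.sum_eq_single s]
  · rw [slot_mul, slot_mul]
  · intro r _ hr
    rw [(commute_slot hr B A).eq, sub_self]
  · simp

/-- The matrices whose derivation on the tensor power commutes with `X`. -/
def commSubmodule (X : Matrix (Fin t → n) (Fin t → n) ℂ) : Submodule ℂ (Matrix n n ℂ) where
  carrier := {A | Commute X (dGamma t A)}
  zero_mem' := by simp
  add_mem' h h' := by simpa using Commute.add_right h h'
  smul_mem' c A h := by simpa using Commute.smul_right h c

theorem mem_commSubmodule {X : Matrix (Fin t → n) (Fin t → n) ℂ} {A : Matrix n n ℂ} :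
    A ∈ commSubmodule X ↔ Commute X (dGamma t A) := Iff.rfl

/-- `dGamma` is a Lie algebra homomorphism, so these matrices form a Lie subalgebra. -/
theorem bracket_mem_commSubmodule {X : Matrix (Fin t → n) (Fin t → n) ℂ} {A B : Matrix n n ℂ}
    (hA : A ∈ commSubmodule X) (hB : B ∈ commSubmodule X) :
    A * B - B * A ∈ commSubmodule X := by
  rw [mem_commSubmodule] at *
  rw [dGamma_bracket]
  exact (hA.mul_right hB).sub_right (hB.mul_right hA)

/-- Brackets are traceless; the identity supplies the one direction they cannot reach. -/
theorem one_mem_commSubmodule (X : Matrix (Fin t → n) (Fin t → n) ℂ) :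
    1 ∈ commSubmodule X := by
  rw [mem_commSubmodule, dGamma_one]
  exact (Commute.one_right X).smul_right _

/-- By Newton's identities `A^{⊗t}` is a polynomial in the derivations of the powers of `A`. -/
theorem commute_tensorPow_of_commute_dGamma {X : Matrix (Fin t → n) (Fin t → n) ℂ}
    {A : Matrix n n ℂ} (h : ∀ k, Commute X (dGamma t (A ^ k))) : Commute X (tensorPow t A) := by
  classical
  let S : Set (Matrix (Fin t → n) (Fin t → n) ℂ) := Set.range fun s : Fin t => slot s A
  have hS : ∀ a ∈ S, ∀ b ∈ S, a * b = b * a := by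
    rintro _ ⟨s, rfl⟩ _ ⟨r, rfl⟩
    by_cases hsr : s = r
    · rw [hsr]
    · exact (commute_slot hsr A A).eq
  -- The operators `slot s A` commute pairwise, so symmetric polynomials can be evaluated at them
  -- inside the commutative algebra they generate.
  have : IsMulCommutative (Algebra.adjoin ℂ S) := Algebra.isMulCommutative_adjoin ℂ hS
  let : CommRing (Algebra.adjoin ℂ S) :=
    { (Algebra.adjoin ℂ S).toRing with mul_comm := this.is_comm.comm }
  let v : Fin t → Algebra.adjoin ℂ S := fun s => ⟨slot s A, Algebra.subset_adjoin ⟨s, rfl⟩⟩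
  let φ : MvPolynomial (Fin t) ℂ →ₐ[ℂ] Matrix (Fin t → n) (Fin t → n) ℂ :=
    (Algebra.adjoin ℂ S).val.comp (MvPolynomial.aeval v)
  have hX : ∀ s, φ (MvPolynomial.X s) = slot s A := fun s => by simp [φ, v]
  have hpsum : ∀ k, φ (MvPolynomial.psum (Fin t) ℂ k) = dGamma t (A ^ k) := fun k => by
    simp only [MvPolynomial.psum, map_sum, map_pow, hX, dGamma_apply, slot_pow]
  -- Newton: `k e_k` is a signed sum of products `e_a p_b` with `a < k`, the power sums `p_b` are
  -- the given derivations, and `k` is invertible in `ℂ`.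
  have hesymm : ∀ k, Commute X (φ (MvPolynomial.esymm (Fin t) ℂ k)) := by
    intro k
    induction k using Nat.strong_induction_on with
    | _ k ih =>
      rcases Nat.eq_zero_or_pos k with rfl | hk
      · simp
      have hk' : (k : ℂ) ≠ 0 := by exact_mod_cast hk.ne'
      have := congrArg φ (MvPolynomial.mul_esymm_eq_sum (Fin t) ℂ k)
      have hc : Commute X (φ ((k : MvPolynomial (Fin t) ℂ) * MvPolynomial.esymm (Fin t) ℂ k)) := by
        rw [this]
        simp only [map_mul, map_sum, map_pow, map_neg, map_one]
        refine Commute.mul_right ((Commute.neg_one_right X).pow_right _)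
          (Commute.sum_right _ _ _ fun a ha => ?_)
        rw [Finset.mem_filter] at ha
        refine Commute.mul_right (Commute.mul_right ((Commute.neg_one_right X).pow_right _)
          (ih _ ha.2)) ?_
        rw [hpsum]
        exact h _
      have h2 : φ (MvPolynomial.esymm (Fin t) ℂ k) =
          (k : ℂ)⁻¹ • φ ((k : MvPolynomial (Fin t) ℂ) * MvPolynomial.esymm (Fin t) ℂ k) := by
        rw [map_mul, map_natCast, ← nsmul_eq_mul, ← Nat.cast_smul_eq_nsmul ℂ, smul_smul,
          inv_mul_cancel₀ hk', one_smul]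
      rw [h2]
      exact hc.smul_right _
  have hprod : ∀ T : Finset (Fin t), φ (∏ s ∈ T, MvPolynomial.X s) =
      piTensor fun s => if s ∈ T then A else 1 := by
    intro T
    induction T using Finset.induction_on with
    | empty => simp [piTensor_one]
    | insert s T hs ih =>
      rw [Finset.prod_insert hs, map_mul, ih, hX, slot, piTensor_mul]
      congr 1
      funext r
      by_cases hr : r = s
      · subst hr; simp [hs]
      · simp [hr]
  -- In `t` variables `e_t` is the product of all of them, that is, `A` in every slot.
  have ht : φ (MvPolynomial.esymm (Fin t) ℂ t) = tensorPow t A := by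
    have : Finset.powersetCard t (Finset.univ : Finset (Fin t)) = {Finset.univ} := by
      simpa using Finset.powersetCard_self (Finset.univ : Finset (Fin t))
    rw [MvPolynomial.esymm, this, Finset.sum_singleton, hprod]
    simp [tensorPow_eq_piTensor]
  rw [← ht]
  exact hesymm t

theorem hasDerivAt_tensorPow (P : Matrix n n ℂ) (x y : Fin t → n) :
    HasDerivAt (fun θ : ℝ => tensorPow t (1 + (Complex.exp (θ * Complex.I) - 1) • P) x y)
      (Complex.I * dGamma t P x y) 0 := by
  have hexp : HasDerivAt (fun θ : ℝ => Complex.exp (θ * Complex.I)) Complex.I 0 := by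
    have h := ((Complex.ofRealCLM.hasDerivAt (x := (0 : ℝ))).mul_const Complex.I).cexp
    simpa using h
  have h1 : ∀ s ∈ (Finset.univ : Finset (Fin t)),
      HasDerivAt (fun θ : ℝ => (1 + (Complex.exp (θ * Complex.I) - 1) • P) (x s) (y s))
        (Complex.I * P (x s) (y s)) 0 := by
    intro s _
    simp only [Matrix.add_apply, Matrix.smul_apply, smul_eq_mul]
    exact ((hexp.sub_const 1).mul_const _).const_add _
  have h2 := HasDerivAt.fun_finsetProd h1
  refine h2.congr_deriv ?_
  simp only [dGamma_apply, Matrix.sum_apply, slot_apply, Finset.mul_sum, smul_eq_mul]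
  refine Finset.sum_congr rfl fun s _ => ?_
  simp [mul_left_comm]

/-- For a projection `P` and `z = exp (iθ)` this matrix is `exp (iθP)`, so a one-parameter group is
available without the matrix exponential. -/
theorem one_add_smul_mem_unitaryGroup {P : Matrix n n ℂ} (h1 : P * P = P) (h2 : Pᴴ = P) {z : ℂ}
    (hz : star z * z = 1) : 1 + (z - 1) • P ∈ unitaryGroup n ℂ := by
  rw [mem_unitaryGroup_iff', star_eq_conjTranspose, conjTranspose_add, conjTranspose_smul, h2,
    conjTranspose_one, add_mul, mul_add, mul_add, one_mul, one_mul, mul_one, smul_mul_smul_comm, h1,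
    add_assoc, ← add_smul, ← add_smul]
  have : z - 1 + (star (z - 1) + star (z - 1) * (z - 1)) = 0 := by
    rw [star_sub, star_one]
    linear_combination hz
  rw [this, zero_smul, add_zero]

/-- Differentiate the commutation with the tensor power of `exp (iθ ι P)` at `θ = 0`. The map `ι`
will be the identity or a two-site embedding. -/
theorem dGamma_commute_of_projection {m : Type*} [Fintype m] [DecidableEq m]
    {X : Matrix (Fin t → n) (Fin t → n) ℂ} (ι : Matrix m m ℂ →ₗ[ℂ] Matrix n n ℂ) (h1 : ι 1 = 1)
    (h : ∀ u ∈ unitaryGroup m ℂ, Commute X (tensorPow t (ι u))) {P : Matrix m m ℂ}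
    (hP : P * P = P) (hP' : Pᴴ = P) : Commute X (dGamma t (ι P)) := by
  have hc : ∀ θ : ℝ, Commute X (tensorPow t (1 + (Complex.exp (θ * Complex.I) - 1) • ι P)) := by
    intro θ
    have := h _ (one_add_smul_mem_unitaryGroup hP hP' (z := Complex.exp (θ * Complex.I)) ?_)
    · simpa [map_add, h1] using this
    · rw [Complex.star_def, ← Complex.exp_conj, ← Complex.exp_add]
      simp
  rw [commute_iff_eq]
  ext x y
  have hl : HasDerivAt (fun θ : ℝ =>
      (X * tensorPow t (1 + (Complex.exp (θ * Complex.I) - 1) • ι P) : Matrix _ _ ℂ) x y)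
      (∑ z, X x z * (Complex.I * dGamma t (ι P) z y)) 0 := by
    simp only [Matrix.mul_apply]
    exact HasDerivAt.fun_sum fun z _ => (hasDerivAt_tensorPow (ι P) z y).const_mul _
  have hr : HasDerivAt (fun θ : ℝ =>
      (tensorPow t (1 + (Complex.exp (θ * Complex.I) - 1) • ι P) * X : Matrix _ _ ℂ) x y)
      (∑ z, (Complex.I * dGamma t (ι P) x z) * X z y) 0 := by
    simp only [Matrix.mul_apply]
    exact HasDerivAt.fun_sum fun z _ => (hasDerivAt_tensorPow (ι P) x z).mul_const _
  have he : (fun θ : ℝ => (X * tensorPow t (1 + (Complex.exp (θ * Complex.I) - 1) • ι P) : Matrix _ _ ℂ) x y) =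
      fun θ : ℝ => (tensorPow t (1 + (Complex.exp (θ * Complex.I) - 1) • ι P) * X : Matrix _ _ ℂ) x y := by
    funext θ
    rw [(hc θ).eq]
  rw [he] at hl
  have hu := hl.unique hr
  apply mul_left_cancel₀ Complex.I_ne_zero
  rw [Matrix.mul_apply, Matrix.mul_apply, Finset.mul_sum, Finset.mul_sum]
  calc _ = ∑ z, X x z * (Complex.I * dGamma t (ι P) z y) :=
        Finset.sum_congr rfl fun z _ => by ring
    _ = _ := hu
    _ = _ := Finset.sum_congr rfl fun z _ => by ring

/-- Matrix units are linear combinations of orthogonal projections. -/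
theorem single_mem_of_projection_mem {m : Type*} [Fintype m] [DecidableEq m]
    (L : Submodule ℂ (Matrix m m ℂ)) (h : ∀ P : Matrix m m ℂ, P * P = P → Pᴴ = P → P ∈ L)
    (a b : m) : Matrix.single a b (1 : ℂ) ∈ L := by
  have hd : ∀ a : m, Matrix.single a a (1 : ℂ) ∈ L := fun a =>
    h _ (by simp) (by simp [Matrix.conjTranspose_single])
  by_cases hab : a = b
  · rw [hab]; exact hd b
  have hba : b ≠ a := fun h => hab h.symm
  -- The projection onto the line through `e_a + (star w) e_b`.
  have hP : ∀ w : ℂ, star w * w = 1 → (1 / 2 : ℂ) • (Matrix.single a a 1 + Matrix.single b b 1 +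
      (w • Matrix.single a b 1 + star w • Matrix.single b a 1)) ∈ L := by
    intro w hw
    apply h
    · have hw' : w * star w = 1 := by rw [mul_comm, hw]
      have h4 : (Matrix.single a a 1 + Matrix.single b b 1 +
          (w • Matrix.single a b 1 + star w • Matrix.single b a 1)) *
          (Matrix.single a a 1 + Matrix.single b b 1 +
          (w • Matrix.single a b 1 + star w • Matrix.single b a 1)) =
          (2 : ℂ) • (Matrix.single a a 1 + Matrix.single b b 1 +
          (w • Matrix.single a b 1 + star w • Matrix.single b a (1 : ℂ))) := by
        simp only [mul_add, add_mul, Matrix.smul_mul, Matrix.mul_smul,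
          Matrix.single_mul_single_same, Matrix.single_mul_single_of_ne (1 : ℂ) _ _ _ hab,
          Matrix.single_mul_single_of_ne (1 : ℂ) _ _ _ hba, smul_zero, smul_smul, hw, hw', mul_one]
        module
      rw [smul_mul_smul_comm, h4, smul_smul]
      norm_num
    · simp only [conjTranspose_smul, conjTranspose_add, Matrix.conjTranspose_single, star_one,
        star_star]
      have : star (1 / 2 : ℂ) = 1 / 2 := by simp
      rw [this, add_comm (star w • _)]
  have h1 := hP 1 (by simp)
  have h2 := hP Complex.I (by simp)
  -- Combining `w = 1` and `w = I` cancels the unit at `(b, a)`; the last term removes the diagonal.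
  have h3 : Matrix.single a b (1 : ℂ) =
      ((1 / 2 : ℂ) • (Matrix.single a a 1 + Matrix.single b b 1 +
        ((1 : ℂ) • Matrix.single a b 1 + star (1 : ℂ) • Matrix.single b a 1))) +
      (-Complex.I) • ((1 / 2 : ℂ) • (Matrix.single a a 1 + Matrix.single b b 1 +
        (Complex.I • Matrix.single a b 1 + star Complex.I • Matrix.single b a 1))) +
      ((Complex.I - 1) / 2) • (Matrix.single a a 1 + Matrix.single b b 1) := by
    ext i j
    simp only [Matrix.smul_apply, Matrix.add_apply, smul_eq_mul, star_one, Complex.star_def,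
      Complex.conj_I]
    linear_combination (1 / 2) * (Matrix.single a b (1 : ℂ) i j - Matrix.single b a (1 : ℂ) i j) *
      Complex.I_mul_I
  rw [h3]
  exact L.add_mem (L.add_mem h1 (L.smul_mem _ h2)) (L.smul_mem _ (L.add_mem (hd a) (hd b)))

theorem dGamma_commute {m : Type*} [Fintype m] [DecidableEq m]
    {X : Matrix (Fin t → n) (Fin t → n) ℂ} (ι : Matrix m m ℂ →ₗ[ℂ] Matrix n n ℂ) (h1 : ι 1 = 1)
    (h : ∀ u ∈ unitaryGroup m ℂ, Commute X (tensorPow t (ι u))) (A : Matrix m m ℂ) :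
    ι A ∈ commSubmodule X := by
  change A ∈ (commSubmodule X).comap ι
  rw [Matrix.matrix_eq_sum_single A]
  refine Submodule.sum_mem _ fun a _ => Submodule.sum_mem _ fun b _ => ?_
  have := single_mem_of_projection_mem ((commSubmodule X).comap ι)
    (fun P hP hP' => dGamma_commute_of_projection ι h1 h hP hP') a b
  simpa [Matrix.smul_single] using Submodule.smul_mem _ (A a b) this

/-- An operator commuting with `dGamma` of all off-diagonal matrix units commutes with `A^{⊗t}`. -/
theorem commute_tensorPow_of_single_mem {X : Matrix (Fin t → n) (Fin t → n) ℂ}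
    (h : ∀ x y : n, x ≠ y → Matrix.single x y (1 : ℂ) ∈ commSubmodule X) (A : Matrix n n ℂ) :
    Commute X (tensorPow t A) := by
  -- The bracket of the units at `(x, y)` and `(y, x)` is this difference.
  have hdiff : ∀ x y : n, Matrix.single x x (1 : ℂ) - Matrix.single y y 1 ∈ commSubmodule X := by
    intro x y
    by_cases hxy : x = y
    · simp [hxy]
    have := bracket_mem_commSubmodule (h x y hxy) (h y x (Ne.symm hxy))
    simpa using this
  have hdiag : ∀ x : n, Matrix.single x x (1 : ℂ) ∈ commSubmodule X := by
    intro x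
    have hc : (Fintype.card n : ℂ) ≠ 0 := by
      have : Nonempty n := ⟨x⟩
      exact_mod_cast Fintype.card_ne_zero
    -- Sum the differences over `y` and add back the identity, the sum of all diagonal units.
    have h1 : (Fintype.card n : ℂ) • Matrix.single x x (1 : ℂ) =
        ∑ y : n, (Matrix.single x x (1 : ℂ) - Matrix.single y y 1) + 1 := by
      have : ∑ y : n, Matrix.single y y (1 : ℂ) = 1 := by
        ext i j
        simp [Matrix.sum_apply, Matrix.single_apply, Matrix.one_apply, 
          Finset.filter_and, Finset.filter_eq']
        by_cases hij : i = j <;> simp [hij, eq_comm]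
      rw [Finset.sum_sub_distrib, this, sub_add_cancel, Finset.sum_const, Finset.card_univ,
        Nat.cast_smul_eq_nsmul]
    have h2 := Submodule.smul_mem _ (Fintype.card n : ℂ)⁻¹
      (Submodule.add_mem _ (Submodule.sum_mem _ fun y (_ : y ∈ Finset.univ) => hdiff x y) (one_mem_commSubmodule X))
    rwa [← h1, smul_smul, inv_mul_cancel₀ hc, one_smul] at h2
  have hall : ∀ B : Matrix n n ℂ, B ∈ commSubmodule X := by
    intro B
    rw [Matrix.matrix_eq_sum_single B]
    refine Submodule.sum_mem _ fun a _ => Submodule.sum_mem _ fun b _ => ?_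
    have : Matrix.single a b (1 : ℂ) ∈ commSubmodule X := by
      by_cases hab : a = b
      · rw [hab]; exact hdiag b
      · exact h a b hab
    simpa [Matrix.smul_single] using Submodule.smul_mem _ (B a b) this
  exact commute_tensorPow_of_commute_dGamma fun k => hall (A ^ k)

end SecondQuantization

end RandomCircuit

namespace RandomCircuit

/-! ### Two-site gates, their commutation, and universality -/

section Gates

variable {N q t : ℕ}

/-- The two-site matrix `A` acting on sites `i, i+1`. -/
def embed (i : Fin (N - 1)) :
    Matrix (Fin q × Fin q) (Fin q × Fin q) ℂ →ₗ[ℂ] Matrix (Fin N → Fin q) (Fin N → Fin q) ℂ where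
  toFun A := (A ⊗ₖ (1 : Matrix ({k : Fin N // k ≠ leftSite i ∧ k ≠ rightSite i} → Fin q)
      ({k : Fin N // k ≠ leftSite i ∧ k ≠ rightSite i} → Fin q) ℂ)).submatrix
      (splitSites q i) (splitSites q i)
  map_add' A B := by simp [add_kronecker, submatrix_add]
  map_smul' c A := by simp [smul_kronecker, submatrix_smul]

theorem coe_gate (i : Fin (N - 1)) (u : unitaryGroup (Fin q × Fin q) ℂ) :
    (gate i u : Matrix (Fin N → Fin q) (Fin N → Fin q) ℂ) = embed i (u : Matrix _ _ ℂ) := rfl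

theorem embed_mul (i : Fin (N - 1)) (A B : Matrix (Fin q × Fin q) (Fin q × Fin q) ℂ) :
    embed i (A * B) = embed i A * embed i B := by
  simp only [embed, LinearMap.coe_mk, AddHom.coe_mk]
  rw [submatrix_mul_equiv, ← mul_kronecker_mul, Matrix.one_mul]

theorem conjTranspose_embed (i : Fin (N - 1)) (A : Matrix (Fin q × Fin q) (Fin q × Fin q) ℂ) :
    (embed i A)ᴴ = embed i Aᴴ := by
  simp only [embed, LinearMap.coe_mk, AddHom.coe_mk]
  rw [conjTranspose_submatrix, conjTranspose_kronecker, conjTranspose_one]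

theorem embed_one (i : Fin (N - 1)) :
    embed i (1 : Matrix (Fin q × Fin q) (Fin q × Fin q) ℂ) = 1 := by
  simp only [embed, LinearMap.coe_mk, AddHom.coe_mk]
  rw [one_kronecker_one, submatrix_one_equiv]

theorem embed_apply (i : Fin (N - 1)) (A : Matrix (Fin q × Fin q) (Fin q × Fin q) ℂ)
    (x y : Fin N → Fin q) : embed i A x y =
      A (x (leftSite i), x (rightSite i)) (y (leftSite i), y (rightSite i)) *
        if ∀ k, k ≠ leftSite i ∧ k ≠ rightSite i → x k = y k then 1 else 0 := by
  simp only [embed, LinearMap.coe_mk, AddHom.coe_mk, submatrix_apply, kroneckerMap_apply, splitSites,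
    Equiv.coe_fn_mk, Matrix.one_apply, funext_iff, Subtype.forall]

theorem embed_single (i : Fin (N - 1)) (a b c d : Fin q) :
    embed i (Matrix.single (a, c) (b, d) 1) = piTensor fun j : Fin N =>
      if j = leftSite i then Matrix.single a b (1 : ℂ)
      else if j = rightSite i then Matrix.single c d 1 else 1 := by
  ext x y
  rw [embed_apply, piTensor, Matrix.of_apply,
    ← Finset.mul_prod_erase _ _ (Finset.mem_univ (leftSite i)),
    ← Finset.mul_prod_erase _ _ (Finset.mem_erase.mpr
      ⟨rightSite_ne_leftSite i, Finset.mem_univ (rightSite i)⟩)]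
  rw [if_pos rfl, if_neg (rightSite_ne_leftSite i), if_pos rfl, ← mul_assoc]
  congr 1
  · simp only [Matrix.single_apply, Prod.mk.injEq, ← ite_and, mul_boole]
    congr 1
    simp only [eq_iff_iff]
    tauto
  · rw [Finset.prod_congr rfl (g := fun j => if x j = y j then (1 : ℂ) else 0)]
    · rw [Finset.prod_boole]
      congr 1
      simp only [Finset.mem_erase, Finset.mem_univ, and_true, eq_iff_iff]
      exact forall_congr' fun k => ⟨fun h h' => h ⟨h'.2, h'.1⟩, fun h h' => h ⟨h'.2, h'.1⟩⟩
    · intro j hj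
      simp only [Finset.mem_erase, Finset.mem_univ, and_true] at hj
      rw [if_neg hj.2, if_neg hj.1, Matrix.one_apply]

theorem linearMap_ext_single {m : Type*} [Fintype m] [DecidableEq m] {E : Type*} [AddCommMonoid E]
    [Module ℂ E] {f g : Matrix m m ℂ →ₗ[ℂ] E}
    (h : ∀ a b, f (Matrix.single a b 1) = g (Matrix.single a b 1)) : f = g := by
  refine LinearMap.ext fun A => ?_
  rw [Matrix.matrix_eq_sum_single A]
  simp only [map_sum]
  refine Finset.sum_congr rfl fun a _ => Finset.sum_congr rfl fun b _ => ?_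
  have : Matrix.single a b (A a b) = A a b • Matrix.single a b (1 : ℂ) := by
    simp [Matrix.smul_single]
  rw [this, map_smul, map_smul, h]

/-- Matrices acting on disjoint pairs of sites commute. -/
theorem commute_embed {i j : Fin (N - 1)} (h : (i : ℕ) + 1 < j)
    (A B : Matrix (Fin q × Fin q) (Fin q × Fin q) ℂ) : Commute (embed i A) (embed j B) := by
  have h1 : ∀ a b a' b', Commute (embed (N := N) i (Matrix.single a b 1 : Matrix (Fin q × Fin q) _ ℂ))
      (embed j (Matrix.single a' b' 1)) := by
    rintro ⟨a, c⟩ ⟨b, d⟩ ⟨a', c'⟩ ⟨b', d'⟩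
    rw [embed_single, embed_single, commute_iff_eq, piTensor_mul, piTensor_mul]
    congr 1
    funext k
    by_cases hk : k = leftSite j ∨ k = rightSite j
    · have h2 : k ≠ leftSite i ∧ k ≠ rightSite i := by
        simp only [leftSite, rightSite, Fin.ext_iff, ne_eq] at hk ⊢
        omega
      simp [h2.1, h2.2]
    · rw [not_or] at hk
      simp [hk.1, hk.2]
  have h2 : ∀ a b, (LinearMap.mulLeft ℂ (embed i (Matrix.single a b 1))) ∘ₗ embed j =
      (LinearMap.mulRight ℂ (embed i (Matrix.single a b 1))) ∘ₗ embed (q := q) j := fun a b =>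
    linearMap_ext_single fun a' b' => h1 a b a' b'
  have h3 : (LinearMap.mulRight ℂ (embed j B)) ∘ₗ embed i =
      (LinearMap.mulLeft ℂ (embed j B)) ∘ₗ embed (q := q) i :=
    linearMap_ext_single fun a b => LinearMap.congr_fun (h2 a b) B
  exact LinearMap.congr_fun h3 A

/-- Placing a two-qudit gate on sites `i, i+1`, as a group homomorphism. -/
def gateHom (i : Fin (N - 1)) :
    unitaryGroup (Fin q × Fin q) ℂ →* unitaryGroup (Fin N → Fin q) ℂ where
  toFun := gate i
  map_one' := Subtype.ext (embed_one i)
  map_mul' u v := by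
    apply Subtype.ext
    rw [coe_gate, UnitaryGroup.mul_val, embed_mul]
    rfl

theorem coe_gateHom (i : Fin (N - 1)) (u : unitaryGroup (Fin q × Fin q) ℂ) :
    (gateHom i u : Matrix (Fin N → Fin q) (Fin N → Fin q) ℂ) = embed i u.1 := rfl

theorem measurable_gateHom (i : Fin (N - 1)) : Measurable (gateHom (q := q) i) := measurable_gate i

theorem momentOperator_gateEnsemble (i : Fin (N - 1)) :
    momentOperator t (gateEnsemble q i) = groupTwirl t (gateHom i) := rfl

theorem momentOperator_haar {n : Type*} [Fintype n] [DecidableEq n] :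
    momentOperator t (haar n) = groupTwirl t (MonoidHom.id (unitaryGroup n ℂ)) := by
  simp only [groupTwirl, MonoidHom.coe_id, Measure.map_id]

theorem momentOperator_circuitEnsemble (c : List (Fin (N - 1))) :
    momentOperator t (circuitEnsemble q c) =
      (c.map fun i => groupTwirl t (gateHom (q := q) i)).prod := by
  induction c with
  | nil => exact momentOperator_dirac_one
  | cons i c ih =>
    rw [List.map_cons, List.prod_cons, ← ih, ← momentOperator_gateEnsemble]
    exact momentOperator_mconv _ _

theorem groupTwirl_gateHom_eq_self_iff (i : Fin (N - 1))
    (X : Matrix (Fin t → Fin N → Fin q) (Fin t → Fin N → Fin q) ℂ) :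
    groupTwirl t (gateHom i) X = X ↔
      ∀ u ∈ unitaryGroup (Fin q × Fin q) ℂ, Commute X (tensorPow t (embed i u)) := by
  rw [groupTwirl_eq_self_iff (measurable_gateHom i)]
  exact ⟨fun h u hu => h ⟨u, hu⟩, fun h u => h u u.2⟩

theorem embed_mem_commSubmodule {i : Fin (N - 1)}
    {X : Matrix (Fin t → Fin N → Fin q) (Fin t → Fin N → Fin q) ℂ}
    (h : groupTwirl t (gateHom i) X = X) (A : Matrix (Fin q × Fin q) (Fin q × Fin q) ℂ) :
    embed i A ∈ commSubmodule X :=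
  dGamma_commute (embed i) (embed_one i) ((groupTwirl_gateHom_eq_self_iff i X).mp h) A

theorem commute_groupTwirl_gateHom {i j : Fin (N - 1)} (h : (i : ℕ) + 1 < j) :
    Commute (groupTwirl t (gateHom (q := q) i)) (groupTwirl t (gateHom j)) := by
  refine commute_groupTwirl (measurable_gateHom j) _ fun v => Commute.symm ?_
  refine commute_groupTwirl (measurable_gateHom i) _ fun u => ?_
  have huv : gateHom i u * gateHom j v = gateHom j v * gateHom (N := N) i u := by
    apply Subtype.ext
    rw [UnitaryGroup.mul_val, UnitaryGroup.mul_val]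
    rw [coe_gateHom, coe_gateHom, (commute_embed h u.1 v.1).eq]
  refine LinearMap.ext fun ρ => ?_
  rw [Module.End.mul_apply, Module.End.mul_apply, twirlMap_apply, twirlMap_apply, twirlMap_apply,
    twirlMap_apply, ← twirl_mul, ← twirl_mul, huv]

/-- The matrix unit on the sites `0, …, k`, tensored with the identity on the others. -/
def prefixUnit (k : ℕ) (x y : Fin N → Fin q) : Matrix (Fin N → Fin q) (Fin N → Fin q) ℂ :=
  piTensor fun j => if (j : ℕ) ≤ k then Matrix.single (x j) (y j) 1 else 1

theorem prefixUnit_mul (k : ℕ) (x y z : Fin N → Fin q) :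
    prefixUnit k x y * prefixUnit k y z = prefixUnit k x z := by
  rw [prefixUnit, prefixUnit, prefixUnit, piTensor_mul]
  congr 1
  funext j
  by_cases hj : (j : ℕ) ≤ k <;> simp [hj]

theorem prefixUnit_mul_of_ne {k : ℕ} {x y y' z : Fin N → Fin q} {j : Fin N} (hj : (j : ℕ) ≤ k)
    (h : y j ≠ y' j) : prefixUnit k x y * prefixUnit k y' z = 0 := by
  rw [prefixUnit, prefixUnit, piTensor_mul]
  exact piTensor_eq_zero j (by simp [hj, h])

/-- The Lie algebra generated by two-site matrices contains all off-diagonal matrix units. -/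
theorem prefixUnit_mem_commSubmodule (hq : 2 ≤ q)
    {X : Matrix (Fin t → Fin N → Fin q) (Fin t → Fin N → Fin q) ℂ}
    (h : ∀ i (A : Matrix (Fin q × Fin q) (Fin q × Fin q) ℂ), embed i A ∈ commSubmodule X)
    (k : ℕ) (hk : 1 ≤ k) : k < N → ∀ (x y : Fin N → Fin q) (j : Fin N), (j : ℕ) ≤ k → x j ≠ y j →
      prefixUnit k x y ∈ commSubmodule X := by
  induction k, hk using Nat.le_induction with
  | base =>
    intro hN x y j hj hxy
    have h0 := h ⟨0, by omega⟩ (Matrix.single (x ⟨0, by omega⟩, x ⟨1, hN⟩)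
      (y ⟨0, by omega⟩, y ⟨1, hN⟩) 1)
    rw [embed_single] at h0
    convert h0 using 1
    rw [prefixUnit]
    congr 1
    funext j
    by_cases h1 : j = ⟨0, by omega⟩
    · subst h1; simp [leftSite]
    · by_cases h2 : j = ⟨1, by omega⟩
      · subst h2; simp [leftSite, rightSite]
      · have h3 : ¬ (j : ℕ) ≤ 1 := by
          simp only [Fin.ext_iff] at h1 h2
          omega
        simp [leftSite, rightSite, h1, h2, h3]
  | succ k hk ih =>
    intro hN
    have main : ∀ (x y : Fin N → Fin q), x ⟨k, by omega⟩ ≠ y ⟨k, by omega⟩ →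
        prefixUnit (k + 1) x y ∈ commSubmodule X := by
      intro x y hxy
      set l : Fin N := ⟨k, by omega⟩ with hl
      set r : Fin N := ⟨k + 1, hN⟩ with hr
      have h1 := ih (by omega) x y l le_rfl hxy
      -- Bracketing with this two-site unit appends site `k + 1`. It is diagonal with label `y l` on
      -- the shared site, and `x l ≠ y l` makes one of the two products vanish.
      have h2 := h ⟨k, by omega⟩ (Matrix.single (y l, x r) (y l, y r) 1)
      have h3 := bracket_mem_commSubmodule h1 h2
      have h0 : embed ⟨k, by omega⟩ (Matrix.single (y l, x r) (y l, y r) 1) * prefixUnit k x y =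
          0 := by
        rw [embed_single, prefixUnit, piTensor_mul]
        refine piTensor_eq_zero l ?_
        have hl' : l = leftSite (⟨k, by omega⟩ : Fin (N - 1)) := rfl
        have hlk : (l : ℕ) ≤ k := le_rfl
        rw [if_pos hl', if_pos hlk]
        exact Matrix.single_mul_single_of_ne _ _ _ _ hxy.symm _
      rw [h0, sub_zero, embed_single, prefixUnit, piTensor_mul] at h3
      · convert h3 using 1
        rw [prefixUnit]
        congr 1
        funext j
        by_cases hj1 : j = l
        · subst hj1; simp [leftSite, hl]
        · by_cases hj2 : j = r
          · subst hj2; simp [leftSite, rightSite, hr]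
          · have h4 : ((j : ℕ) ≤ k + 1) = ((j : ℕ) ≤ k) := by
              simp only [hl, hr, Fin.ext_iff] at hj1 hj2
              simp only [eq_iff_iff]
              omega
            have h5 : j ≠ leftSite (⟨k, by omega⟩ : Fin (N - 1)) := hj1
            have h6 : j ≠ rightSite (⟨k, by omega⟩ : Fin (N - 1)) := hj2
            simp [h4, h5, h6]
    intro x y j hj hxy
    -- If the labels agree at site `k`, pass through a label `z` that differs there, which exists
    -- because `q ≥ 2`. The bracket of the units `(x, z)` and `(z, y)` is the unit `(x, y)`, the
    -- reversed product vanishing at site `j`.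
    by_cases hc : x ⟨k, by omega⟩ = y ⟨k, by omega⟩
    · have : Nontrivial (Fin q) := Fin.nontrivial_iff_two_le.mpr hq
      obtain ⟨a, ha⟩ := exists_ne (x ⟨k, by omega⟩)
      let z : Fin N → Fin q := Function.update x ⟨k, by omega⟩ a
      have hz : z ⟨k, by omega⟩ = a := by simp [z]
      have h1 := main x z (by rw [hz]; exact ha.symm)
      have h2 := main z y (by rw [hz, ← hc]; exact ha)
      have h3 := bracket_mem_commSubmodule h1 h2
      rwa [prefixUnit_mul, prefixUnit_mul_of_ne hj (Ne.symm hxy), sub_zero] at h3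
    · exact main x y hc

/-- Universality of nearest-neighbour gates: what is invariant under all of them is invariant
under all unitaries. -/
theorem groupTwirl_id_eq_self (hN : 2 ≤ N) (hq : 2 ≤ q)
    {X : Matrix (Fin t → Fin N → Fin q) (Fin t → Fin N → Fin q) ℂ}
    (h : ∀ i : Fin (N - 1), groupTwirl t (gateHom i) X = X) :
    groupTwirl t (MonoidHom.id (unitaryGroup (Fin N → Fin q) ℂ)) X = X := by
  rw [groupTwirl_eq_self_iff measurable_id]
  intro u
  refine commute_tensorPow_of_single_mem (fun x y hxy => ?_) _
  obtain ⟨j, hj⟩ := Function.ne_iff.mp hxy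
  have := prefixUnit_mem_commSubmodule hq (fun i A => embed_mem_commSubmodule (h i) A) (N - 1)
    (by omega) (by omega) x y j (by omega) hj
  rw [prefixUnit] at this
  have h2 : ∀ j : Fin N, (j : ℕ) ≤ N - 1 := fun j => by omega
  simpa only [h2, if_true, piTensor_single] using this

theorem groupTwirl_gateHom_mul_groupTwirl_id (i : Fin (N - 1)) :
    groupTwirl t (gateHom (q := q) i) * groupTwirl t (MonoidHom.id _) =
      groupTwirl t (MonoidHom.id _) := by
  refine LinearMap.ext fun X => ?_
  rw [Module.End.mul_apply, groupTwirl_eq_self_iff (measurable_gateHom i)]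
  intro u
  rw [← twirl_eq_self_iff]
  exact twirl_groupTwirl (φ := MonoidHom.id _) measurable_id (gateHom i u) X

theorem sum_single_eq_one {m : Type*} [Fintype m] [DecidableEq m] :
    ∑ a : m, Matrix.single a a (1 : ℂ) = 1 := by
  ext x y
  simp only [Matrix.sum_apply, Matrix.single_apply, Matrix.one_apply]
  by_cases hxy : x = y
  · simp [hxy]
  · rw [if_neg hxy]
    exact Finset.sum_eq_zero fun z _ => if_neg fun h => hxy (h.1.symm.trans h.2)

theorem piTensor_update_sum {ι n κ : Type*} [Fintype ι] [DecidableEq ι] [Fintype n] [Fintype κ]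
    (f : ι → Matrix n n ℂ) (k : ι) (g : κ → Matrix n n ℂ) :
    piTensor (Function.update f k (∑ c, g c)) = ∑ c, piTensor (Function.update f k (g c)) := by
  ext x y
  simp only [Matrix.sum_apply, piTensor, Matrix.of_apply]
  have h : ∀ A : Matrix n n ℂ, ∏ s, Function.update f k A s (x s) (y s) =
      A (x k) (y k) * ∏ s ∈ Finset.univ.erase k, f s (x s) (y s) := by
    intro A
    rw [← Finset.mul_prod_erase _ _ (Finset.mem_univ k), Function.update_self]
    congr 1
    refine Finset.prod_congr rfl fun s hs => ?_
    rw [Function.update_of_ne (Finset.ne_of_mem_erase hs)]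
  simp only [h, Matrix.sum_apply, Finset.sum_mul]

/-- For `t = 1` the gate twirls on overlapping pairs commute as well. -/
theorem groupTwirl_one_gateHom_invariant {i j : Fin (N - 1)} (hij : (i : ℕ) + 1 = j)
    {X : Matrix (Fin 1 → Fin N → Fin q) (Fin 1 → Fin N → Fin q) ℂ}
    (h : groupTwirl 1 (gateHom j) X = X) :
    groupTwirl 1 (gateHom j) (groupTwirl 1 (gateHom i) X) = groupTwirl 1 (gateHom i) X := by
  set Y := groupTwirl 1 (gateHom i) X with hY
  -- For `t = 1` the tensor power is linear in the operator, so commutation need only be tested on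
  -- products of one-site matrices.
  have hd : ∀ A : Matrix (Fin N → Fin q) (Fin N → Fin q) ℂ, dGamma 1 A = tensorPow 1 A := by
    intro A
    ext x y
    simp [dGamma_apply, slot_apply, tensorPow]
  have hYi : groupTwirl 1 (gateHom i) Y = Y := by
    rw [hY, ← Module.End.mul_apply, groupTwirl_mul_self (measurable_gateHom i)]
  let e : Fin N → Fin q → Fin q → Matrix (Fin N → Fin q) (Fin N → Fin q) ℂ := fun k a b =>
    piTensor fun j => if j = k then Matrix.single a b 1 else 1
  have hright : ∀ (i : Fin (N - 1)) a b, e (rightSite i) a b =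
      embed i (∑ c, Matrix.single (c, a) (c, b) 1) := by
    intro i a b
    simp only [map_sum, embed_single, e]
    have := piTensor_update_sum (fun j : Fin N => if j = rightSite i then Matrix.single a b 1 else 1)
      (leftSite i) fun c : Fin q => Matrix.single c c (1 : ℂ)
    rw [sum_single_eq_one, Function.update_eq_self_iff.mpr (by
      rw [if_neg (rightSite_ne_leftSite i).symm])] at this
    rw [this]
    refine Finset.sum_congr rfl fun c _ => ?_
    congr 1
    funext k
    simp [Function.update_apply]
  have hsplit : ∀ a b c d, embed j (Matrix.single (a, c) (b, d) 1) =
      e (rightSite i) a b * e (rightSite j) c d := by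
    intro a b c d
    have hl : rightSite i = leftSite j := Fin.ext hij
    rw [embed_single, hl, piTensor_mul]
    congr 1
    funext k
    by_cases hk : k = leftSite j
    · subst hk; simp [(rightSite_ne_leftSite j).symm]
    · simp [hk]
  have hcomm : ∀ c d (A : Matrix (Fin q × Fin q) (Fin q × Fin q) ℂ),
      Commute (e (rightSite j) c d) (embed i A) := by
    intro c d A
    have h1 : (LinearMap.mulLeft ℂ (e (rightSite j) c d)) ∘ₗ embed i =
        (LinearMap.mulRight ℂ (e (rightSite j) c d)) ∘ₗ embed (q := q) i := by
      refine linearMap_ext_single ?_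
      rintro ⟨a, a'⟩ ⟨b, b'⟩
      simp only [LinearMap.comp_apply, LinearMap.mulLeft_apply, LinearMap.mulRight_apply,
        embed_single, e, piTensor_mul]
      congr 1
      funext k
      by_cases hk : k = rightSite j
      · have h2 : k ≠ leftSite i ∧ k ≠ rightSite i := by
          simp only [leftSite, rightSite, Fin.ext_iff, ne_eq] at hk ⊢
          omega
        simp [h2.1, h2.2]
      · simp [hk]
    exact LinearMap.congr_fun h1 A
  have hYl : ∀ a b, Commute Y (tensorPow 1 (e (rightSite i) a b)) := fun a b => by
    rw [← hd, hright]
    exact embed_mem_commSubmodule hYi _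
  -- Matrices on the outer site of pair `j` commute with all gates on pair `i`. Taking the
  -- commutator with them thus passes through the twirl, and it annihilates `X`.
  have hYr : ∀ c d, Commute Y (tensorPow 1 (e (rightSite j) c d)) := fun c d => by
    have hX : Commute X (tensorPow 1 (e (rightSite j) c d)) := by
      rw [← hd, hright]
      exact embed_mem_commSubmodule h _
    set C := tensorPow 1 (e (rightSite j) c d) with hC
    have hCu : ∀ A : Matrix (Fin q × Fin q) (Fin q × Fin q) ℂ,
        C * tensorPow 1 (embed i A) = tensorPow 1 (embed i A) * C := fun A => by
      rw [hC, ← tensorPow_mul, ← tensorPow_mul, (hcomm c d A).eq]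
    have hT := commute_groupTwirl (measurable_gateHom i)
      (LinearMap.mulLeft ℂ C - LinearMap.mulRight ℂ C) (fun u => by
        refine LinearMap.ext fun ρ => ?_
        change C * twirl 1 (gate i u) ρ - twirl 1 (gate i u) ρ * C =
          twirl 1 (gate i u) (C * ρ - ρ * C)
        rw [twirl, twirl, coe_gate, conjTranspose_embed, Matrix.mul_sub, Matrix.sub_mul]
        congr 1
        · rw [← Matrix.mul_assoc, ← Matrix.mul_assoc, hCu, Matrix.mul_assoc _ C ρ]
        · rw [Matrix.mul_assoc, ← hCu]
          simp only [Matrix.mul_assoc])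
    have h0 := LinearMap.congr_fun hT.eq X
    simp only [Module.End.mul_apply, LinearMap.sub_apply, LinearMap.mulLeft_apply,
      LinearMap.mulRight_apply, ← hY] at h0
    rw [hX.eq, sub_self, map_zero, sub_eq_zero] at h0
    exact h0.symm
  rw [groupTwirl_gateHom_eq_self_iff]
  intro u _
  have h1 : (LinearMap.mulLeft ℂ Y) ∘ₗ dGamma 1 ∘ₗ embed j =
      (LinearMap.mulRight ℂ Y) ∘ₗ dGamma 1 ∘ₗ embed (q := q) j := by
    refine linearMap_ext_single ?_
    rintro ⟨a, c⟩ ⟨b, d⟩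
    simp only [LinearMap.comp_apply, LinearMap.mulLeft_apply, LinearMap.mulRight_apply, hd, hsplit,
      tensorPow_mul]
    exact ((hYl a b).mul_right (hYr c d)).eq
  have := LinearMap.congr_fun h1 u
  simp only [LinearMap.comp_apply, hd] at this
  exact this

end Gates

end RandomCircuit

open scoped InnerProductSpace

namespace RandomCircuit

/-! ### Products of orthogonal projections -/

section Projections

variable {V : Type*} [NormedAddCommGroup V] [InnerProductSpace ℂ V]

theorem symmetricProjection_apply_apply {P : Module.End ℂ V} (hP : P.IsSymmetricProjection) (v : V) :
    P (P v) = P v :=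
  LinearMap.congr_fun hP.isIdempotentElem v

theorem norm_sq_symmetricProjection {P : Module.End ℂ V} (hP : P.IsSymmetricProjection) (v : V) :
    ‖v‖ ^ 2 = ‖P v‖ ^ 2 + ‖v - P v‖ ^ 2 := by
  have h : ⟪P v, v - P v⟫_ℂ = 0 := by
    rw [hP.isSymmetric v, map_sub, symmetricProjection_apply_apply hP, sub_self, inner_zero_right]
  have := norm_add_sq_eq_norm_sq_add_norm_sq_of_inner_eq_zero (P v) (v - P v) h
  simp only [add_sub_cancel] at this
  rw [sq, sq, sq, this]

theorem norm_symmetricProjection_le {P : Module.End ℂ V} (hP : P.IsSymmetricProjection) (v : V) :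
    ‖P v‖ ≤ ‖v‖ := by
  have := norm_sq_symmetricProjection hP v
  nlinarith [norm_nonneg v, norm_nonneg (P v), sq_nonneg ‖v - P v‖]

theorem symmetricProjection_eq_self_of_norm_le {P : Module.End ℂ V} (hP : P.IsSymmetricProjection)
    {v : V} (h : ‖v‖ ≤ ‖P v‖) : P v = v := by
  have h1 := norm_sq_symmetricProjection hP v
  have h2 : ‖v - P v‖ ^ 2 ≤ 0 := by nlinarith [norm_nonneg v, norm_nonneg (P v)]
  have h3 : ‖v - P v‖ = 0 := by nlinarith [sq_nonneg ‖v - P v‖]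
  exact (sub_eq_zero.mp (norm_eq_zero.mp h3)).symm

theorem norm_list_prod_le (l : List (Module.End ℂ V)) (hl : ∀ P ∈ l, P.IsSymmetricProjection)
    (v : V) : ‖l.prod v‖ ≤ ‖v‖ := by
  induction l with
  | nil => simp
  | cons P l ih =>
    rw [List.prod_cons, Module.End.mul_apply]
    exact (norm_symmetricProjection_le (hl P (by simp)) _).trans
      (ih fun Q hQ => hl Q (by simp [hQ]))

/-- A projection strictly shortens every vector that it moves, so a product that keeps the norm of
`v` cannot move `v` at any stage. -/
theorem eq_self_of_norm_le_list_prod (l : List (Module.End ℂ V))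
    (hl : ∀ P ∈ l, P.IsSymmetricProjection) {v : V} (h : ‖v‖ ≤ ‖l.prod v‖) :
    ∀ P ∈ l, P v = v := by
  induction l with
  | nil => simp
  | cons P l ih =>
    have hl' : ∀ Q ∈ l, Q.IsSymmetricProjection := fun Q hQ => hl Q (by simp [hQ])
    rw [List.prod_cons, Module.End.mul_apply] at h
    have h1 := norm_symmetricProjection_le (hl P (by simp)) (l.prod v)
    have h2 := norm_list_prod_le l hl' v
    have h3 := ih hl' (h.trans h1)
    have h4 : l.prod v = v := by
      have : ∀ m : List (Module.End ℂ V), (∀ Q ∈ m, Q v = v) → m.prod v = v := by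
        intro m hm
        induction m with
        | nil => simp
        | cons Q m ihm =>
          rw [List.prod_cons, Module.End.mul_apply, ihm fun R hR => hm R (by simp [hR]),
            hm Q (by simp)]
      exact this l h3
    rw [h4] at h
    intro Q hQ
    rcases List.mem_cons.mp hQ with rfl | hQ
    · exact symmetricProjection_eq_self_of_norm_le (hl Q (by simp)) h
    · exact h3 Q hQ

theorem list_prod_apply_eq_self {l : List (Module.End ℂ V)} {v : V} (h : ∀ P ∈ l, P v = v) :
    l.prod v = v := by
  induction l with
  | nil => simp
  | cons Q m ihm =>
    rw [List.prod_cons, Module.End.mul_apply, ihm fun R hR => h R (by simp [hR]), h Q (by simp)]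

/-- The eigenvalues other than `1` of a product of orthogonal projections lie inside the open unit
disc. -/
theorem norm_eigenvalue_lt_one (l : List (Module.End ℂ V))
    (hl : ∀ P ∈ l, P.IsSymmetricProjection) {μ : ℂ} (h : Module.End.HasEigenvalue l.prod μ)
    (hμ : μ ≠ 1) : ‖μ‖ < 1 := by
  obtain ⟨v, hv⟩ := h.exists_hasEigenvector
  by_contra hlt
  rw [not_lt] at hlt
  have h1 : ‖v‖ ≤ ‖l.prod v‖ := by
    rw [hv.apply_eq_smul, norm_smul]
    nlinarith [norm_nonneg v]
  have h2 := list_prod_apply_eq_self (eq_self_of_norm_le_list_prod l hl h1)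
  rw [hv.apply_eq_smul] at h2
  apply hμ
  have h3 : (μ - 1) • v = 0 := by rw [sub_smul, h2, one_smul, sub_self]
  exact sub_eq_zero.mp ((smul_eq_zero.mp h3).resolve_right hv.2)

theorem isSymmetricProjection_mul {P Q : Module.End ℂ V} (hP : P.IsSymmetricProjection)
    (hQ : Q.IsSymmetricProjection) (h : Commute P Q) : (P * Q).IsSymmetricProjection := by
  refine ⟨hP.isIdempotentElem.mul_of_commute h hQ.isIdempotentElem, fun u v => ?_⟩
  rw [h.eq, Module.End.mul_apply, hQ.isSymmetric, hP.isSymmetric, ← Module.End.mul_apply, h.eq]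

theorem isSymmetricProjection_one : (1 : Module.End ℂ V).IsSymmetricProjection :=
  ⟨IsIdempotentElem.one, fun _ _ => rfl⟩

theorem isSymmetricProjection_list_prod {l : List (Module.End ℂ V)}
    (hl : ∀ P ∈ l, P.IsSymmetricProjection) (hc : l.Pairwise Commute) :
    l.prod.IsSymmetricProjection := by
  induction l with
  | nil => exact isSymmetricProjection_one
  | cons P l ih =>
    rw [List.pairwise_cons] at hc
    rw [List.prod_cons]
    exact isSymmetricProjection_mul (hl P (by simp)) (ih (fun Q hQ => hl Q (by simp [hQ])) hc.2)
      (Commute.list_prod_right _ _ hc.1)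

theorem inner_list_prod (l : List (Module.End ℂ V)) (hl : ∀ P ∈ l, P.IsSymmetric) (u v : V) :
    ⟪l.prod u, v⟫_ℂ = ⟪u, l.reverse.prod v⟫_ℂ := by
  induction l generalizing u v with
  | nil => simp
  | cons P l ih =>
    rw [List.prod_cons, Module.End.mul_apply, hl P (by simp), ih fun Q hQ => hl Q (by simp [hQ]),
      List.reverse_cons, List.prod_append]
    simp

/-- The adjoint of the hypothesis `P * H = H`. -/
theorem eq_mul_of_symmetric {H P : Module.End ℂ V} (hH : H.IsSymmetric) (hP : P.IsSymmetric)
    (h : P * H = H) : H * P = H := by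
  refine LinearMap.ext fun v => ext_inner_left ℂ fun u => ?_
  rw [Module.End.mul_apply, ← hH, ← hP, ← Module.End.mul_apply, h, hH]

variable [FiniteDimensional ℂ V]

/-- The nonzero eigenvalues of `A * B` and `B * A` agree. -/
theorem hasEigenvalue_mul_comm {A B : Module.End ℂ V} {μ : ℂ} (hμ : μ ≠ 0)
    (h : Module.End.HasEigenvalue (A * B) μ) : Module.End.HasEigenvalue (B * A) μ := by
  rw [Module.End.hasEigenvalue_iff_mem_spectrum] at h ⊢
  have := spectrum.nonzero_mul_comm (𝕜 := ℂ) A B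
  have h2 : μ ∈ spectrum ℂ (A * B) \ {0} := ⟨h, hμ⟩
  rw [this] at h2
  exact h2.1

/-- Two orthogonal projections `O`, `E`: the eigenvalues of `O * E` other than `1` bound the cosine
of the angle of their ranges, relative to the common range of `H`. -/
theorem norm_sq_mul_sub_le {O E H : Module.End ℂ V} (hO : O.IsSymmetricProjection)
    (hE : E.IsSymmetricProjection) (hH : H.IsSymmetricProjection) (hOH : O * H = H)
    (hEH : E * H = H) (hfix : ∀ v, O v = v → E v = v → H v = v) {r : ℝ} (hr : 0 ≤ r)
    (h : ∀ μ, Module.End.HasEigenvalue (O * E) μ → μ ≠ 1 → ‖μ‖ ≤ r) (v : V) :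
    ‖(E * O - H) v‖ ^ 2 ≤ r * ‖v‖ ^ 2 := by
  have hHO := eq_mul_of_symmetric hH.isSymmetric hO.isSymmetric hOH
  have hHE := eq_mul_of_symmetric hH.isSymmetric hE.isSymmetric hEH
  have hHH : H * H = H := hH.isIdempotentElem
  have hOO : O * O = O := hO.isIdempotentElem
  have hEE : E * E = E := hE.isIdempotentElem
  -- `T` is `Aᴴ A` for `A = E O - H`, so it suffices to bound its eigenvalues.
  set T : Module.End ℂ V := O * E * O - H with hT
  have hTsymm : T.IsSymmetric := by
    intro x y
    simp only [hT, LinearMap.sub_apply, inner_sub_left, inner_sub_right, Module.End.mul_apply]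
    rw [hO.isSymmetric, hE.isSymmetric, hO.isSymmetric, hH.isSymmetric]
  have hquad : ⟪v, T v⟫_ℂ = ((‖(E * O - H) v‖ ^ 2 : ℝ) : ℂ) := by
    have h1 : T = (O * E - H) * (E * O - H) := by
      rw [sub_mul, mul_sub, mul_sub, ← mul_assoc H, hHE, hHO, mul_assoc O E H, hEH, hOH, hHH,
        ← mul_assoc, mul_assoc O E E, hEE, sub_self, sub_zero]
    have h2 : ∀ w, ⟪v, (O * E - H) w⟫_ℂ = ⟪(E * O - H) v, w⟫_ℂ := by
      intro w
      simp only [LinearMap.sub_apply, inner_sub_left, inner_sub_right, Module.End.mul_apply]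
      rw [hE.isSymmetric, hO.isSymmetric, hH.isSymmetric]
    rw [h1, Module.End.mul_apply, h2, inner_self_eq_norm_sq_to_K]
    simp
  set b := hTsymm.eigenvectorBasis rfl with hb
  -- An eigenvector with positive eigenvalue lies in the range of `T`, so `O` fixes it and `H` kills
  -- it. It is then an eigenvector of `O E` with the same eigenvalue.
  have heig : ∀ i, hTsymm.eigenvalues rfl i ≤ r := by
    intro i
    by_contra hlt
    rw [not_le] at hlt
    set c := hTsymm.eigenvalues rfl i with hc
    have hc0 : 0 < c := hr.trans_lt hlt
    have hc0' : (c : ℂ) ≠ 0 := by exact_mod_cast hc0.ne'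
    have hTb : T (b i) = (c : ℂ) • b i := hTsymm.apply_eigenvectorBasis rfl i
    have hbT : b i = (c : ℂ)⁻¹ • T (b i) := by rw [hTb, smul_smul, inv_mul_cancel₀ hc0', one_smul]
    have hOT : O * T = T := by
      rw [hT, mul_sub, hOH, ← mul_assoc, ← mul_assoc, hOO]
    have hHT : H * T = 0 := by
      rw [hT, mul_sub, hHH, ← mul_assoc, ← mul_assoc, hHO, hHE, hHO, sub_self]
    have hOb : O (b i) = b i := by
      rw [hbT, map_smul, ← Module.End.mul_apply, hOT]
    have hHb : H (b i) = 0 := by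
      rw [hbT, map_smul, ← Module.End.mul_apply, hHT]
      simp
    have hOEb : (O * E) (b i) = (c : ℂ) • b i := by
      rw [← hTb, hT, LinearMap.sub_apply, hHb, sub_zero, Module.End.mul_apply (O * E), hOb]
    have hb0 : b i ≠ 0 := b.orthonormal.ne_zero i
    have hev : Module.End.HasEigenvalue (O * E) (c : ℂ) :=
      Module.End.hasEigenvalue_of_hasEigenvector
        ⟨Module.End.mem_eigenspace_iff.mpr hOEb, hb0⟩
    -- Eigenvalue `1` would make the vector fixed by `O` and `E`, hence by `H`, which kills it.
    have hc1 : (c : ℂ) ≠ 1 := by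
      intro h1
      rw [h1, one_smul, Module.End.mul_apply] at hOEb
      have hEb : E (b i) = b i := symmetricProjection_eq_self_of_norm_le hE (by
        have := norm_symmetricProjection_le hO (E (b i))
        rwa [hOEb] at this)
      exact hb0 ((hfix _ hOb hEb).symm.trans hHb)
    have := h c hev hc1
    rw [Complex.norm_real, Real.norm_of_nonneg hc0.le] at this
    linarith
  have hsum : ⟪v, T v⟫_ℂ = ((∑ i, hTsymm.eigenvalues rfl i * ‖⟪b i, v⟫_ℂ‖ ^ 2 : ℝ) : ℂ) := by
    rw [← b.sum_inner_mul_inner v (T v)]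
    push_cast
    refine Finset.sum_congr rfl fun i _ => ?_
    have h1 : ⟪b i, T v⟫_ℂ = (hTsymm.eigenvalues rfl i : ℂ) * ⟪b i, v⟫_ℂ := by
      rw [← hTsymm, hTsymm.apply_eigenvectorBasis, inner_smul_left]
      simp [hb]
    rw [h1, ← inner_conj_symm v (b i), mul_left_comm, Complex.conj_mul']
  rw [hsum] at hquad
  have hq' := Complex.ofReal_injective hquad
  rw [← hq', ← b.sum_sq_norm_inner_right v, Finset.mul_sum]
  exact Finset.sum_le_sum fun i _ => mul_le_mul_of_nonneg_right (heig i) (sq_nonneg _)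

end Projections

/-! ### Hilbert–Schmidt norm of operators -/

section HilbertSchmidt

variable {V ι : Type*} [NormedAddCommGroup V] [InnerProductSpace ℂ V] [Fintype ι]
  (b : OrthonormalBasis ι ℂ V)

/-- The squared Hilbert–Schmidt norm of an operator. -/
noncomputable def hsNormSq (Φ : Module.End ℂ V) : ℝ := ∑ i, ‖Φ (b i)‖ ^ 2

theorem hsNormSq_mul_le {A : Module.End ℂ V} {r : ℝ} (hA : ∀ v, ‖A v‖ ^ 2 ≤ r * ‖v‖ ^ 2)
    (Φ : Module.End ℂ V) : hsNormSq b (A * Φ) ≤ r * hsNormSq b Φ := by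
  rw [hsNormSq, hsNormSq, Finset.mul_sum]
  exact Finset.sum_le_sum fun i _ => hA _

theorem hsNormSq_contraction_mul_le {A : Module.End ℂ V} (hA : ∀ v, ‖A v‖ ≤ ‖v‖)
    (Φ : Module.End ℂ V) : hsNormSq b (A * Φ) ≤ hsNormSq b Φ := by
  have := hsNormSq_mul_le b (r := 1) (A := A) (fun v => by
    rw [one_mul]; exact pow_le_pow_left₀ (norm_nonneg _) (hA v) 2) Φ
  rwa [one_mul] at this

/-- Used to reverse the order of the factors in a product of projections. -/
theorem hsNormSq_adjoint {Φ Ψ : Module.End ℂ V} (h : ∀ u v, ⟪Φ u, v⟫_ℂ = ⟪u, Ψ v⟫_ℂ) :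
    hsNormSq b Φ = hsNormSq b Ψ := by
  simp only [hsNormSq]
  have h1 : ∀ i, ‖Φ (b i)‖ ^ 2 = ∑ j, ‖⟪b j, Φ (b i)⟫_ℂ‖ ^ 2 := fun i =>
    (b.sum_sq_norm_inner_right _).symm
  have h2 : ∀ i, ‖Ψ (b i)‖ ^ 2 = ∑ j, ‖⟪b j, Ψ (b i)⟫_ℂ‖ ^ 2 := fun i =>
    (b.sum_sq_norm_inner_right _).symm
  simp only [h1, h2]
  rw [Finset.sum_comm]
  refine Finset.sum_congr rfl fun i _ => Finset.sum_congr rfl fun j _ => ?_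
  rw [← h, norm_inner_symm]

theorem hsNormSq_one_sub_le {H : Module.End ℂ V} (hH : H.IsSymmetricProjection) :
    hsNormSq b (1 - H) ≤ Fintype.card ι := by
  have : hsNormSq b (1 - H) ≤ ∑ _i : ι, (1 : ℝ) := by
    refine Finset.sum_le_sum fun i _ => ?_
    have h1 := norm_sq_symmetricProjection hH (b i)
    rw [b.orthonormal.1 i] at h1
    rw [LinearMap.sub_apply, Module.End.one_apply]
    nlinarith [sq_nonneg ‖H (b i)‖]
  simpa using this

end HilbertSchmidt

end RandomCircuit

namespace RandomCircuit

/-! ### Staircase and two-layer products have the same nonzero spectrum -/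

section CoxeterProducts

variable {V : Type*} [NormedAddCommGroup V] [InnerProductSpace ℂ V] [FiniteDimensional ℂ V]

/-- The product of the `P i` with `i < n` and `i ≡ b mod 2`. -/
def parityProd {M : Type*} [Monoid M] (P : ℕ → M) (b n : ℕ) : M :=
  (((List.range n).filter fun i => i % 2 = b % 2).map P).prod

theorem parityProd_succ_of_eq {M : Type*} [Monoid M] (P : ℕ → M) {b n : ℕ} (h : n % 2 = b % 2) :
    parityProd P b (n + 1) = parityProd P b n * P n := by
  simp [parityProd, List.range_succ, List.filter_append, h]

theorem parityProd_succ_of_ne {M : Type*} [Monoid M] (P : ℕ → M) {b n : ℕ} (h : n % 2 ≠ b % 2) :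
    parityProd P b (n + 1) = parityProd P b n := by
  simp [parityProd, List.range_succ, List.filter_append, h]

theorem commute_parityProd {M : Type*} [Monoid M] {P : ℕ → M} {b n : ℕ} {T : M}
    (h : ∀ j, j < n → j % 2 = b % 2 → Commute T (P j)) : Commute T (parityProd P b n) := by
  refine Commute.list_prod_right _ _ fun x hx => ?_
  obtain ⟨j, hj, rfl⟩ := List.mem_map.mp hx
  simp only [List.mem_filter, List.mem_range, decide_eq_true_eq] at hj
  exact h j hj.1 hj.2

/-- The product of all `P i` in increasing order and the product of the even ones times the odd
ones have the same nonzero eigenvalues, if only neighbours fail to commute. -/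
theorem hasEigenvalue_stair_iff {P : ℕ → Module.End ℂ V}
    (hP : ∀ i j, i + 1 < j → Commute (P i) (P j)) (n : ℕ) :
    ∀ T : Module.End ℂ V, (∀ j, j + 1 < n → Commute T (P j)) → ∀ μ : ℂ, μ ≠ 0 →
      (Module.End.HasEigenvalue (((List.range n).map P).prod * T) μ ↔
        Module.End.HasEigenvalue (parityProd P 0 n * parityProd P 1 n * T) μ) := by
  induction n with
  | zero => simp [parityProd]
  | succ m ih =>
    intro T hT μ hμ
    -- The last factor `P m` is absorbed into `T`; this is what the arbitrary factor `T` in the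
    -- induction is for.
    rw [List.range_succ, List.map_append, List.prod_append, List.map_singleton, List.prod_singleton,
      mul_assoc, ih (P m * T) (fun j hj => ((hP j m hj).symm.mul_left (hT j (by omega)))) μ hμ]
    rcases Nat.mod_two_eq_zero_or_one m with hm | hm
    · rw [parityProd_succ_of_eq P (b := 0) (by omega), parityProd_succ_of_ne P (b := 1) (by omega)]
      have hPO : Commute (P m) (parityProd P 0 m) :=
        commute_parityProd fun j hj hj2 => (hP j m (by omega)).symm
      have hTO : Commute T (parityProd P 0 m) := commute_parityProd fun j hj _ => hT j (by omega)
      have hTE : Commute T (parityProd P 1 m) := commute_parityProd fun j hj _ => hT j (by omega)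
      -- Rotate `P m * T` to the front. There `P m` slides through the even factors to its place,
      -- and `T` slides back through all factors to the end. For odd `m` no rotation is needed.
      have he : P m * T * (parityProd P 0 m * parityProd P 1 m) =
          parityProd P 0 m * P m * parityProd P 1 m * T := by
        rw [mul_assoc (P m), (hTO.mul_right hTE).eq, ← mul_assoc, ← mul_assoc, hPO.eq]
      rw [← he]
      exact ⟨hasEigenvalue_mul_comm hμ, hasEigenvalue_mul_comm hμ⟩
    · rw [parityProd_succ_of_eq P (b := 1) (by omega), parityProd_succ_of_ne P (b := 0) (by omega)]
      simp only [mul_assoc]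

end CoxeterProducts

/-! ### Geometric convergence of alternating products -/

section AlternatingProducts

variable {V ι : Type*} [NormedAddCommGroup V] [InnerProductSpace ℂ V] [FiniteDimensional ℂ V]
  [Fintype ι] (b : OrthonormalBasis ι ℂ V)

/-- Convergence of alternating products of two projections in Hilbert–Schmidt norm. -/
theorem hsNormSq_alternating_le {L : ℕ → Module.End ℂ V} {H : Module.End ℂ V} {r : ℝ}
    (hL : ∀ j, (L j).IsSymmetricProjection) (hH : H.IsSymmetricProjection)
    (hLH : ∀ j, L j * H = H) (hr : 0 ≤ r)
    (hstep : ∀ j v, ‖(L (j + 1) * L j - H) v‖ ^ 2 ≤ r * ‖v‖ ^ 2) (ℓ : ℕ) :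
    hsNormSq b (((List.range (ℓ + 1)).map L).prod - H) ≤ r ^ ℓ * hsNormSq b (L 0 - H) := by
  -- The reversed product is the adjoint. It grows on the left, where the operator bound `hstep`
  -- applies.
  have hrev : ∀ k, hsNormSq b (((List.range k).map L).prod - H) =
      hsNormSq b (((List.range k).map L).reverse.prod - H) := by
    intro k
    refine hsNormSq_adjoint b fun u v => ?_
    rw [LinearMap.sub_apply, LinearMap.sub_apply, inner_sub_left, inner_sub_right,
      hH.isSymmetric u v, inner_list_prod]
    intro P hP
    obtain ⟨j, _, rfl⟩ := List.mem_map.mp hP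
    exact (hL j).isSymmetric
  induction ℓ with
  | zero => simp
  | succ ℓ ih =>
    rw [hrev] at ih ⊢
    set R := ((List.range (ℓ + 1)).map L).reverse.prod with hR
    have hHH : H * H = H := hH.isIdempotentElem
    have hHL : ∀ j, H * L j = H := fun j =>
      eq_mul_of_symmetric hH.isSymmetric (hL j).isSymmetric (hLH j)
    have hsucc : ((List.range (ℓ + 1 + 1)).map L).reverse.prod = L (ℓ + 1) * R := by
      rw [hR, List.range_succ (n := ℓ + 1), List.map_append, List.reverse_append]
      simp
    have hLR : L ℓ * R = R := by
      rw [hR, List.range_succ (n := ℓ), List.map_append, List.reverse_append]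
      simp only [List.map_cons, List.map_nil, List.reverse_cons, List.reverse_nil, List.nil_append,
        List.cons_append, List.prod_cons]
      rw [← mul_assoc, (hL ℓ).isIdempotentElem.eq]
    have hHR : H * R = H := by
      have : ∀ l : List ℕ, H * (l.map L).prod = H := by
        intro l
        induction l with
        | nil => simp
        | cons j l ihl => rw [List.map_cons, List.prod_cons, ← mul_assoc, hHL, ihl]
      rw [hR, ← List.map_reverse, this]
    -- Since `L ℓ` is idempotent and already stands leftmost in `R`, it can be used once more, so
    -- each new layer costs one full factor `r`.
    have hfac : L (ℓ + 1) * R - H = (L (ℓ + 1) * L ℓ - H) * (R - H) := by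
      rw [sub_mul, mul_sub, mul_sub, hHR, hHH, mul_assoc _ _ R, hLR, mul_assoc _ _ H, hLH, hLH,
        sub_self, sub_zero]
    rw [hsucc, hfac, pow_succ', mul_assoc]
    exact (hsNormSq_mul_le b (hstep ℓ) _).trans (mul_le_mul_of_nonneg_left ih hr)

end AlternatingProducts

end RandomCircuit

namespace RandomCircuit

/-! ### Frobenius norm, trace norm and the diamond norm bound -/

section Frobenius

variable {l m n : Type*} [Fintype l] [Fintype m] [Fintype n]

/-- The squared Frobenius norm. -/
noncomputable def frobSq (A : Matrix m n ℂ) : ℝ := ∑ i, ∑ j, ‖A i j‖ ^ 2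

theorem frobSq_nonneg (A : Matrix m n ℂ) : 0 ≤ frobSq A :=
  Finset.sum_nonneg fun _ _ => Finset.sum_nonneg fun _ _ => sq_nonneg _

theorem trace_conjTranspose_mul_self (A : Matrix m n ℂ) : (Aᴴ * A).trace = (frobSq A : ℂ) := by
  simp only [Matrix.trace, Matrix.diag_apply, Matrix.mul_apply, conjTranspose_apply, frobSq]
  rw [Finset.sum_comm]
  push_cast
  refine Finset.sum_congr rfl fun i _ => Finset.sum_congr rfl fun j _ => ?_
  exact Complex.conj_mul' _

theorem norm_sum_mul_sq_le {ι : Type*} (s : Finset ι) (f g : ι → ℂ) :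
    ‖∑ i ∈ s, f i * g i‖ ^ 2 ≤ (∑ i ∈ s, ‖f i‖ ^ 2) * ∑ i ∈ s, ‖g i‖ ^ 2 := by
  refine le_trans (pow_le_pow_left₀ (norm_nonneg _) ?_ 2)
    (Finset.sum_mul_sq_le_sq_mul_sq s (fun i => ‖f i‖) fun i => ‖g i‖)
  exact (norm_sum_le _ _).trans (le_of_eq (Finset.sum_congr rfl fun i _ => norm_mul _ _))

theorem frobSq_mul_le (A : Matrix l m ℂ) (B : Matrix m n ℂ) :
    frobSq (A * B) ≤ frobSq A * frobSq B := by
  have h : ∀ i j, ‖(A * B) i j‖ ^ 2 ≤ (∑ k, ‖A i k‖ ^ 2) * ∑ k, ‖B k j‖ ^ 2 := fun i j => by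
    rw [Matrix.mul_apply]
    exact norm_sum_mul_sq_le _ _ _
  refine (Finset.sum_le_sum fun i _ => Finset.sum_le_sum fun j _ => h i j).trans (le_of_eq ?_)
  simp only [← Finset.mul_sum, ← Finset.sum_mul, frobSq]
  rw [Finset.sum_comm (f := fun i j => ‖B i j‖ ^ 2)]

theorem norm_trace_mul_sq_le (A : Matrix m n ℂ) (B : Matrix n m ℂ) :
    ‖(A * B).trace‖ ^ 2 ≤ frobSq A * frobSq B := by
  have h1 : (A * B).trace = ∑ p : m × n, A p.1 p.2 * B p.2 p.1 := by
    simp only [Matrix.trace, Matrix.diag_apply, Matrix.mul_apply, Fintype.sum_prod_type]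
  rw [h1]
  refine (norm_sum_mul_sq_le _ _ _).trans (le_of_eq ?_)
  simp only [Fintype.sum_prod_type, frobSq]
  rw [Finset.sum_comm (f := fun (i : m) (j : n) => ‖B j i‖ ^ 2)]

theorem norm_trace_mul_le (A : Matrix m n ℂ) (B : Matrix n m ℂ) :
    ‖(A * B).trace‖ ≤ √(frobSq A * frobSq B) :=
  Real.le_sqrt_of_sq_le (norm_trace_mul_sq_le A B)

theorem frobSq_projection_mul_le [DecidableEq m] {p : Matrix m m ℂ} (hp : p * p = p) (hp' : pᴴ = p)
    (G : Matrix m n ℂ) : (frobSq (p * G) : ℝ) ≤ frobSq G := by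
  have h : (frobSq G : ℂ) = (frobSq (p * G) : ℂ) + (frobSq ((1 - p) * G) : ℂ) := by
    rw [← trace_conjTranspose_mul_self, ← trace_conjTranspose_mul_self,
      ← trace_conjTranspose_mul_self, ← Matrix.trace_add]
    congr 1
    simp only [conjTranspose_mul, conjTranspose_sub, conjTranspose_one, hp']
    have e1 : Gᴴ * p * (p * G) = Gᴴ * (p * G) := by
      rw [Matrix.mul_assoc, ← Matrix.mul_assoc p, hp]
    have e2 : Gᴴ * (1 - p) * ((1 - p) * G) = Gᴴ * G - Gᴴ * (p * G) := by
      rw [Matrix.mul_assoc, ← Matrix.mul_assoc (1 - p), Matrix.sub_mul 1 p (1 - p), Matrix.one_mul,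
        Matrix.mul_sub, Matrix.mul_one, hp, sub_self, sub_zero, Matrix.sub_mul, Matrix.one_mul,
        Matrix.mul_sub]
    rw [e1, e2, add_sub_cancel]
  have h' : frobSq G = frobSq (p * G) + frobSq ((1 - p) * G) := by exact_mod_cast h
  linarith [frobSq_nonneg ((1 - p) * G)]

end Frobenius

section TraceNorm

variable {d : Type*} [Fintype d] [DecidableEq d]

theorem exists_unitary_diagonalization (A : Matrix d d ℂ) : ∃ V : Matrix d d ℂ, V * Vᴴ = 1 ∧
    Vᴴ * V = 1 ∧ (A * V)ᴴ * (A * V) =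
      diagonal fun i => ((isHermitian_conjTranspose_mul_self A).eigenvalues i : ℂ) := by
  set h := isHermitian_conjTranspose_mul_self A
  refine ⟨h.eigenvectorUnitary, ?_, ?_, ?_⟩
  · exact Unitary.mul_star_self_of_mem h.eigenvectorUnitary.2
  · exact Unitary.star_mul_self_of_mem h.eigenvectorUnitary.2
  · have := h.conjStarAlgAut_star_eigenvectorUnitary
    rw [Unitary.conjStarAlgAut_apply] at this
    rw [conjTranspose_mul, Matrix.mul_assoc, ← Matrix.mul_assoc Aᴴ, ← Matrix.mul_assoc]
    simpa [star_eq_conjTranspose, Function.comp_def] using this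

theorem eigenvalues_conjTranspose_mul_self_nonneg (A : Matrix d d ℂ) (i : d) :
    0 ≤ (isHermitian_conjTranspose_mul_self A).eigenvalues i :=
  (posSemidef_conjTranspose_mul_self A).eigenvalues_nonneg i

/-- A Schmidt-type decomposition that realizes the trace norm. -/
theorem exists_rankOne_decomposition (A : Matrix d d ℂ) : ∃ w v : d → d → ℂ,
    (∀ x y, A x y = ∑ i, w i x * star (v i y)) ∧ (∀ i, ∑ x, ‖v i x‖ ^ 2 = 1) ∧
      ∑ i, √(∑ x, ‖w i x‖ ^ 2) = traceNorm A := by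
  obtain ⟨V, hV, hV', hd⟩ := exists_unitary_diagonalization A
  have hcol : ∀ (M : Matrix d d ℂ) i, ((∑ x, ‖M x i‖ ^ 2 : ℝ) : ℂ) = (Mᴴ * M) i i := by
    intro M i
    rw [Matrix.mul_apply]
    push_cast
    exact Finset.sum_congr rfl fun x _ => (Complex.conj_mul' _).symm
  refine ⟨fun i x => (A * V) x i, fun i x => V x i, fun x y => ?_, fun i => ?_, ?_⟩
  · have : A = A * V * Vᴴ := by rw [Matrix.mul_assoc, hV, Matrix.mul_one]
    conv_lhs => rw [this, Matrix.mul_apply]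
    rfl
  · have := hcol V i
    rw [hV', Matrix.one_apply_eq] at this
    exact_mod_cast this
  · refine Finset.sum_congr rfl fun i _ => ?_
    have := hcol (A * V) i
    rw [hd, diagonal_apply_eq] at this
    congr 1
    exact_mod_cast this

/-- The trace norm as a pairing with a contraction. -/
theorem exists_dual_contraction (A : Matrix d d ℂ) : ∃ W : Matrix d d ℂ,
    (W * A).trace = (traceNorm A : ℂ) ∧
      ∀ {n : Type} [Fintype n] (G : Matrix d n ℂ), frobSq (W * G) ≤ frobSq G := by
  obtain ⟨V, hV, hV', hd⟩ := exists_unitary_diagonalization A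
  set e := (isHermitian_conjTranspose_mul_self A).eigenvalues with he
  have he0 : ∀ i, 0 ≤ e i := eigenvalues_conjTranspose_mul_self_nonneg A
  -- Inverse singular values, with `0⁻¹ = 0` on the kernel. The matrix `V * Q` below is then the
  -- adjoint of the partial isometry in the polar decomposition of `A`.
  set s : d → ℂ := fun i => (((√(e i))⁻¹ : ℝ) : ℂ) with hs
  have hs' : (diagonal s)ᴴ = diagonal s := by
    rw [diagonal_conjTranspose]
    congr 1
    funext i
    simp [hs]
  have hse : ∀ i, s i * (e i : ℂ) = ((√(e i) : ℝ) : ℂ) := by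
    intro i
    simp only [hs]
    norm_cast
    by_cases h0 : √(e i) = 0
    · simp [h0]
    · rw [inv_mul_eq_iff_eq_mul₀ h0, Real.mul_self_sqrt (he0 i)]
  have hss : ∀ i, s i * (e i : ℂ) * s i * s i = s i := by
    intro i
    rw [hse]
    simp only [hs]
    norm_cast
    by_cases h0 : √(e i) = 0
    · simp [h0]
    · rw [mul_inv_cancel₀ h0, one_mul]
  set Q := diagonal s * (A * V)ᴴ with hQ
  have hQQ : Q * Qᴴ = diagonal fun i => s i * (e i : ℂ) * s i := by
    rw [hQ, conjTranspose_mul (diagonal s), conjTranspose_conjTranspose, hs', Matrix.mul_assoc,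
      ← Matrix.mul_assoc (A * V)ᴴ, hd, diagonal_mul_diagonal, diagonal_mul_diagonal]
    congr 1
    funext i
    ring
  have hQQQ : Q * Qᴴ * Q = Q := by
    rw [hQQ, hQ, ← Matrix.mul_assoc, diagonal_mul_diagonal]
    congr 2
    funext i
    exact hss i
  refine ⟨V * Q, ?_, fun {n} _ G => ?_⟩
  · rw [Matrix.mul_assoc, Matrix.trace_mul_comm, hQ, Matrix.mul_assoc, Matrix.mul_assoc, hd,
      diagonal_mul_diagonal, trace_diagonal, traceNorm]
    push_cast
    exact Finset.sum_congr rfl fun i _ => hse i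
  · have h1 : frobSq (V * Q * G) = frobSq (Qᴴ * Q * G) := by
      have : (frobSq (V * Q * G) : ℂ) = (frobSq (Qᴴ * Q * G) : ℂ) := by
        rw [← trace_conjTranspose_mul_self, ← trace_conjTranspose_mul_self]
        congr 1
        simp only [conjTranspose_mul, conjTranspose_conjTranspose]
        have e1 : Gᴴ * (Qᴴ * Vᴴ) * (V * Q * G) = Gᴴ * Qᴴ * (Vᴴ * V) * (Q * G) := by
          simp only [Matrix.mul_assoc]
        have e2 : Gᴴ * (Qᴴ * Q) * (Qᴴ * Q * G) = Gᴴ * Qᴴ * (Q * Qᴴ * Q * G) := by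
          simp only [Matrix.mul_assoc]
        rw [e1, e2, hV', hQQQ, Matrix.mul_one]
      exact_mod_cast this
    rw [h1]
    refine frobSq_projection_mul_le ?_ ?_ G
    · rw [Matrix.mul_assoc, ← Matrix.mul_assoc Q, hQQQ]
    · rw [conjTranspose_mul, conjTranspose_conjTranspose]

end TraceNorm

section Diamond

variable {d : Type} [Fintype d] [DecidableEq d]

theorem ampliation_apply (Φ : Matrix d d ℂ →ₗ[ℂ] Matrix d d ℂ) (k : ℕ)
    (ρ : Matrix (d × Fin k) (d × Fin k) ℂ) (x y : d × Fin k) :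
    ampliation Φ k ρ x y = ∑ a, ∑ b, ρ (a, x.2) (b, y.2) * choi Φ (x.1, a) (y.1, b) := by
  rw [ampliation, Matrix.of_apply]
  conv_lhs => rw [Matrix.matrix_eq_sum_single (Matrix.of fun i j => ρ (i, x.2) (j, y.2))]
  simp only [map_sum, Matrix.sum_apply, Matrix.of_apply, choi]
  refine Finset.sum_congr rfl fun a _ => Finset.sum_congr rfl fun b _ => ?_
  have : Matrix.single a b (ρ (a, x.2) (b, y.2)) = ρ (a, x.2) (b, y.2) • Matrix.single a b 1 := by
    simp [Matrix.smul_single]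
  rw [this, map_smul, Matrix.smul_apply, smul_eq_mul]

/-- The diamond norm is at most the dimension times the Frobenius norm of the Choi matrix. -/
theorem diamondNorm_le (Φ : Matrix d d ℂ →ₗ[ℂ] Matrix d d ℂ) :
    diamondNorm Φ ≤ ENNReal.ofReal (Fintype.card d * √(frobSq (choi Φ))) := by
  refine iSup_le fun k => iSup_le fun ρ => iSup_le fun hρ => ENNReal.ofReal_le_ofReal ?_
  obtain ⟨w, v, hdec, hv, hw⟩ := exists_rankOne_decomposition ρ
  obtain ⟨W, hW, hcontr⟩ := exists_dual_contraction (ampliation Φ k ρ)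
  -- `G f` is `1 ⊗ f`, with `f` read as a map from the input factor to the ancilla. A rank-one input
  -- `w vᴴ` is sent to `G w * choi Φ * (G v)ᴴ`, and the dimension factor in the bound is the squared
  -- Frobenius norm of the `1`.
  let G : (d × Fin k → ℂ) → Matrix (d × Fin k) (d × d) ℂ := fun f =>
    Matrix.of fun x p => if x.1 = p.1 then f (p.2, x.2) else 0
  have hG : ∀ f, frobSq (G f) = Fintype.card d * ∑ x, ‖f x‖ ^ 2 := by
    intro f
    simp only [frobSq, G, Matrix.of_apply, Fintype.sum_prod_type]
    have h1 : ∀ (i a j : d) (r : Fin k), ‖(if i = j then f (a, r) else 0)‖ ^ 2 =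
        if i = j then ‖f (a, r)‖ ^ 2 else 0 := fun i a j r => by split_ifs <;> simp
    simp only [h1]
    have h2 : ∀ (i : d) (r : Fin k), ∑ j, ∑ a, (if i = j then ‖f (a, r)‖ ^ 2 else 0) =
        ∑ a, ‖f (a, r)‖ ^ 2 := fun i r => by
      rw [Finset.sum_comm]
      simp
    simp only [h2, Finset.sum_const, Finset.card_univ, nsmul_eq_mul]
    rw [Finset.sum_comm]
  have hG' : ∀ f, frobSq (G f)ᴴ = frobSq (G f) := by
    intro f
    simp only [frobSq, conjTranspose_apply, norm_star]
    exact Finset.sum_comm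
  have hM : ampliation Φ k ρ = ∑ i, G (w i) * (choi Φ * (G (v i))ᴴ) := by
    ext x y
    rw [ampliation_apply, Matrix.sum_apply]
    have h1 : ∀ i, (G (w i) * (choi Φ * (G (v i))ᴴ)) x y =
        ∑ a, ∑ b, w i (a, x.2) * choi Φ (x.1, a) (y.1, b) * star (v i (b, y.2)) := by
      intro i
      simp only [Matrix.mul_apply, G, Matrix.of_apply, conjTranspose_apply, Fintype.sum_prod_type,
        ite_mul, zero_mul, apply_ite star, star_zero, mul_ite, mul_zero, Finset.sum_ite_irrel,
        Finset.sum_const_zero, Finset.sum_ite_eq, Finset.mem_univ, if_true, Finset.mul_sum, mul_assoc]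
    simp only [h1, hdec, Finset.sum_mul]
    rw [Finset.sum_comm]
    conv_rhs => rw [Finset.sum_comm]
    rw [Finset.sum_comm]
    refine Finset.sum_congr rfl fun a _ => ?_
    conv_rhs => rw [Finset.sum_comm]
    refine Finset.sum_congr rfl fun b _ => Finset.sum_congr rfl fun i _ => ?_
    ring
  -- Cauchy–Schwarz for the Frobenius norm; each of the two matrices `G` contributes the square root
  -- of the dimension.
  have hterm : ∀ i, ‖(W * (G (w i) * (choi Φ * (G (v i))ᴴ))).trace‖ ≤
      Fintype.card d * √(frobSq (choi Φ)) * √(∑ x, ‖w i x‖ ^ 2) := by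
    intro i
    rw [← Matrix.mul_assoc]
    refine (norm_trace_mul_le _ _).trans ?_
    have h1 := hcontr (G (w i))
    have h2 := frobSq_mul_le (choi Φ) (G (v i))ᴴ
    rw [hG] at h1
    rw [hG', hG, hv, mul_one] at h2
    refine Real.sqrt_le_iff.mpr ⟨by positivity, ?_⟩
    refine (mul_le_mul h1 h2 (frobSq_nonneg _) (by positivity)).trans (le_of_eq ?_)
    rw [mul_pow, mul_pow, Real.sq_sqrt (frobSq_nonneg _), Real.sq_sqrt (by positivity)]
    ring
  have hnorm : traceNorm (ampliation Φ k ρ) ≤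
      ‖(W * ampliation Φ k ρ).trace‖ := by
    rw [hW, Complex.norm_real]
    exact le_abs_self _
  calc traceNorm (ampliation Φ k ρ) ≤ ‖(W * ampliation Φ k ρ).trace‖ := hnorm
    _ = ‖∑ i, (W * (G (w i) * (choi Φ * (G (v i))ᴴ))).trace‖ := by
        rw [hM, Matrix.mul_sum, Matrix.trace_sum]
    _ ≤ ∑ i, Fintype.card d * √(frobSq (choi Φ)) * √(∑ x, ‖w i x‖ ^ 2) :=
        (norm_sum_le _ _).trans (Finset.sum_le_sum fun i _ => hterm i)
    _ = Fintype.card d * √(frobSq (choi Φ)) * traceNorm ρ := by rw [← Finset.mul_sum, hw]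
    _ ≤ Fintype.card d * √(frobSq (choi Φ)) :=
        mul_le_of_le_one_right (by positivity) hρ

end Diamond

end RandomCircuit

namespace RandomCircuit

/-! ### Matrices as a Hilbert space -/

section HilbertSchmidtInner

variable {d : Type*} [Fintype d] [DecidableEq d]

/-- The Hilbert–Schmidt inner product `tr(Aᴴ B)` on matrices. -/
@[reducible] noncomputable def hsInnerCore (d : Type*) [Fintype d] :
    InnerProductSpace.Core ℂ (Matrix d d ℂ) where
  inner A B := (Aᴴ * B).trace
  conj_inner_symm A B := by
    rw [← Complex.star_def, ← trace_conjTranspose, conjTranspose_mul, conjTranspose_conjTranspose]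
  re_inner_nonneg A := by
    simp only [trace_conjTranspose_mul_self]
    exact frobSq_nonneg A
  add_left A B C := by simp [Matrix.add_mul]
  smul_left A B c := by simp
  definite A h := Matrix.trace_conjTranspose_mul_self_eq_zero_iff.mp h

/-- The Hilbert–Schmidt norm on matrices. -/
@[reducible] noncomputable def hsNormedAddCommGroup (d : Type*) [Fintype d] :
    NormedAddCommGroup (Matrix d d ℂ) :=
  @InnerProductSpace.Core.toNormedAddCommGroup ℂ _ _ _ _ (hsInnerCore d)

/-- The Hilbert space of matrices. -/
@[reducible] noncomputable def hsInnerProductSpace (d : Type*) [Fintype d] :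
    @InnerProductSpace ℂ (Matrix d d ℂ) _ (hsNormedAddCommGroup d).toSeminormedAddCommGroup :=
  @InnerProductSpace.ofCore ℂ _ _ _ _ (hsInnerCore d).toCore

attribute [local instance] hsNormedAddCommGroup hsInnerProductSpace

theorem hs_inner_def (A B : Matrix d d ℂ) : ⟪A, B⟫_ℂ = (Aᴴ * B).trace := rfl

theorem hs_norm_sq (A : Matrix d d ℂ) : ‖A‖ ^ 2 = frobSq A := by
  have h := inner_self_eq_norm_sq_to_K (𝕜 := ℂ) A
  rw [hs_inner_def, trace_conjTranspose_mul_self] at h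
  exact Complex.ofReal_injective (by rw [h]; simp)

theorem hs_inner_single_left (a b : d) (A : Matrix d d ℂ) :
    ⟪Matrix.single a b (1 : ℂ), A⟫_ℂ = A a b := by
  rw [hs_inner_def, Matrix.conjTranspose_single, star_one, Matrix.trace_single_mul, one_smul]

/-- The orthonormal basis of matrix units. -/
noncomputable def hsBasis (d : Type*) [Fintype d] [DecidableEq d] :
    OrthonormalBasis (d × d) ℂ (Matrix d d ℂ) :=
  (Matrix.stdBasis ℂ d d).toOrthonormalBasis (by
    rw [orthonormal_iff_ite]
    rintro ⟨a, b⟩ ⟨a', b'⟩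
    rw [Matrix.stdBasis_eq_single, Matrix.stdBasis_eq_single, hs_inner_single_left,
      Matrix.single_apply]
    simp only [Prod.mk.injEq, eq_comm])

theorem hsBasis_apply (p : d × d) : hsBasis d p = Matrix.single p.1 p.2 1 := by
  rw [hsBasis, Module.Basis.coe_toOrthonormalBasis]
  exact Matrix.stdBasis_eq_single ℂ p.1 p.2

/-- The Choi matrix only rearranges the matrix entries of `Φ`. -/
theorem hsNormSq_eq_frobSq_choi (Φ : Module.End ℂ (Matrix d d ℂ)) :
    hsNormSq (hsBasis d) Φ = frobSq (choi Φ) := by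
  simp only [hsNormSq, hsBasis_apply, hs_norm_sq]
  simp only [frobSq, choi, Matrix.of_apply, Fintype.sum_prod_type]
  calc ∑ a, ∑ b, ∑ i, ∑ j, ‖Φ (Matrix.single a b 1) i j‖ ^ 2
      = ∑ a, ∑ i, ∑ b, ∑ j, ‖Φ (Matrix.single a b 1) i j‖ ^ 2 :=
        Finset.sum_congr rfl fun a _ => Finset.sum_comm
    _ = ∑ i, ∑ a, ∑ b, ∑ j, ‖Φ (Matrix.single a b 1) i j‖ ^ 2 := Finset.sum_comm
    _ = ∑ i, ∑ a, ∑ j, ∑ b, ‖Φ (Matrix.single a b 1) i j‖ ^ 2 :=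
        Finset.sum_congr rfl fun i _ => Finset.sum_congr rfl fun a _ => Finset.sum_comm

variable {m n : Type*} [Fintype m] [DecidableEq m] [Fintype n] [DecidableEq n] {t : ℕ}

theorem isSymmetricProjection_groupTwirl {φ : unitaryGroup m ℂ →* unitaryGroup n ℂ}
    (hφ : Measurable φ) : (groupTwirl t φ).IsSymmetricProjection := by
  refine ⟨groupTwirl_mul_self hφ, fun A B => ?_⟩
  rw [hs_inner_def, hs_inner_def, conjTranspose_groupTwirl hφ, trace_mul_groupTwirl hφ]

theorem exists_span_decomposition (S : Submodule ℂ (Matrix d d ℂ)) (K : Matrix d d ℂ) :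
    ∃ K' ∈ S, ∃ K'', (∀ A ∈ S, (Aᴴ * K'').trace = 0) ∧ K = K' + K'' := by
  obtain ⟨K', hK', K'', hK'', h⟩ := S.exists_add_mem_mem_orthogonal K
  exact ⟨K', hK', K'', fun A hA => (Submodule.mem_orthogonal S K'').mp hK'' A hA, h⟩

theorem trace_sq_le_card_mul_frobSq (A : Matrix d d ℂ) :
    ‖A.trace‖ ^ 2 ≤ Fintype.card d * frobSq A := by
  have h := norm_trace_mul_sq_le (1 : Matrix d d ℂ) A
  rw [Matrix.one_mul] at h
  refine h.trans (le_of_eq ?_)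
  congr 1
  simp only [frobSq, Matrix.one_apply]
  have h1 : ∀ i j : d, ‖(if i = j then (1 : ℂ) else 0)‖ ^ 2 = if i = j then 1 else 0 :=
    fun i j => by split_ifs <;> simp
  simp [h1]

end HilbertSchmidtInner

/-! ### Choi matrices of moment operators and multiplicative error -/

section Multiplicative

variable {n : Type} [Fintype n] [DecidableEq n] {t : ℕ}

theorem choi_momentOperator_apply (μ : Measure (unitaryGroup n ℂ)) [IsFiniteMeasure μ]
    (x y : (Fin t → n) × (Fin t → n)) : choi (momentOperator t μ) x y =
      ∫ U : unitaryGroup n ℂ, star (tensorPow t (U : Matrix n n ℂ) x.2 x.1) *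
        tensorPow t (U : Matrix n n ℂ) y.2 y.1 ∂μ := by
  rw [choi, Matrix.of_apply, momentOperator_apply]
  refine integral_congr_ae (Filter.Eventually.of_forall fun U => ?_)
  simp only [twirl, ← conjTranspose_tensorPow]
  rw [Matrix.mul_apply, Finset.sum_eq_single y.2]
  · rw [Matrix.mul_apply, Finset.sum_eq_single x.2]
    · simp [conjTranspose_apply]
    · intro b _ hb
      simp [hb.symm]
    · simp
  · intro b _ hb
    rw [Matrix.mul_apply, Finset.sum_eq_zero, zero_mul]
    intro c _
    simp [hb.symm]
  · simp

theorem continuous_tensorPow_apply (x y : Fin t → n) :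
    Continuous fun U : unitaryGroup n ℂ => tensorPow t (U : Matrix n n ℂ) x y := by
  simp only [tensorPow, Matrix.of_apply]
  exact continuous_finsetProd _ fun s _ => continuous_subtype_val.matrix_elem _ _

theorem isHermitian_choi_momentOperator (μ : Measure (unitaryGroup n ℂ)) [IsFiniteMeasure μ] :
    (choi (momentOperator t μ)).IsHermitian := by
  refine Matrix.IsHermitian.ext fun x y => ?_
  rw [choi_momentOperator_apply, choi_momentOperator_apply, Complex.star_def, ← integral_conj]
  refine integral_congr_ae (Filter.Eventually.of_forall fun U => ?_)
  simp [mul_comm]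

/-- The quadratic form of the Choi matrix of a moment operator. -/
theorem choi_momentOperator_quadratic (μ : Measure (unitaryGroup n ℂ)) [IsFiniteMeasure μ]
    (ψ : (Fin t → n) × (Fin t → n) → ℂ) :
    star ψ ⬝ᵥ choi (momentOperator t μ) *ᵥ ψ =
      ∫ U : unitaryGroup n ℂ, ((‖(tensorPow t (U : Matrix n n ℂ) *
        Matrix.of fun a b => ψ (a, b)).trace‖ ^ 2 : ℝ) : ℂ) ∂μ := by
  have htr : ∀ U : unitaryGroup n ℂ, (tensorPow t (U : Matrix n n ℂ) *
      Matrix.of fun a b => ψ (a, b)).trace =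
        ∑ y, tensorPow t (U : Matrix n n ℂ) y.2 y.1 * ψ y := fun U => by
    simp only [Matrix.trace, Matrix.diag_apply, Matrix.mul_apply, Matrix.of_apply,
      Fintype.sum_prod_type]
    exact Finset.sum_comm
  have hsq : ∀ U : unitaryGroup n ℂ, ((‖(tensorPow t (U : Matrix n n ℂ) *
        Matrix.of fun a b => ψ (a, b)).trace‖ ^ 2 : ℝ) : ℂ) =
      ∑ x, ∑ y, star (ψ x) * (star (tensorPow t (U : Matrix n n ℂ) x.2 x.1) *
        tensorPow t (U : Matrix n n ℂ) y.2 y.1) * ψ y := fun U => by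
    push_cast
    rw [← Complex.conj_mul', htr, map_sum, Finset.sum_mul_sum]
    refine Finset.sum_congr rfl fun x _ => Finset.sum_congr rfl fun y _ => ?_
    rw [map_mul, Complex.star_def]
    ring
  have hint : ∀ x y : (Fin t → n) × (Fin t → n), Integrable (fun U : unitaryGroup n ℂ =>
      star (ψ x) * (star (tensorPow t (U : Matrix n n ℂ) x.2 x.1) *
        tensorPow t (U : Matrix n n ℂ) y.2 y.1) * ψ y) μ := fun x y => by
    refine Continuous.integrable_of_hasCompactSupport ?_ (HasCompactSupport.of_compactSpace _)
    exact (continuous_const.mul ((continuous_tensorPow_apply _ _).star.mul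
      (continuous_tensorPow_apply _ _))).mul continuous_const
  simp only [hsq]
  rw [integral_finsetSum _ fun x _ => integrable_finsetSum _ fun y _ => hint x y]
  simp only [dotProduct, mulVec, Pi.star_apply, Finset.mul_sum]
  refine Finset.sum_congr rfl fun x _ => ?_
  rw [integral_finsetSum _ fun y _ => hint x y]
  refine Finset.sum_congr rfl fun y _ => ?_
  rw [integral_mul_const, integral_const_mul, ← choi_momentOperator_apply, mul_assoc]

/-- On the span of the `U^{⊗t}`, the Choi matrix of the Haar moment operator is bounded below by
the inverse dimension. -/
theorem frobSq_le_choi_haar {K : Matrix (Fin t → n) (Fin t → n) ℂ}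
    (hK : K ∈ Submodule.span ℂ (Set.range fun U : unitaryGroup n ℂ =>
      tensorPow t (U : Matrix n n ℂ))) :
    frobSq K ≤ Fintype.card (Fin t → n) *
      (star (fun p : (Fin t → n) × (Fin t → n) => K p.1 p.2) ⬝ᵥ
        choi (momentOperator t (haar n)) *ᵥ fun p => K p.1 p.2).re := by
  rw [momentOperator_haar]
  have hid : Measurable (MonoidHom.id (unitaryGroup n ℂ)) := measurable_id
  set Φ := groupTwirl t (MonoidHom.id (unitaryGroup n ℂ)) with hΦ
  -- `Φ` maps into the commutant of the operators `U^{⊗t}`, and `K` is in their span.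
  have hcomm : ∀ A, Φ A * K = K * Φ A := by
    intro A
    have h1 : ∀ U : unitaryGroup n ℂ, Commute (Φ A) (tensorPow t (U : Matrix n n ℂ)) := fun U =>
      (twirl_eq_self_iff U _).mp (twirl_groupTwirl hid U A)
    refine Submodule.span_induction (p := fun K _ => Φ A * K = K * Φ A) ?_ (by simp) ?_ ?_ hK
    · rintro _ ⟨U, rfl⟩
      exact (h1 U).eq
    · intro B C _ _ hB hC
      rw [Matrix.mul_add, Matrix.add_mul, hB, hC]
    · intro c B _ hB
      rw [Matrix.mul_smul, Matrix.smul_mul, hB]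
  -- `R r y` carries the conjugate of row `r` of `K` in its column `y`, so its trace is the
  -- conjugate of `K r y`.
  let R : (Fin t → n) → (Fin t → n) → Matrix (Fin t → n) (Fin t → n) ℂ := fun r y =>
    ∑ x, star (K r x) • Matrix.single x y 1
  have hRapply : ∀ r y c e, R r y c e = if e = y then star (K r c) else 0 := by
    intro r y c e
    simp only [R, Matrix.sum_apply, Matrix.smul_apply, Matrix.single_apply, smul_eq_mul, mul_ite,
      mul_one, mul_zero]
    by_cases h : e = y
    · simp [h]
    · simp [h, Ne.symm h]
  -- Moving `K` across `Φ (E_xy)` by `hcomm` turns the quadratic form of the Choi matrix into a sum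
  -- of quadratic forms of the projection `Φ`.
  have hquad : (star (fun p : (Fin t → n) × (Fin t → n) => K p.1 p.2) ⬝ᵥ
      choi Φ *ᵥ fun p => K p.1 p.2) = ∑ r, ∑ y, ((R r y)ᴴ * Φ (R r y)).trace := by
    have hrhs : ∀ r y, ((R r y)ᴴ * Φ (R r y)).trace =
        ∑ x, ∑ c, star (K r x) * (K r c * Φ (Matrix.single x y 1) c y) := by
      intro r y
      simp only [Matrix.trace, Matrix.diag_apply, Matrix.mul_apply, conjTranspose_apply, hRapply]
      rw [Finset.sum_eq_single y]
      · simp only [if_true, star_star]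
        rw [Finset.sum_comm]
        refine Finset.sum_congr rfl fun c _ => ?_
        simp only [R, map_sum, map_smul, Matrix.sum_apply, Matrix.smul_apply, smul_eq_mul,
          Finset.mul_sum]
        exact Finset.sum_congr rfl fun x _ => by ring
      · intro b _ hb
        simp [hb]
      · simp
    simp only [hrhs]
    have hlhs : ∀ x1 x2 y2 : Fin t → n, ∑ y1, choi Φ (x1, x2) (y1, y2) * K y1 y2 =
        ∑ c, K x1 c * Φ (Matrix.single x2 y2 1) c y2 := by
      intro x1 x2 y2
      have := congrFun (congrFun (hcomm (Matrix.single x2 y2 1)) x1) y2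
      rw [Matrix.mul_apply, Matrix.mul_apply] at this
      exact this
    simp only [dotProduct, mulVec, Pi.star_apply, Fintype.sum_prod_type]
    refine Finset.sum_congr rfl fun r _ => ?_
    have : ∀ x2, ∑ y1, ∑ y2, choi Φ (r, x2) (y1, y2) * K y1 y2 =
        ∑ y2, ∑ c, K r c * Φ (Matrix.single x2 y2 1) c y2 := fun x2 => by
      rw [Finset.sum_comm]
      exact Finset.sum_congr rfl fun y2 _ => hlhs r x2 y2
    simp only [this, Finset.mul_sum]
    exact Finset.sum_comm
  have hone : Φ 1 = 1 := by
    rw [hΦ, groupTwirl_eq_self_iff hid]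
    exact fun u => Commute.one_left _
  have hpos : ∀ A, ((Aᴴ * Φ A).trace) = (frobSq (Φ A) : ℂ) := by
    intro A
    rw [← trace_conjTranspose_mul_self, conjTranspose_groupTwirl hid, ← trace_mul_groupTwirl hid,
      ← Module.End.mul_apply, groupTwirl_mul_self hid]
  have htrace : ∀ A, (Φ A).trace = A.trace := by
    intro A
    have := trace_mul_groupTwirl hid A (1 : Matrix (Fin t → n) (Fin t → n) ℂ)
    rw [← hΦ, hone, Matrix.one_mul, Matrix.one_mul] at this
    exact this
  have htrR : ∀ r y, (R r y).trace = star (K r y) := by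
    intro r y
    simp [Matrix.trace, hRapply]
  rw [hquad, Complex.re_sum, Finset.mul_sum, frobSq]
  refine Finset.sum_le_sum fun r _ => ?_
  rw [Complex.re_sum, Finset.mul_sum]
  refine Finset.sum_le_sum fun y _ => ?_
  rw [hpos, Complex.ofReal_re]
  -- `Φ` preserves the trace, so `|K r y|² = |tr Φ(R r y)|²`, at most the dimension times the
  -- squared norm of `Φ(R r y)`.
  refine le_trans (le_of_eq ?_) (trace_sq_le_card_mul_frobSq _)
  rw [htrace, htrR, norm_star]

theorem norm_dotProduct_mulVec_le {p : Type*} [Fintype p] (A : Matrix p p ℂ) (ψ : p → ℂ) :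
    ‖star ψ ⬝ᵥ A *ᵥ ψ‖ ≤ √(frobSq A) * ∑ x, ‖ψ x‖ ^ 2 := by
  have h1 : star ψ ⬝ᵥ A *ᵥ ψ = (Matrix.vecMulVec ψ (star ψ) * A).trace := by
    simp only [Matrix.trace, Matrix.diag_apply, Matrix.mul_apply, Matrix.vecMulVec_apply, dotProduct,
      mulVec, Finset.mul_sum, Pi.star_apply]
    rw [Finset.sum_comm]
    refine Finset.sum_congr rfl fun x _ => Finset.sum_congr rfl fun y _ => by ring
  have h2 : frobSq (Matrix.vecMulVec ψ (star ψ)) = (∑ x, ‖ψ x‖ ^ 2) ^ 2 := by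
    simp only [frobSq, Matrix.vecMulVec_apply, norm_mul, Pi.star_apply, norm_star, mul_pow, sq (∑ x, _),
      Finset.sum_mul_sum]
  rw [h1]
  refine (norm_trace_mul_le _ _).trans (le_of_eq ?_)
  rw [h2, Real.sqrt_mul (sq_nonneg _), Real.sqrt_sq (by positivity), mul_comm]

/-- Closeness of the moment operators in Hilbert–Schmidt norm implies the multiplicative-error
design property. -/
theorem isMultiplicativeDesign_of_frobSq_le (μ : Measure (unitaryGroup n ℂ)) [IsFiniteMeasure μ]
    {ε : ℝ} (h : Fintype.card (Fin t → n) *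
      √(frobSq (choi (momentOperator t μ - momentOperator t (haar n)))) ≤ ε) :
    IsMultiplicativeDesign t ε μ := by
  have hsub : choi (momentOperator t μ - momentOperator t (haar n)) =
      choi (momentOperator t μ) - choi (momentOperator t (haar n)) := by
    ext x y
    simp [choi]
  rw [hsub] at h
  set A := choi (momentOperator t μ) with hA
  set B := choi (momentOperator t (haar n)) with hB
  have key : ∀ ψ : (Fin t → n) × (Fin t → n) → ℂ, ∃ a b : ℝ, star ψ ⬝ᵥ A *ᵥ ψ = a ∧
      star ψ ⬝ᵥ B *ᵥ ψ = b ∧ |a - b| ≤ ε * b := by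
    intro ψ
    -- Both quadratic forms see `ψ` only through the traces against `U^{⊗t}`, hence only through its
    -- component in their span, which is closed under adjoints.
    obtain ⟨K', hK', K'', hK'', hK⟩ := exists_span_decomposition (Submodule.span ℂ
      (Set.range fun U : unitaryGroup n ℂ => tensorPow t (U : Matrix n n ℂ)))
      (Matrix.of fun a b => ψ (a, b))
    have htr : ∀ U : unitaryGroup n ℂ, (tensorPow t (U : Matrix n n ℂ) *
        Matrix.of fun a b => ψ (a, b)).trace = (tensorPow t (U : Matrix n n ℂ) * K').trace := by
      intro U
      have h1 := hK'' (tensorPow t ((U⁻¹ : unitaryGroup n ℂ) : Matrix n n ℂ))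
        (Submodule.subset_span ⟨U⁻¹, rfl⟩)
      rw [UnitaryGroup.inv_val, star_eq_conjTranspose, conjTranspose_tensorPow,
        conjTranspose_conjTranspose] at h1
      rw [hK, Matrix.mul_add, Matrix.trace_add, h1, add_zero]
    let ψ' : (Fin t → n) × (Fin t → n) → ℂ := fun p => K' p.1 p.2
    have hred : ∀ (ν : Measure (unitaryGroup n ℂ)) [IsFiniteMeasure ν],
        star ψ ⬝ᵥ choi (momentOperator t ν) *ᵥ ψ = star ψ' ⬝ᵥ choi (momentOperator t ν) *ᵥ ψ' := by
      intro ν _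
      rw [choi_momentOperator_quadratic, choi_momentOperator_quadratic]
      simp only [htr]
      rfl
    refine ⟨∫ U : unitaryGroup n ℂ, ‖(tensorPow t (U : Matrix n n ℂ) * K').trace‖ ^ 2 ∂μ,
      ∫ U : unitaryGroup n ℂ, ‖(tensorPow t (U : Matrix n n ℂ) * K').trace‖ ^ 2 ∂(haar n),
      ?_, ?_, ?_⟩
    · rw [hA, choi_momentOperator_quadratic, ← integral_complex_ofReal]
      simp only [htr]
    · rw [hB, choi_momentOperator_quadratic, ← integral_complex_ofReal]
      simp only [htr]
    · have hqA : star ψ' ⬝ᵥ A *ᵥ ψ' = ((∫ U : unitaryGroup n ℂ,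
          ‖(tensorPow t (U : Matrix n n ℂ) * K').trace‖ ^ 2 ∂μ : ℝ) : ℂ) := by
        rw [hA, choi_momentOperator_quadratic, ← integral_complex_ofReal]
        rfl
      have hqB : star ψ' ⬝ᵥ B *ᵥ ψ' = ((∫ U : unitaryGroup n ℂ,
          ‖(tensorPow t (U : Matrix n n ℂ) * K').trace‖ ^ 2 ∂(haar n) : ℝ) : ℂ) := by
        rw [hB, choi_momentOperator_quadratic, ← integral_complex_ofReal]
        rfl
      -- The chain is `|a - b| ≤ ‖A - B‖ ‖K'‖² ≤ ‖A - B‖ D b ≤ ε b`, with Frobenius norms.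
      have h1 := norm_dotProduct_mulVec_le (A - B) ψ'
      rw [Matrix.sub_mulVec, dotProduct_sub, hqA, hqB, ← Complex.ofReal_sub, Complex.norm_real,
        Real.norm_eq_abs] at h1
      have h2 := frobSq_le_choi_haar hK'
      change _ ≤ _ * (star ψ' ⬝ᵥ B *ᵥ ψ').re at h2
      rw [hqB, Complex.ofReal_re] at h2
      have h3 : ∑ x, ‖ψ' x‖ ^ 2 = frobSq K' := by
        simp only [ψ', frobSq, Fintype.sum_prod_type]
      rw [h3] at h1
      refine h1.trans ?_
      refine (mul_le_mul_of_nonneg_left h2 (Real.sqrt_nonneg _)).trans ?_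
      rw [← mul_assoc, mul_comm (√_)]
      exact mul_le_mul_of_nonneg_right h (integral_nonneg fun _ => sq_nonneg _)
  have hAh : A.IsHermitian := isHermitian_choi_momentOperator μ
  have hBh : B.IsHermitian := isHermitian_choi_momentOperator (haar n)
  have hsmul : ∀ c : ℝ, (c • B).IsHermitian := fun c => by
    rw [Matrix.IsHermitian, conjTranspose_smul, hBh.eq, star_trivial]
  refine ⟨Matrix.PosSemidef.of_dotProduct_mulVec_nonneg (hAh.sub (hsmul _)) fun ψ => ?_,
    Matrix.PosSemidef.of_dotProduct_mulVec_nonneg ((hsmul _).sub hAh) fun ψ => ?_⟩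
  · obtain ⟨a, b, ha, hb, hab⟩ := key ψ
    rw [Matrix.sub_mulVec, Matrix.smul_mulVec, dotProduct_sub, dotProduct_smul, ha, hb]
    have := (abs_le.mp hab).1
    have h0 : 0 ≤ a - (1 - ε) * b := by linarith
    rw [Complex.real_smul]
    exact_mod_cast h0
  · obtain ⟨a, b, ha, hb, hab⟩ := key ψ
    rw [Matrix.sub_mulVec, Matrix.smul_mulVec, dotProduct_sub, dotProduct_smul, ha, hb]
    have := (abs_le.mp hab).2
    have h0 : 0 ≤ (1 + ε) * b - a := by linarith
    rw [Complex.real_smul]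
    exact_mod_cast h0

theorem isAdditiveDesign_of_frobSq_le (μ : Measure (unitaryGroup n ℂ)) [IsFiniteMeasure μ]
    {ε : ℝ} (h : Fintype.card (Fin t → n) *
      √(frobSq (choi (momentOperator t μ - momentOperator t (haar n)))) ≤ ε) :
    IsAdditiveDesign t ε μ :=
  (diamondNorm_le _).trans (ENNReal.ofReal_le_ofReal h)

end Multiplicative

end RandomCircuit

namespace RandomCircuit

/-! ### Ranks of twirls as moments of traces -/

section TraceMoments

attribute [local instance] hsNormedAddCommGroup hsInnerProductSpace

variable {m n : Type*} [Fintype m] [DecidableEq m] [Fintype n] [DecidableEq n] {t : ℕ}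

theorem groupTwirl_single_apply {φ : unitaryGroup m ℂ →* unitaryGroup n ℂ} (hφ : Measurable φ)
    (a b x y : Fin t → n) : groupTwirl t φ (Matrix.single a b 1) x y =
      ∫ u, star (tensorPow t (φ u : Matrix n n ℂ) a x) * tensorPow t (φ u : Matrix n n ℂ) b y
        ∂(haar m) := by
  rw [groupTwirl_apply hφ]
  refine integral_congr_ae (Filter.Eventually.of_forall fun u => ?_)
  simp only [twirl, ← conjTranspose_tensorPow]
  rw [Matrix.mul_apply, Finset.sum_eq_single b]
  · rw [Matrix.mul_apply, Finset.sum_eq_single a]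
    · simp [conjTranspose_apply]
    · intro c _ hc
      simp [hc.symm]
    · simp
  · intro c _ hc
    rw [Matrix.mul_apply, Finset.sum_eq_zero, zero_mul]
    intro e _
    simp [hc.symm]
  · simp

/-- The left side is the trace of the superoperator, and conjugation by `U^{⊗t}` has trace `|tr
U|^(2t)`. -/
theorem sum_groupTwirl_single {φ : unitaryGroup m ℂ →* unitaryGroup n ℂ} (hφ : Continuous φ) :
    ∑ p : (Fin t → n) × (Fin t → n), groupTwirl t φ (Matrix.single p.1 p.2 1) p.1 p.2 =
      ((∫ u, ‖(φ u : Matrix n n ℂ).trace‖ ^ (2 * t) ∂(haar m) : ℝ) : ℂ) := by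
  simp only [groupTwirl_single_apply hφ.measurable]
  have hc : ∀ x y : Fin t → n, Continuous fun u => tensorPow t (φ u : Matrix n n ℂ) x y :=
    fun x y => (by
      simp only [tensorPow, Matrix.of_apply]
      exact continuous_finsetProd _ fun s _ =>
        (continuous_subtype_val.comp hφ).matrix_elem _ _)
  rw [← integral_finsetSum, ← integral_complex_ofReal]
  · refine integral_congr_ae (Filter.Eventually.of_forall fun u => ?_)
    have h1 : ((‖(φ u : Matrix n n ℂ).trace‖ ^ (2 * t) : ℝ) : ℂ) =
        star (tensorPow t (φ u : Matrix n n ℂ)).trace * (tensorPow t (φ u : Matrix n n ℂ)).trace := by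
      rw [trace_tensorPow, Complex.star_def, Complex.conj_mul', norm_pow, mul_comm 2 t, pow_mul]
      push_cast
      ring
    beta_reduce
    rw [h1]
    simp only [Fintype.sum_prod_type, Matrix.trace, Matrix.diag_apply, star_sum,
      Finset.sum_mul_sum]
  · intro p _
    refine Continuous.integrable_of_hasCompactSupport ?_ (HasCompactSupport.of_compactSpace _)
    exact (hc _ _).star.mul (hc _ _)

/-- For an orthogonal projection the squared Hilbert–Schmidt norm is the trace. -/
theorem hsNormSq_groupTwirl {φ : unitaryGroup m ℂ →* unitaryGroup n ℂ} (hφ : Continuous φ) :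
    hsNormSq (hsBasis (Fin t → n)) (groupTwirl t φ) =
      ∫ u, ‖(φ u : Matrix n n ℂ).trace‖ ^ (2 * t) ∂(haar m) := by
  have hP := isSymmetricProjection_groupTwirl (t := t) hφ.measurable
  apply Complex.ofReal_injective
  rw [← sum_groupTwirl_single hφ, hsNormSq]
  push_cast
  refine Finset.sum_congr rfl fun p _ => ?_
  rw [← hs_inner_single_left p.1 p.2 (groupTwirl t φ (Matrix.single p.1 p.2 1)), ← hsBasis_apply]
  have h := inner_self_eq_norm_sq_to_K (𝕜 := ℂ) (groupTwirl t φ (hsBasis (Fin t → n) p))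
  rw [hP.isSymmetric, symmetricProjection_apply_apply hP] at h
  rw [h]
  simp

/-- The second moment of the trace of a Haar-random unitary. -/
theorem integral_norm_trace_sq [Nonempty m] :
    ∫ u : unitaryGroup m ℂ, ‖(u : Matrix m m ℂ).trace‖ ^ 2 ∂(haar m) = 1 := by
  have hid : Measurable (MonoidHom.id (unitaryGroup m ℂ)) := measurable_id
  have h := sum_groupTwirl_single (t := 1) (φ := MonoidHom.id (unitaryGroup m ℂ)) continuous_id
  simp only [mul_one, MonoidHom.id_apply] at h
  apply Complex.ofReal_injective
  rw [← h]
  set Φ := groupTwirl 1 (MonoidHom.id (unitaryGroup m ℂ)) with hΦ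
  have hone : Φ 1 = 1 := by
    rw [hΦ, groupTwirl_eq_self_iff hid]
    exact fun u => Commute.one_left _
  -- Schur's lemma: the image of the full twirl commutes with all matrix units.
  have hscalar : ∀ A, ∃ c : ℂ, Φ A = Matrix.scalar _ c := by
    intro A
    have hA : Φ (Φ A) = Φ A := by rw [hΦ, ← Module.End.mul_apply, groupTwirl_mul_self hid]
    rw [hΦ, groupTwirl_eq_self_iff hid] at hA
    have h1 : ∀ B : Matrix m m ℂ, B ∈ commSubmodule (Φ A) := fun B =>
      dGamma_commute LinearMap.id rfl (fun u hu => hA ⟨u, hu⟩) B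
    have h2 : ∀ i j : Fin 1 → m, i ≠ j → Commute (Matrix.single i j 1) (Φ A) := by
      intro i j _
      have := h1 (Matrix.single (i 0) (j 0) 1)
      rw [mem_commSubmodule, dGamma_apply, Fin.sum_univ_one] at this
      have h3 : slot 0 (Matrix.single (i 0) (j 0) (1 : ℂ)) = Matrix.single i j 1 := by
        rw [slot, ← piTensor_single]
        congr 1
        funext s
        rw [Subsingleton.elim s 0, Function.update_self]
      rw [h3] at this
      exact this.symm
    obtain ⟨c, hc⟩ := Matrix.mem_range_scalar_of_commute_single h2
    exact ⟨c, hc.symm⟩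
  have htrace : ∀ A, (Φ A).trace = A.trace := by
    intro A
    have := trace_mul_groupTwirl hid A (1 : Matrix (Fin 1 → m) (Fin 1 → m) ℂ)
    rw [← hΦ, hone, Matrix.one_mul, Matrix.one_mul] at this
    exact this
  have hcard : (Fintype.card (Fin 1 → m) : ℂ) ≠ 0 := by exact_mod_cast Fintype.card_ne_zero
  have hval : ∀ a b, Φ (Matrix.single a b 1) a b =
      if a = b then (Fintype.card (Fin 1 → m) : ℂ)⁻¹ else 0 := by
    intro a b
    obtain ⟨c, hc⟩ := hscalar (Matrix.single a b 1)
    by_cases hab : a = b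
    · subst hab
      have h1 := htrace (Matrix.single a a 1)
      rw [hc] at h1 ⊢
      simp only [Matrix.scalar_apply, trace_diagonal, Finset.sum_const, Finset.card_univ,
        nsmul_eq_mul, Matrix.trace_single_eq_same] at h1
      rw [Matrix.scalar_apply, diagonal_apply_eq, if_pos rfl]
      exact eq_inv_of_mul_eq_one_right h1
    · rw [hc, if_neg hab, Matrix.scalar_apply, diagonal_apply_ne _ hab]
  simp only [Fintype.sum_prod_type, hval]
  simp

end TraceMoments

section GateTrace

attribute [local instance] hsNormedAddCommGroup hsInnerProductSpace

variable {N q t : ℕ}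

theorem trace_embed (i : Fin (N - 1)) (A : Matrix (Fin q × Fin q) (Fin q × Fin q) ℂ) :
    (embed i A).trace = A.trace *
      Fintype.card ({k : Fin N // k ≠ leftSite i ∧ k ≠ rightSite i} → Fin q) := by
  rw [← Matrix.trace_one, ← Matrix.trace_kronecker]
  simp only [embed, LinearMap.coe_mk, AddHom.coe_mk, Matrix.trace, Matrix.diag_apply,
    submatrix_apply]
  exact Equiv.sum_comp (splitSites q i) fun p => (A ⊗ₖ (1 : Matrix _ _ ℂ)) p p

theorem continuous_gateHom (i : Fin (N - 1)) : Continuous (gateHom (q := q) i) := by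
  refine Continuous.subtype_mk ?_ _
  refine Continuous.matrix_submatrix ?_ _ _
  refine continuous_matrix fun x y => ?_
  simp only [kroneckerMap_apply]
  exact (continuous_subtype_val.matrix_elem _ _).mul continuous_const

theorem norm_trace_unitary_le {m : Type*} [Fintype m] [DecidableEq m] (u : unitaryGroup m ℂ) :
    ‖(u : Matrix m m ℂ).trace‖ ≤ Fintype.card m := by
  refine (norm_sum_le _ _).trans ?_
  refine (Finset.sum_le_sum fun i _ => entry_norm_bound_of_unitary u.2 i i).trans ?_
  simp

/-- The rank of a gate twirl is at most `q⁻⁴` times the dimension of the operator space. -/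
theorem hsNormSq_gate_le (hq : 1 ≤ q) (ht : 1 ≤ t) (i : Fin (N - 1)) :
    hsNormSq (hsBasis (Fin t → Fin N → Fin q)) (groupTwirl t (gateHom i)) ≤
      ((q : ℝ) ^ (N * t)) ^ 2 / (q : ℝ) ^ 4 := by
  have : Nonempty (Fin q) := ⟨⟨0, hq⟩⟩
  have hq0 : (0 : ℝ) < q := by exact_mod_cast hq
  rw [hsNormSq_groupTwirl (continuous_gateHom i)]
  set c : ℕ := Fintype.card ({k : Fin N // k ≠ leftSite i ∧ k ≠ rightSite i} → Fin q) with hc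
  have hcard : q ^ N = q ^ 2 * c := by
    have := Fintype.card_congr (splitSites q i)
    simpa [Fintype.card_prod, sq, hc] using this
  -- All but two of the `2t` factors `|tr u|` are bounded by `q²`. The remaining square has Haar
  -- mean `1` instead of `q⁴`, whence the gain `q⁻⁴`.
  have hbound : ∀ u : unitaryGroup (Fin q × Fin q) ℂ,
      ‖(gateHom i u : Matrix (Fin N → Fin q) (Fin N → Fin q) ℂ).trace‖ ^ (2 * t) ≤
        ((c : ℝ) ^ (2 * t) * ((q : ℝ) ^ 2) ^ (2 * t - 2)) * ‖u.1.trace‖ ^ 2 := by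
    intro u
    rw [coe_gateHom, trace_embed, norm_mul, ← hc, Complex.norm_natCast, mul_pow]
    have h1 : ‖u.1.trace‖ ≤ (q : ℝ) ^ 2 := by
      have := norm_trace_unitary_le u
      simpa [Fintype.card_prod, sq] using this
    have h2 : ‖u.1.trace‖ ^ (2 * t) = ‖u.1.trace‖ ^ (2 * t - 2) * ‖u.1.trace‖ ^ 2 := by
      rw [← pow_add]
      congr 1
      omega
    rw [h2, mul_comm _ ((c : ℝ) ^ (2 * t)), mul_assoc]
    refine mul_le_mul_of_nonneg_left ?_ (by positivity)
    exact mul_le_mul_of_nonneg_right (pow_le_pow_left₀ (norm_nonneg _) h1 _) (by positivity)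
  have hcont : Continuous fun u : unitaryGroup (Fin q × Fin q) ℂ => ‖u.1.trace‖ := by
    refine Continuous.norm ?_
    simp only [Matrix.trace, Matrix.diag_apply]
    exact continuous_finsetSum _ fun i _ => continuous_subtype_val.matrix_elem _ _
  have hcont' : Continuous fun u : unitaryGroup (Fin q × Fin q) ℂ =>
      ‖(gateHom i u : Matrix (Fin N → Fin q) (Fin N → Fin q) ℂ).trace‖ := by
    refine Continuous.norm ?_
    simp only [Matrix.trace, Matrix.diag_apply]
    exact continuous_finsetSum _ fun j _ =>
      (continuous_subtype_val.comp (continuous_gateHom i)).matrix_elem _ _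
  refine (integral_mono_of_nonneg (Filter.Eventually.of_forall fun u => by positivity) ?_
    (Filter.Eventually.of_forall hbound)).trans ?_
  · exact ((hcont.pow 2).const_mul _).integrable_of_hasCompactSupport
      (HasCompactSupport.of_compactSpace _)
  · rw [integral_const_mul, integral_norm_trace_sq, mul_one, le_div_iff₀ (by positivity)]
    have h3 : ((q : ℝ) ^ (N * t)) ^ 2 = ((q : ℝ) ^ 2 * c) ^ (2 * t) := by
      have : (q : ℝ) ^ N = (q : ℝ) ^ 2 * c := by exact_mod_cast hcard
      rw [← this]
      ring
    have h4 : ((q : ℝ) ^ 2) ^ (2 * t - 2) * (q : ℝ) ^ 4 = ((q : ℝ) ^ 2) ^ (2 * t) := by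
      have : (q : ℝ) ^ 4 = ((q : ℝ) ^ 2) ^ 2 := by ring
      rw [this, ← pow_add]
      congr 1
      omega
    rw [h3, mul_assoc, h4, mul_pow, mul_comm]

end GateTrace

end RandomCircuit

namespace RandomCircuit

/-! ### The commutant of `U ⊗ U` -/

section TwoCopies

variable {n : Type*} [Fintype n] [DecidableEq n]

/-- The operator exchanging two copies. -/
def copySwap (n : Type*) [DecidableEq n] : Matrix (Fin 2 → n) (Fin 2 → n) ℂ :=
  Matrix.of fun x y => if x = ![y 1, y 0] then 1 else 0

theorem commute_tensorPow_of_commute_unitary {t : ℕ} {X : Matrix (Fin t → n) (Fin t → n) ℂ}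
    (h : ∀ u : unitaryGroup n ℂ, Commute X (tensorPow t (u : Matrix n n ℂ))) (A : Matrix n n ℂ) :
    Commute X (tensorPow t A) :=
  commute_tensorPow_of_commute_dGamma fun _ =>
    dGamma_commute LinearMap.id rfl (fun u hu => h ⟨u, hu⟩) _

/-- Polarization puts the symmetrized matrix units into the span of the squares `A ⊗ A`. -/
theorem polarization_tensorPow_two (a b c d : n) :
    tensorPow 2 (Matrix.single a b 1 + Matrix.single c d 1) - tensorPow 2 (Matrix.single a b 1) -
      tensorPow 2 (Matrix.single c d 1) =
        Matrix.single ![a, c] ![b, d] (1 : ℂ) + Matrix.single ![c, a] ![d, b] 1 := by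
  have h : ∀ (a c b d : n) (x y : Fin 2 → n), Matrix.single ![a, c] ![b, d] (1 : ℂ) x y =
      Matrix.single a b (1 : ℂ) (x 0) (y 0) * Matrix.single c d (1 : ℂ) (x 1) (y 1) := by
    intro a c b d x y
    simp only [Matrix.single_apply, funext_iff, Fin.forall_fin_two, Matrix.cons_val_zero,
      Matrix.cons_val_one, ← ite_and, mul_ite, mul_one, mul_zero]
    congr 1
    apply propext
    tauto
  ext x y
  simp only [Matrix.sub_apply, Matrix.add_apply, h, tensorPow, Matrix.of_apply, Fin.prod_univ_two]
  ring

/-- The commutant of `{U ⊗ U}` is spanned by the identity and the swap. -/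
theorem exists_eq_smul_one_add_smul_copySwap [Nontrivial n] {X : Matrix (Fin 2 → n) (Fin 2 → n) ℂ}
    (h : ∀ u : unitaryGroup n ℂ, Commute X (tensorPow 2 (u : Matrix n n ℂ))) :
    ∃ α β : ℂ, X = α • (1 : Matrix (Fin 2 → n) (Fin 2 → n) ℂ) + β • copySwap n := by
  have key : ∀ (a b c d : n) (x y : Fin 2 → n),
      (if ![b, d] = y then X x ![a, c] else 0) + (if ![d, b] = y then X x ![c, a] else 0) =
      (if ![a, c] = x then X ![b, d] y else 0) + (if ![c, a] = x then X ![d, b] y else 0) := by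
    intro a b c d x y
    have h1 : Commute X (Matrix.single ![a, c] ![b, d] (1 : ℂ) + Matrix.single ![c, a] ![d, b] 1) := by
      rw [← polarization_tensorPow_two]
      have := commute_tensorPow_of_commute_unitary h
      exact ((this _).sub_right (this _)).sub_right (this _)
    have h2 := congrFun (congrFun h1.eq x) y
    simp only [Matrix.mul_add, Matrix.add_mul, Matrix.add_apply] at h2
    have e1 : ∀ i j : Fin 2 → n, (X * Matrix.single i j (1 : ℂ)) x y = if j = y then X x i else 0 := by
      intro i j
      split_ifs with hj
      · subst hj
        simp
      · simp [Ne.symm hj]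
    have e2 : ∀ i j : Fin 2 → n, (Matrix.single i j (1 : ℂ) * X) x y = if i = x then X j y else 0 := by
      intro i j
      split_ifs with hj
      · subst hj
        simp
      · simp [Ne.symm hj]
    rwa [e1, e1, e2, e2] at h2
  have pair : ∀ a b c d : n, (![a, b] = ![c, d]) ↔ a = c ∧ b = d := by
    intro a b c d
    simp [funext_iff, Fin.forall_fin_two]
  have eta : ∀ x : Fin 2 → n, x = ![x 0, x 1] := by
    intro x
    funext s
    fin_cases s <;> rfl
  have hzero : ∀ (a c : n) (x : Fin 2 → n), x ≠ ![a, c] → x ≠ ![c, a] → X x ![a, c] = 0 := by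
    intro a c x h1 h2
    have := key a a c c x ![a, c]
    rw [if_pos rfl, if_neg h1.symm, if_neg h2.symm] at this
    by_cases hac : a = c
    · subst hac
      rw [if_pos rfl] at this
      linear_combination this / 2
    · rw [if_neg (by rw [pair]; exact fun h => hac h.2)] at this
      simpa using this
  -- One reference pair of distinct labels fixes both coefficients; special cases of `key` carry
  -- them to all other entries.
  obtain ⟨b, d, hbd⟩ := exists_pair_ne n
  have hdiag : ∀ a c, a ≠ c → X ![a, c] ![a, c] = X ![b, d] ![b, d] := by
    intro a c hac
    have := key a b c d ![a, c] ![b, d]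
    simpa [pair, hac, hac.symm, hbd, hbd.symm] using this
  have hoff : ∀ a c, a ≠ c → X ![a, c] ![c, a] = X ![b, d] ![d, b] := by
    intro a c hac
    have := key a b c d ![a, c] ![d, b]
    simpa [pair, hac, hac.symm, hbd, hbd.symm] using this
  have hsame : ∀ a, X ![a, a] ![a, a] = X ![b, d] ![b, d] + X ![b, d] ![d, b] := by
    intro a
    have := key b a d a ![b, d] ![a, a]
    simpa [pair, hbd, hbd.symm] using this.symm
  refine ⟨X ![b, d] ![b, d], X ![b, d] ![d, b], ?_⟩
  ext x y
  simp only [Matrix.add_apply, Matrix.smul_apply, Matrix.one_apply, copySwap, Matrix.of_apply,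
    smul_eq_mul]
  obtain ⟨a, c, rfl⟩ : ∃ a c, y = ![a, c] := ⟨y 0, y 1, eta y⟩
  simp only [Matrix.cons_val_zero, Matrix.cons_val_one]
  by_cases hac : a = c
  · subst hac
    by_cases hx : x = ![a, a]
    · simp [hx, hsame]
    · simp [hx, hzero a a x hx hx]
  · by_cases hx : x = ![a, c]
    · subst hx
      simp [hdiag a c hac, pair, hac]
    · by_cases hx' : x = ![c, a]
      · subst hx'
        simp [hoff c a (Ne.symm hac), pair, hac, Ne.symm hac]
      · simp [hx, hx', hzero a c x hx hx']

end TwoCopies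

end RandomCircuit

namespace RandomCircuit

/-! ### Domain wall operators and their Gram matrix -/

section DomainWalls

attribute [local instance] hsNormedAddCommGroup hsInnerProductSpace

variable {N q : ℕ}

/-- Exchange the two copies of the sites `j < k`. -/
def wallMap (k : ℕ) (y : Fin 2 → Fin N → Fin q) : Fin 2 → Fin N → Fin q :=
  fun s j => if (j : ℕ) < k then y (s + 1) j else y s j

theorem wallMap_wallMap (k : ℕ) (y : Fin 2 → Fin N → Fin q) : wallMap k (wallMap k y) = y := by
  funext s j
  have hs : s + 1 + 1 = s := by
    revert s
    decide
  by_cases hj : (j : ℕ) < k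
  · simp [wallMap, hj, hs]
  · simp [wallMap, hj]

theorem eq_wallMap_iff (k : ℕ) (x y : Fin 2 → Fin N → Fin q) :
    x = wallMap k y ↔ y = wallMap k x :=
  ⟨fun h => by rw [h, wallMap_wallMap], fun h => by rw [h, wallMap_wallMap]⟩

/-- The domain wall operator: the swap on sites `j < k`, the identity on the other sites. -/
def wall (N q k : ℕ) : Matrix (Fin 2 → Fin N → Fin q) (Fin 2 → Fin N → Fin q) ℂ :=
  Matrix.of fun x y => if x = wallMap k y then 1 else 0

theorem wall_mul_apply (k : ℕ) (A : Matrix (Fin 2 → Fin N → Fin q) (Fin 2 → Fin N → Fin q) ℂ)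
    (x y : Fin 2 → Fin N → Fin q) : (wall N q k * A) x y = A (wallMap k x) y := by
  simp only [Matrix.mul_apply, wall, Matrix.of_apply, eq_wallMap_iff k x, ite_mul, one_mul, zero_mul]
  simp

theorem mul_wall_apply (k : ℕ) (A : Matrix (Fin 2 → Fin N → Fin q) (Fin 2 → Fin N → Fin q) ℂ)
    (x y : Fin 2 → Fin N → Fin q) : (A * wall N q k) x y = A x (wallMap k y) := by
  simp only [Matrix.mul_apply, wall, Matrix.of_apply, mul_ite, mul_one, mul_zero]
  simp

theorem wall_zero : wall N q 0 = 1 := by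
  ext x y
  have h : wallMap 0 y = y := by
    funext s j
    simp [wallMap]
  simp [wall, Matrix.one_apply, h]

theorem wall_top : wall N q N = copySwap (Fin N → Fin q) := by
  ext x y
  have h : wallMap N y = ![y 1, y 0] := by
    funext s j
    fin_cases s <;> simp [wallMap]
  simp [wall, copySwap, h]

/-- Unless the wall separates the two sites of the gate, both or neither of them are swapped, and `u
⊗ u` commutes with either. -/
theorem groupTwirl_gateHom_wall (i : Fin (N - 1)) {k : ℕ} (hk : k ≠ i + 1) :
    groupTwirl 2 (gateHom i) (wall N q k) = wall N q k := by
  rw [groupTwirl_gateHom_eq_self_iff]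
  intro u _
  rw [commute_iff_eq]
  ext x y
  rw [wall_mul_apply, mul_wall_apply]
  have hmerge : ∀ (p r : Prop) [Decidable p] [Decidable r] (c e : ℂ),
      (c * if p then 1 else 0) * (e * if r then 1 else 0) = c * e * if p ∧ r then 1 else 0 := by
    intro p r _ _ c e
    by_cases hp : p <;> by_cases hr : r <;> simp [hp, hr]
  simp only [tensorPow, Matrix.of_apply, embed_apply, Fin.prod_univ_two, hmerge, ← forall_and]
  congr 1
  swap
  · congr 1
    apply propext
    refine forall_congr' fun j => ?_
    by_cases hj : (j : ℕ) < k
    · simp only [wallMap, hj, if_true, zero_add, show (1 : Fin 2) + 1 = 0 from rfl]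
      tauto
    · simp only [wallMap, hj, if_false]
  · have hi : ((leftSite i : Fin N) : ℕ) = i := rfl
    have hi' : ((rightSite i : Fin N) : ℕ) = i + 1 := rfl
    rcases Nat.lt_or_gt_of_ne hk with h | h
    · have h1 : ¬ (i : ℕ) < k := by omega
      have h2 : ¬ (i : ℕ) + 1 < k := by omega
      simp [wallMap, hi, hi', h1, h2]
    · have h1 : (i : ℕ) < k := by omega
      simp only [wallMap, hi, hi', h1, h, if_true, zero_add, show (1 : Fin 2) + 1 = 0 from rfl]
      ring

/-- Two walls multiply to the swap on the sites between them; such a site contributes trace `q` and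
any other site `q²`. -/
theorem inner_wall {k l : ℕ} (hkl : k ≤ l) (hl : l ≤ N) (hq : 1 ≤ q) :
    ⟪wall N q k, wall N q l⟫_ℂ = (((q : ℝ) ^ (2 * N) * ((q : ℝ)⁻¹) ^ (l - k) : ℝ) : ℂ) := by
  have hq0 : (q : ℂ) ≠ 0 := by exact_mod_cast (show q ≠ 0 by omega)
  have h1 : ⟪wall N q k, wall N q l⟫_ℂ = ∑ y : Fin 2 → Fin N → Fin q,
      ∏ j : Fin N, if k ≤ (j : ℕ) ∧ (j : ℕ) < l → y 0 j = y 1 j then (1 : ℂ) else 0 := by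
    rw [hs_inner_def]
    refine Finset.sum_congr rfl fun y _ => ?_
    rw [Matrix.diag_apply, mul_wall_apply, conjTranspose_apply, Fintype.prod_boole]
    simp only [wall, Matrix.of_apply, RCLike.star_def, apply_ite (starRingEnd ℂ), map_one, map_zero]
    congr 1
    apply propext
    simp only [funext_iff]
    constructor
    · intro h j hj
      have := h 0 j
      have h' : ¬ (j : ℕ) < k := by omega
      simpa [wallMap, hj.2, h', eq_comm] using this
    · intro h s j
      by_cases h1 : (j : ℕ) < k
      · have h2 : (j : ℕ) < l := by omega
        simp [wallMap, h1, h2]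
      · by_cases h2 : (j : ℕ) < l
        · have h3 := h j ⟨by omega, h2⟩
          fin_cases s <;> simp [wallMap, h1, h2, h3]
        · simp [wallMap, h1, h2]
  rw [h1]
  let e : (Fin 2 → Fin N → Fin q) ≃ (Fin N → Fin q × Fin q) :=
    { toFun := fun y j => (y 0 j, y 1 j)
      invFun := fun p => ![fun j => (p j).1, fun j => (p j).2]
      left_inv := fun y => by
        funext s j
        fin_cases s <;> rfl
      right_inv := fun p => rfl }
  have h2 := e.sum_comp fun p : Fin N → Fin q × Fin q =>
    ∏ j : Fin N, if k ≤ (j : ℕ) ∧ (j : ℕ) < l → (p j).1 = (p j).2 then (1 : ℂ) else 0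
  refine h2.trans ?_
  have h3 := (Fintype.prod_sum fun (j : Fin N) (p : Fin q × Fin q) =>
    if k ≤ (j : ℕ) ∧ (j : ℕ) < l → p.1 = p.2 then (1 : ℂ) else 0).symm
  refine h3.trans ?_
  have h4 : ∀ j : Fin N, (∑ p : Fin q × Fin q,
      if k ≤ (j : ℕ) ∧ (j : ℕ) < l → p.1 = p.2 then (1 : ℂ) else 0) =
        (q : ℂ) ^ 2 * if k ≤ (j : ℕ) ∧ (j : ℕ) < l then (q : ℂ)⁻¹ else 1 := by
    intro j
    by_cases hj : k ≤ (j : ℕ) ∧ (j : ℕ) < l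
    · rw [if_pos hj, Fintype.sum_prod_type]
      simp only [hj, and_self, true_imp_iff]
      simp
      field_simp
    · simp only [hj, false_imp_iff]
      simp [Fintype.card_prod, sq]
  simp only [h4]
  rw [Finset.prod_mul_distrib, Finset.prod_const, Finset.card_univ, Fintype.card_fin, ← pow_mul,
    Fin.prod_univ_eq_prod_range (fun j => if k ≤ j ∧ j < l then (q : ℂ)⁻¹ else 1) N,
    Finset.prod_ite, Finset.prod_const_one, mul_one, Finset.prod_const]
  have h5 : (Finset.range N).filter (fun j => k ≤ j ∧ j < l) = Finset.Ico k l := by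
    ext j
    simp only [Finset.mem_filter, Finset.mem_range, Finset.mem_Ico]
    omega
  rw [h5, Nat.card_Ico]
  push_cast
  rfl

end DomainWalls

end RandomCircuit

namespace RandomCircuit

/-! ### Lower bound on the overlap of the two layers -/

section Overlap

attribute [local instance] hsNormedAddCommGroup hsInnerProductSpace

variable {N q : ℕ}

theorem groupTwirl_id_eq_zero_of_inner_eq_zero (hN : 1 ≤ N) (hq : 2 ≤ q)
    {v : Matrix (Fin 2 → Fin N → Fin q) (Fin 2 → Fin N → Fin q) ℂ}
    (h0 : ⟪wall N q 0, v⟫_ℂ = 0) (h1 : ⟪wall N q N, v⟫_ℂ = 0) :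
    groupTwirl 2 (MonoidHom.id (unitaryGroup (Fin N → Fin q) ℂ)) v = 0 := by
  have : Nonempty (Fin N) := ⟨⟨0, hN⟩⟩
  have : Nontrivial (Fin q) := Fin.nontrivial_iff_two_le.mpr hq
  have hid : Measurable (MonoidHom.id (unitaryGroup (Fin N → Fin q) ℂ)) := measurable_id
  have hP := isSymmetricProjection_groupTwirl (t := 2) hid
  set Φ := groupTwirl 2 (MonoidHom.id (unitaryGroup (Fin N → Fin q) ℂ)) with hΦ
  have hfix : Φ (Φ v) = Φ v := by rw [hΦ, ← Module.End.mul_apply, groupTwirl_mul_self hid]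
  have hcomm := (groupTwirl_eq_self_iff hid (Φ v)).mp hfix
  obtain ⟨α, β, hαβ⟩ := exists_eq_smul_one_add_smul_copySwap hcomm
  have : ⟪Φ v, Φ v⟫_ℂ = 0 := by
    rw [← hP.isSymmetric, hfix, hαβ, ← wall_zero, ← wall_top, inner_add_left, inner_smul_left,
      inner_smul_left, h0, h1, mul_zero, mul_zero, add_zero]
  exact inner_self_eq_zero.mp this

/-- Vectors fixed by the gates of an even, respectively an odd, layer whose ranges meet at a
definite angle. -/
theorem exists_overlap_two (hN : 3 ≤ N) (hq : 2 ≤ q) :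
    ∃ v w : Matrix (Fin 2 → Fin N → Fin q) (Fin 2 → Fin N → Fin q) ℂ,
      (∀ i : Fin (N - 1), (i : ℕ) % 2 = 0 → groupTwirl 2 (gateHom i) v = v) ∧
      (∀ i : Fin (N - 1), (i : ℕ) % 2 = 1 → groupTwirl 2 (gateHom i) w = w) ∧
      groupTwirl 2 (MonoidHom.id (unitaryGroup (Fin N → Fin q) ℂ)) v = 0 ∧
      ⟪w, v⟫_ℂ ≠ 0 ∧ ‖w‖ ^ 2 * ‖v‖ ^ 2 ≤ (q : ℝ) ^ 4 * ‖⟪w, v⟫_ℂ‖ ^ 2 := by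
  have hq1 : 1 ≤ q := by omega
  have hq0 : (0 : ℝ) < q := by exact_mod_cast hq1
  set x : ℝ := (q : ℝ)⁻¹ with hx
  set G : ℝ := (q : ℝ) ^ (2 * N) with hG
  set X : ℝ := x ^ (N - 2) with hX
  have hx0 : 0 < x := by positivity
  have hX0 : 0 < X := by positivity
  have hG0 : 0 < G := by positivity
  have hx2 : x ≤ 1 / 2 := by
    rw [hx, one_div]
    exact inv_anti₀ (by norm_num) (by exact_mod_cast hq)
  have hXx : X ≤ x := pow_le_of_le_one hx0.le (by linarith) (by omega)
  have eN : x ^ N = X * x ^ 2 := by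
    rw [hX, ← pow_add]
    congr 1
    omega
  have eN1 : x ^ (N - 1) = X * x := by
    rw [hX, ← pow_succ]
    congr 1
    omega
  have g : ∀ k l : ℕ, k ≤ l → l ≤ N →
      ⟪wall N q k, wall N q l⟫_ℂ = ((G * x ^ (l - k) : ℝ) : ℂ) :=
    fun k l h h' => inner_wall h h' hq1
  have g' : ∀ k l : ℕ, k ≤ l → l ≤ N →
      ⟪wall N q l, wall N q k⟫_ℂ = ((G * x ^ (l - k) : ℝ) : ℂ) := by
    intro k l h h'
    rw [← inner_conj_symm, g k l h h', Complex.conj_ofReal]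
  have g00 := g 0 0 le_rfl (by omega)
  have g01 := g 0 1 (by omega) (by omega)
  have g02 := g 0 2 (by omega) (by omega)
  have g0N := g 0 N (by omega) (by omega)
  have g10 := g' 0 1 (by omega) (by omega)
  have g20 := g' 0 2 (by omega) (by omega)
  have gN0 := g' 0 N (by omega) (by omega)
  have g11 := g 1 1 le_rfl (by omega)
  have g12 := g 1 2 (by omega) (by omega)
  have g1N := g 1 N (by omega) le_rfl
  have g21 := g' 1 2 (by omega) (by omega)
  have gN1 := g' 1 N (by omega) le_rfl
  have g22 := g 2 2 le_rfl (by omega)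
  have g2N := g 2 N (by omega) le_rfl
  have gN2 := g' 2 N (by omega) le_rfl
  have gNN := g N N le_rfl le_rfl
  simp only [Nat.sub_self, Nat.sub_zero, pow_zero, pow_one, eN, eN1, ← hX,
    show 2 - 1 = 1 from rfl] at g00 g01 g02 g0N g10 g20 gN0 g11 g12 g1N g21 gN1 g22 g2N gN2 gNN
  -- `v` and `w` are the walls at `2` and `1` with their components along the walls at `0` and `N`
  -- removed. The Gram–Schmidt coefficients are cleared of their common denominator `s = 1 -
  -- x^(2N)`.
  set s : ℝ := 1 - X ^ 2 * x ^ 4 with hs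
  set v := (s : ℂ) • wall N q 2 - ((x ^ 2 * (1 - X ^ 2) : ℝ) : ℂ) • wall N q 0 -
    ((X * (1 - x ^ 4) : ℝ) : ℂ) • wall N q N with hv
  set w := (s : ℂ) • wall N q 1 - ((x * (1 - X ^ 2 * x ^ 2) : ℝ) : ℂ) • wall N q 0 -
    ((X * x * (1 - x ^ 2) : ℝ) : ℂ) • wall N q N with hw
  have hvv : ⟪v, v⟫_ℂ = ((G * s * (1 - x ^ 4) * (1 - X ^ 2) : ℝ) : ℂ) := by
    simp only [hv, inner_sub_left, inner_sub_right, inner_smul_left, inner_smul_right,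
      Complex.conj_ofReal, g00, g02, g0N, g20, gN0, g22, g2N, gN2, gNN, hs]
    push_cast
    ring
  have hww : ⟪w, w⟫_ℂ = ((G * s * (1 - x ^ 2) * (1 - X ^ 2 * x ^ 2) : ℝ) : ℂ) := by
    simp only [hw, inner_sub_left, inner_sub_right, inner_smul_left, inner_smul_right,
      Complex.conj_ofReal, g00, g01, g0N, g10, gN0, g11, g1N, gN1, gNN, hs]
    push_cast
    ring
  have hwv : ⟪w, v⟫_ℂ = ((G * s * x * (1 - x ^ 2) * (1 - X ^ 2) : ℝ) : ℂ) := by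
    simp only [hv, hw, inner_sub_left, inner_sub_right, inner_smul_left, inner_smul_right,
      Complex.conj_ofReal, g00, g02, g0N, g10, g12, g1N, gN0, gN2, gNN, hs]
    push_cast
    ring
  have h0v : ⟪wall N q 0, v⟫_ℂ = 0 := by
    simp only [hv, inner_sub_right, inner_smul_right, g00, g02, g0N, hs]
    push_cast
    ring
  have hNv : ⟪wall N q N, v⟫_ℂ = 0 := by
    simp only [hv, inner_sub_right, inner_smul_right, gN0, gN2, gNN, hs]
    push_cast
    ring
  have nsq : ∀ (u : Matrix (Fin 2 → Fin N → Fin q) (Fin 2 → Fin N → Fin q) ℂ) (c : ℝ),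
      ⟪u, u⟫_ℂ = (c : ℂ) → ‖u‖ ^ 2 = c := by
    intro u c h
    rw [inner_self_eq_norm_sq_to_K] at h
    exact Complex.ofReal_injective (by rw [← h]; simp)
  have hx4 : x ^ 2 ≤ 1 / 4 := by nlinarith
  have hX4 : X ^ 2 ≤ 1 / 4 := by nlinarith
  have hs0 : 0 < s := by
    have : X ^ 2 * x ^ 4 ≤ 1 / 4 * 1 := by
      refine mul_le_mul hX4 ?_ (by positivity) (by norm_num)
      nlinarith
    rw [hs]
    linarith
  refine ⟨v, w, fun i hi => ?_, fun i hi => ?_,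
    groupTwirl_id_eq_zero_of_inner_eq_zero (by omega) hq h0v hNv, ?_, ?_⟩
  · rw [hv, map_sub, map_sub, map_smul, map_smul, map_smul, groupTwirl_gateHom_wall i,
      groupTwirl_gateHom_wall i, groupTwirl_gateHom_wall i] <;> omega
  · rw [hw, map_sub, map_sub, map_smul, map_smul, map_smul, groupTwirl_gateHom_wall i,
      groupTwirl_gateHom_wall i, groupTwirl_gateHom_wall i] <;> omega
  · rw [hwv]
    have h1 : 0 < 1 - x ^ 2 := by linarith
    have h2 : 0 < 1 - X ^ 2 := by linarith
    exact_mod_cast (by positivity : G * s * x * (1 - x ^ 2) * (1 - X ^ 2) ≠ 0)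
  -- The squared cosine is `x² (1 - X²) / ((1 + x²) (1 - X² x²))`; it is at least `x⁴ = q⁻⁴` because
  -- `x²` and `X²` are at most `1/4`.
  · rw [nsq _ _ hvv, nsq _ _ hww, hwv, Complex.norm_real, Real.norm_eq_abs, sq_abs]
    have hqx : (q : ℝ) * x = 1 := mul_inv_cancel₀ hq0.ne'
    have h1 : 0 < 1 - x ^ 2 := by linarith
    have h2 : 0 < 1 - X ^ 2 := by linarith
    have hmain : x ^ 2 * ((1 + x ^ 2) * (1 - X ^ 2 * x ^ 2)) ≤ 1 - X ^ 2 := by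
      have h3 : (1 + x ^ 2) * (1 - X ^ 2 * x ^ 2) ≤ 5 / 4 * 1 :=
        mul_le_mul (by linarith) (by nlinarith [sq_nonneg (X * x)]) (by nlinarith) (by norm_num)
      nlinarith
    have hmain' : (1 + x ^ 2) * (1 - X ^ 2 * x ^ 2) ≤ (q : ℝ) ^ 2 * (1 - X ^ 2) := by
      have h4 : (q : ℝ) ^ 2 * x ^ 2 = 1 := by rw [← mul_pow, hqx, one_pow]
      calc (1 + x ^ 2) * (1 - X ^ 2 * x ^ 2)
          = (q : ℝ) ^ 2 * (x ^ 2 * ((1 + x ^ 2) * (1 - X ^ 2 * x ^ 2))) := by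
            rw [← mul_assoc ((q : ℝ) ^ 2), h4, one_mul]
        _ ≤ _ := mul_le_mul_of_nonneg_left hmain (by positivity)
    have h5 : (q : ℝ) ^ 4 * (G * s * x * (1 - x ^ 2) * (1 - X ^ 2)) ^ 2 =
        (G * s * (1 - x ^ 2)) ^ 2 * (1 - X ^ 2) * ((q : ℝ) ^ 2 * (1 - X ^ 2)) * (q * x) ^ 2 := by
      ring
    rw [h5, hqx, one_pow, mul_one]
    calc _ = (G * s * (1 - x ^ 2)) ^ 2 * (1 - X ^ 2) * ((1 + x ^ 2) * (1 - X ^ 2 * x ^ 2)) := by ring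
      _ ≤ _ := mul_le_mul_of_nonneg_left hmain' (by positivity)

end Overlap

end RandomCircuit

namespace RandomCircuit

/-! ### From two copies to any larger number -/

section CopyExtend

attribute [local instance] hsNormedAddCommGroup hsInnerProductSpace

variable {m n : Type*} [Fintype m] [DecidableEq m] [Fintype n] [DecidableEq n] {r : ℕ}

/-- Append `s` copies on which the operator acts as the identity. -/
noncomputable def copyExtend (s : ℕ) (X : Matrix (Fin r → n) (Fin r → n) ℂ) :
    Matrix (Fin (r + s) → n) (Fin (r + s) → n) ℂ :=
  (X ⊗ₖ (1 : Matrix (Fin s → n) (Fin s → n) ℂ)).submatrix (Fin.appendEquiv r s).symm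
    (Fin.appendEquiv r s).symm

theorem tensorPow_add (r s : ℕ) (A : Matrix n n ℂ) : tensorPow (r + s) A =
    (tensorPow r A ⊗ₖ tensorPow s A).submatrix (Fin.appendEquiv r s).symm
      (Fin.appendEquiv r s).symm := by
  ext x y
  simp [tensorPow, Fin.prod_univ_add, Fin.appendEquiv]

/-- The added copies carry the identity, which conjugation does not change. -/
theorem twirl_copyExtend (s : ℕ) (U : unitaryGroup n ℂ) (X : Matrix (Fin r → n) (Fin r → n) ℂ) :
    twirl (r + s) U (copyExtend s X) = copyExtend s (twirl r U X) := by
  rw [twirl, copyExtend, tensorPow_add, tensorPow_add, submatrix_mul_equiv, submatrix_mul_equiv,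
    ← mul_kronecker_mul, ← mul_kronecker_mul, Matrix.mul_one, star_tensorPow_mul]
  rfl

theorem groupTwirl_copyExtend {φ : unitaryGroup m ℂ →* unitaryGroup n ℂ} (hφ : Measurable φ) (s : ℕ)
    (X : Matrix (Fin r → n) (Fin r → n) ℂ) :
    groupTwirl (r + s) φ (copyExtend s X) = copyExtend s (groupTwirl r φ X) := by
  ext x y
  rw [groupTwirl_apply hφ]
  simp only [twirl_copyExtend]
  simp only [copyExtend, submatrix_apply, kroneckerMap_apply]
  rw [integral_mul_const, groupTwirl_apply hφ]

theorem inner_copyExtend (s : ℕ) (X Y : Matrix (Fin r → n) (Fin r → n) ℂ) :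
    ⟪copyExtend s X, copyExtend s Y⟫_ℂ = ⟪X, Y⟫_ℂ * Fintype.card (Fin s → n) := by
  rw [hs_inner_def, hs_inner_def, copyExtend, copyExtend, conjTranspose_submatrix,
    submatrix_mul_equiv, conjTranspose_kronecker, ← mul_kronecker_mul, conjTranspose_one,
    Matrix.mul_one, ← Matrix.trace_one, ← Matrix.trace_kronecker]
  simp only [Matrix.trace, Matrix.diag_apply, submatrix_apply]
  exact Equiv.sum_comp (Fin.appendEquiv r s).symm fun p => ((Xᴴ * Y) ⊗ₖ (1 : Matrix _ _ ℂ)) p p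

theorem norm_sq_copyExtend (s : ℕ) (X : Matrix (Fin r → n) (Fin r → n) ℂ) :
    ‖copyExtend s X‖ ^ 2 = ‖X‖ ^ 2 * Fintype.card (Fin s → n) := by
  have h := inner_copyExtend s X X
  rw [inner_self_eq_norm_sq_to_K, inner_self_eq_norm_sq_to_K] at h
  exact Complex.ofReal_injective (by simpa using h)

variable {N q t : ℕ}

/-- Vectors fixed by the gates of an even, respectively an odd, layer whose ranges meet at a
definite angle. -/
theorem exists_overlap (hN : 3 ≤ N) (hq : 2 ≤ q) (ht : 2 ≤ t) :
    ∃ v w : Matrix (Fin t → Fin N → Fin q) (Fin t → Fin N → Fin q) ℂ,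
      (∀ i : Fin (N - 1), (i : ℕ) % 2 = 0 → groupTwirl t (gateHom i) v = v) ∧
      (∀ i : Fin (N - 1), (i : ℕ) % 2 = 1 → groupTwirl t (gateHom i) w = w) ∧
      groupTwirl t (MonoidHom.id (unitaryGroup (Fin N → Fin q) ℂ)) v = 0 ∧
      ⟪w, v⟫_ℂ ≠ 0 ∧ ‖w‖ ^ 2 * ‖v‖ ^ 2 ≤ (q : ℝ) ^ 4 * ‖⟪w, v⟫_ℂ‖ ^ 2 := by
  obtain ⟨s, rfl⟩ := Nat.exists_eq_add_of_le ht
  obtain ⟨v, w, hv, hw, hH, h0, h1⟩ := exists_overlap_two hN hq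
  have : Nonempty (Fin q) := ⟨⟨0, by omega⟩⟩
  have hc : (0 : ℝ) < Fintype.card (Fin s → Fin N → Fin q) := by exact_mod_cast Fintype.card_pos
  refine ⟨copyExtend s v, copyExtend s w, fun i hi => ?_, fun i hi => ?_, ?_, ?_, ?_⟩
  · rw [groupTwirl_copyExtend (measurable_gateHom i), hv i hi]
  · rw [groupTwirl_copyExtend (measurable_gateHom i), hw i hi]
  · rw [groupTwirl_copyExtend (φ := MonoidHom.id _) measurable_id, hH]
    simp [copyExtend]
  · rw [inner_copyExtend]
    exact mul_ne_zero h0 (by exact_mod_cast hc.ne')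
  · rw [norm_sq_copyExtend, norm_sq_copyExtend, inner_copyExtend, norm_mul, Complex.norm_natCast,
      mul_pow]
    calc _ = (‖w‖ ^ 2 * ‖v‖ ^ 2) * (Fintype.card (Fin s → Fin N → Fin q) : ℝ) ^ 2 := by ring
      _ ≤ (q : ℝ) ^ 4 * ‖⟪w, v⟫_ℂ‖ ^ 2 * (Fintype.card (Fin s → Fin N → Fin q) : ℝ) ^ 2 :=
        mul_le_mul_of_nonneg_right h1 (by positivity)
      _ = _ := by ring

end CopyExtend

end RandomCircuit

namespace RandomCircuit

/-! ### Brickwork layers as orthogonal projections -/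

section Layers

attribute [local instance] hsNormedAddCommGroup hsInnerProductSpace

variable (N q t : ℕ)

/-- The moment operator of the `j`-th brickwork layer. -/
noncomputable def layer (j : ℕ) :
    Module.End ℂ (Matrix (Fin t → Fin N → Fin q) (Fin t → Fin N → Fin q) ℂ) :=
  ((brickworkLayer N j).map fun i => groupTwirl t (gateHom (q := q) i)).prod

/-- The gate twirls, indexed by natural numbers and continued by the identity. -/
noncomputable def gateTwirl (j : ℕ) :
    Module.End ℂ (Matrix (Fin t → Fin N → Fin q) (Fin t → Fin N → Fin q) ℂ) :=
  if h : j < N - 1 then groupTwirl t (gateHom (q := q) ⟨j, h⟩) else 1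

variable {N q t}

theorem gateTwirl_val (i : Fin (N - 1)) : gateTwirl N q t i = groupTwirl t (gateHom i) := by
  simp [gateTwirl]

theorem commute_gateTwirl {i j : ℕ} (h : i + 1 < j) :
    Commute (gateTwirl N q t i) (gateTwirl N q t j) := by
  unfold gateTwirl
  split_ifs
  · exact commute_groupTwirl_gateHom h
  · exact Commute.one_right _
  · exact Commute.one_left _
  · exact Commute.one_left _

theorem momentOperator_staircase : momentOperator t (circuitEnsemble q (staircase N)) =
    ((List.range (N - 1)).map (gateTwirl N q t)).prod := by
  rw [momentOperator_circuitEnsemble, staircase, ← List.map_coe_finRange_eq_range, List.map_map]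
  congr 1
  exact List.map_congr_left fun i _ => (gateTwirl_val i).symm

theorem layer_eq_parityProd (j : ℕ) : layer N q t j = parityProd (gateTwirl N q t) j (N - 1) := by
  rw [layer, parityProd, ← List.map_coe_finRange_eq_range, List.filter_map, List.map_map]
  congr 1
  exact List.map_congr_left fun i _ => (gateTwirl_val i).symm

theorem momentOperator_brickwork (ℓ : ℕ) : momentOperator t (circuitEnsemble q (brickwork N ℓ)) =
    ((List.range ℓ).map (layer N q t)).prod := by
  rw [momentOperator_circuitEnsemble, brickwork]
  generalize List.range ℓ = l
  induction l with
  | nil => simp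
  | cons j l ih =>
    rw [List.flatMap_cons, List.map_append, List.prod_append, ih, List.map_cons, List.prod_cons]
    rfl

theorem mem_brickworkLayer {i : Fin (N - 1)} {j : ℕ} :
    i ∈ brickworkLayer N j ↔ (i : ℕ) % 2 = j % 2 := by
  simp [brickworkLayer]

theorem layer_congr {j k : ℕ} (h : j % 2 = k % 2) : layer N q t j = layer N q t k := by
  simp only [layer, brickworkLayer, h]

theorem isSymmetricProjection_gate (i : Fin (N - 1)) :
    (groupTwirl t (gateHom (q := q) i)).IsSymmetricProjection :=
  isSymmetricProjection_groupTwirl (measurable_gateHom i)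

theorem isSymmetricProjection_of_mem_map_gate (c : List (Fin (N - 1))) :
    ∀ P ∈ c.map (fun i => groupTwirl t (gateHom (q := q) i)), P.IsSymmetricProjection := by
  intro P hP
  obtain ⟨i, _, rfl⟩ := List.mem_map.mp hP
  exact isSymmetricProjection_gate i

theorem isSymmetricProjection_haar :
    (groupTwirl t (MonoidHom.id (unitaryGroup (Fin N → Fin q) ℂ))).IsSymmetricProjection :=
  isSymmetricProjection_groupTwirl (φ := MonoidHom.id _) measurable_id

theorem isSymmetricProjection_layer (j : ℕ) : (layer N q t j).IsSymmetricProjection := by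
  refine isSymmetricProjection_list_prod (isSymmetricProjection_of_mem_map_gate _) ?_
  rw [List.pairwise_map]
  refine List.Pairwise.imp_of_mem (R := fun i k => (i : Fin (N - 1)) ≠ k) ?_
    ((List.nodup_finRange _).filter _)
  intro i k hi hk hik
  rw [mem_brickworkLayer] at hi hk
  have : (i : ℕ) ≠ k := fun h => hik (Fin.ext h)
  rcases lt_or_gt_of_ne this with h | h
  · exact commute_groupTwirl_gateHom (by omega)
  · exact (commute_groupTwirl_gateHom (by omega)).symm

theorem prod_gate_mul_haar (c : List (Fin (N - 1))) :
    (c.map fun i => groupTwirl t (gateHom (q := q) i)).prod * groupTwirl t (MonoidHom.id _) =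
      groupTwirl t (MonoidHom.id _) := by
  induction c with
  | nil => simp
  | cons i c ih =>
    rw [List.map_cons, List.prod_cons, mul_assoc, ih, groupTwirl_gateHom_mul_groupTwirl_id]

theorem haar_apply_eq_self_of_layer (hN : 2 ≤ N) (hq : 2 ≤ q) {j : ℕ}
    {v : Matrix (Fin t → Fin N → Fin q) (Fin t → Fin N → Fin q) ℂ} (h0 : layer N q t j v = v)
    (h1 : layer N q t (j + 1) v = v) :
    groupTwirl t (MonoidHom.id (unitaryGroup (Fin N → Fin q) ℂ)) v = v := by
  refine groupTwirl_id_eq_self hN hq fun i => ?_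
  have key : ∀ k, layer N q t k v = v → (i : ℕ) % 2 = k % 2 → groupTwirl t (gateHom i) v = v := by
    intro k hk hi
    exact eq_self_of_norm_le_list_prod
      ((brickworkLayer N k).map fun i => groupTwirl t (gateHom (q := q) i))
      (isSymmetricProjection_of_mem_map_gate _) (congrArg norm hk).ge _
      (List.mem_map.mpr ⟨i, mem_brickworkLayer.mpr hi, rfl⟩)
  rcases Nat.mod_two_eq_zero_or_one (i + j) with h | h
  · exact key j h0 (by omega)
  · exact key (j + 1) h1 (by omega)

end Layers

/-! ### Bounds on the staircase eigenvalue -/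

section StairEigenvalue

attribute [local instance] hsNormedAddCommGroup hsInnerProductSpace

variable {N q t : ℕ}

theorem finite_stairEigenvalue_set : {r : ℝ | ∃ μ : ℂ,
    Module.End.HasEigenvalue (momentOperator t (circuitEnsemble q (staircase N))) μ ∧
      μ ≠ 1 ∧ r = ‖μ‖}.Finite := by
  refine ((Module.End.finite_hasEigenvalue
    (momentOperator t (circuitEnsemble q (staircase N)))).image norm).subset ?_
  rintro r ⟨μ, h, _, rfl⟩
  exact ⟨μ, h, rfl⟩

theorem norm_le_stairEigenvalue {μ : ℂ}
    (h : Module.End.HasEigenvalue (momentOperator t (circuitEnsemble q (staircase N))) μ)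
    (hμ : μ ≠ 1) : ‖μ‖ ≤ stairEigenvalue N q t :=
  le_csSup finite_stairEigenvalue_set.bddAbove ⟨μ, h, hμ, rfl⟩

theorem stairEigenvalue_nonneg : 0 ≤ stairEigenvalue N q t :=
  Real.sSup_nonneg (by rintro r ⟨μ, _, _, rfl⟩; exact norm_nonneg _)

theorem stairEigenvalue_lt_one : stairEigenvalue N q t < 1 := by
  rcases Set.eq_empty_or_nonempty {r : ℝ | ∃ μ : ℂ,
    Module.End.HasEigenvalue (momentOperator t (circuitEnsemble q (staircase N))) μ ∧
      μ ≠ 1 ∧ r = ‖μ‖} with h | h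
  · rw [stairEigenvalue, h, Real.sSup_empty]
    exact one_pos
  · obtain ⟨μ, hμ, h1, h2⟩ := h.csSup_mem finite_stairEigenvalue_set
    rw [stairEigenvalue, h2]
    rw [momentOperator_circuitEnsemble] at hμ
    exact norm_eigenvalue_lt_one _ (isSymmetricProjection_of_mem_map_gate _) hμ h1

/-- An idempotent has no eigenvalues besides `0` and `1`. This covers `N = 2` and `t = 1`, where the
gate projections commute. -/
theorem stairEigenvalue_eq_zero_of_isIdempotentElem
    (h : IsIdempotentElem (momentOperator t (circuitEnsemble q (staircase N)))) :
    stairEigenvalue N q t = 0 := by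
  refine le_antisymm (Real.sSup_le ?_ le_rfl) stairEigenvalue_nonneg
  rintro r ⟨μ, hμ, h1, rfl⟩
  obtain ⟨v, hv⟩ := hμ.exists_hasEigenvector
  have h2 := LinearMap.congr_fun h v
  rw [Module.End.mul_apply, hv.apply_eq_smul, map_smul, hv.apply_eq_smul, smul_smul] at h2
  have h3 : μ * μ = μ := smul_left_injective ℂ hv.2 h2
  have h4 : μ = 0 := by
    by_contra h0
    exact h1 (mul_left_cancel₀ h0 (by rw [h3, mul_one]))
  simp [h4]

theorem stairEigenvalue_two : stairEigenvalue 2 q t = 0 := by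
  refine stairEigenvalue_eq_zero_of_isIdempotentElem ?_
  rw [momentOperator_staircase]
  simp only [show 2 - 1 = 1 from rfl, List.range_one, List.map_singleton, List.prod_singleton]
  have h := gateTwirl_val (N := 2) (q := q) (t := t) 0
  rw [Fin.val_zero] at h
  rw [h]
  exact (isSymmetricProjection_gate _).isIdempotentElem

/-- For first moments, neighbouring gate twirls commute. -/
theorem commute_groupTwirl_one_gateHom {i j : Fin (N - 1)} (hij : (i : ℕ) + 1 = j) :
    Commute (groupTwirl 1 (gateHom (q := q) i)) (groupTwirl 1 (gateHom j)) := by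
  set P := groupTwirl 1 (gateHom (q := q) i)
  set Q := groupTwirl 1 (gateHom (q := q) j)
  have hP : P.IsSymmetricProjection := isSymmetricProjection_gate i
  have hQ : Q.IsSymmetricProjection := isSymmetricProjection_gate j
  have h : Q * (P * Q) = P * Q := by
    refine LinearMap.ext fun X => ?_
    exact groupTwirl_one_gateHom_invariant hij (symmetricProjection_apply_apply hQ X)
  -- The adjoint of `h`; comparing both gives `P Q = Q P`.
  have h' : Q * P * Q = Q * P := by
    refine LinearMap.ext fun v => ext_inner_left ℂ fun u => ?_
    simp only [Module.End.mul_apply]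
    have := LinearMap.congr_fun h u
    simp only [Module.End.mul_apply] at this
    rw [← hQ.isSymmetric, ← hP.isSymmetric, ← hQ.isSymmetric, this, ← hQ.isSymmetric,
      ← hP.isSymmetric]
  rw [commute_iff_eq, ← h, ← mul_assoc, h']

theorem stairEigenvalue_one : stairEigenvalue N q 1 = 0 := by
  refine stairEigenvalue_eq_zero_of_isIdempotentElem ?_
  rw [momentOperator_circuitEnsemble]
  refine (isSymmetricProjection_list_prod (isSymmetricProjection_of_mem_map_gate _) ?_).isIdempotentElem
  rw [List.pairwise_map]
  refine List.Pairwise.imp ?_ (List.nodup_finRange _)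
  intro i k hik
  have hik' : (i : ℕ) ≠ k := fun h => hik (Fin.ext h)
  have key : ∀ i k : Fin (N - 1), (i : ℕ) < k →
      Commute (groupTwirl 1 (gateHom (q := q) i)) (groupTwirl 1 (gateHom k)) := by
    intro i k h
    rcases Nat.lt_or_ge (i + 1) k with h' | h'
    · exact commute_groupTwirl_gateHom h'
    · exact commute_groupTwirl_one_gateHom (by omega)
  rcases lt_or_gt_of_ne hik' with h | h
  · exact key i k h
  · exact (key k i h).symm

theorem norm_le_of_hasEigenvalue_layer_mul {j : ℕ} {μ : ℂ}
    (h : Module.End.HasEigenvalue (layer N q t j * layer N q t (j + 1)) μ) (hμ : μ ≠ 1) :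
    ‖μ‖ ≤ stairEigenvalue N q t := by
  by_cases h0 : μ = 0
  · simpa [h0] using stairEigenvalue_nonneg
  have h01 : Module.End.HasEigenvalue (layer N q t 0 * layer N q t 1) μ := by
    rcases Nat.mod_two_eq_zero_or_one j with hj | hj
    · rwa [layer_congr (k := 0) (by omega : j % 2 = 0 % 2),
        layer_congr (k := 1) (by omega : (j + 1) % 2 = 1 % 2)] at h
    · rw [layer_congr (k := 1) (by omega : j % 2 = 1 % 2),
        layer_congr (k := 0) (by omega : (j + 1) % 2 = 0 % 2)] at h
      exact hasEigenvalue_mul_comm h0 h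
  refine norm_le_stairEigenvalue ?_ hμ
  have := hasEigenvalue_stair_iff (P := gateTwirl N q t) (fun _ _ => commute_gateTwirl) (N - 1) 1
    (fun _ _ => Commute.one_left _) μ h0
  rw [mul_one, mul_one] at this
  rw [momentOperator_staircase, this, ← layer_eq_parityProd, ← layer_eq_parityProd]
  exact h01

theorem norm_sq_layer_mul_sub_le (hN : 2 ≤ N) (hq : 2 ≤ q) (j : ℕ)
    (v : Matrix (Fin t → Fin N → Fin q) (Fin t → Fin N → Fin q) ℂ) :
    ‖(layer N q t (j + 1) * layer N q t j -
        groupTwirl t (MonoidHom.id (unitaryGroup (Fin N → Fin q) ℂ))) v‖ ^ 2 ≤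
      stairEigenvalue N q t * ‖v‖ ^ 2 :=
  norm_sq_mul_sub_le (isSymmetricProjection_layer j) (isSymmetricProjection_layer (j + 1))
    isSymmetricProjection_haar (prod_gate_mul_haar _) (prod_gate_mul_haar _)
    (fun _ h0 h1 => haar_apply_eq_self_of_layer hN hq h0 h1) stairEigenvalue_nonneg
    (fun _ h hμ => norm_le_of_hasEigenvalue_layer_mul h hμ) v

/-- The staircase eigenvalue is at least `q⁻⁴`. -/
theorem one_le_stairEigenvalue_mul (hN : 3 ≤ N) (hq : 2 ≤ q) (ht : 2 ≤ t) :
    1 ≤ stairEigenvalue N q t * (q : ℝ) ^ 4 := by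
  obtain ⟨v, w, hv, hw, hH, h0, h1⟩ := exists_overlap hN hq ht
  have hOv : layer N q t 0 v = v := by
    refine list_prod_apply_eq_self fun P hP => ?_
    obtain ⟨i, hi, rfl⟩ := List.mem_map.mp hP
    exact hv i (mem_brickworkLayer.mp hi)
  have hEw : layer N q t 1 w = w := by
    refine list_prod_apply_eq_self fun P hP => ?_
    obtain ⟨i, hi, rfl⟩ := List.mem_map.mp hP
    exact hw i (mem_brickworkLayer.mp hi)
  -- `O` fixes `v` and `H` kills it, so `(E O - H) v = E v`, whose norm is bounded below by pairing
  -- with `w = E w`.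
  have hbound := norm_sq_layer_mul_sub_le (t := t) (by omega : 2 ≤ N) hq 0 v
  rw [LinearMap.sub_apply, Module.End.mul_apply, hOv, hH, sub_zero, zero_add] at hbound
  have hinner : ⟪w, v⟫_ℂ = ⟪w, layer N q t 1 v⟫_ℂ := by
    rw [← (isSymmetricProjection_layer 1).isSymmetric, hEw]
  have hcs : ‖⟪w, v⟫_ℂ‖ ^ 2 ≤ ‖w‖ ^ 2 * ‖layer N q t 1 v‖ ^ 2 := by
    rw [hinner, ← mul_pow]
    exact pow_le_pow_left₀ (norm_nonneg _) (norm_inner_le_norm _ _) 2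
  have hpos : 0 < ‖⟪w, v⟫_ℂ‖ ^ 2 := by positivity
  have hl : ‖⟪w, v⟫_ℂ‖ ^ 2 ≤ stairEigenvalue N q t * (q : ℝ) ^ 4 * ‖⟪w, v⟫_ℂ‖ ^ 2 := by
    calc ‖⟪w, v⟫_ℂ‖ ^ 2 ≤ ‖w‖ ^ 2 * (stairEigenvalue N q t * ‖v‖ ^ 2) :=
          hcs.trans (mul_le_mul_of_nonneg_left hbound (by positivity))
      _ = stairEigenvalue N q t * (‖w‖ ^ 2 * ‖v‖ ^ 2) := by ring
      _ ≤ stairEigenvalue N q t * ((q : ℝ) ^ 4 * ‖⟪w, v⟫_ℂ‖ ^ 2) :=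
          mul_le_mul_of_nonneg_left h1 stairEigenvalue_nonneg
      _ = _ := by ring
  exact le_of_mul_le_mul_right (by rwa [one_mul]) hpos

end StairEigenvalue

end RandomCircuit

namespace RandomCircuit

/-! ### Convergence of the brickwork and the layer counts -/

section Convergence

attribute [local instance] hsNormedAddCommGroup hsInnerProductSpace

variable {N q t : ℕ}

theorem gate_apply_layer {i : Fin (N - 1)} {j : ℕ} (h : (i : ℕ) % 2 = j % 2) :
    groupTwirl t (gateHom (q := q) i) * layer N q t j = layer N q t j := by
  refine LinearMap.ext fun v => ?_
  exact eq_self_of_norm_le_list_prod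
    ((brickworkLayer N j).map fun i => groupTwirl t (gateHom (q := q) i))
    (isSymmetricProjection_of_mem_map_gate _)
    (congrArg norm (symmetricProjection_apply_apply (isSymmetricProjection_layer j) v)).ge _
    (List.mem_map.mpr ⟨i, mem_brickworkLayer.mpr h, rfl⟩)

/-- The gate on the first pair belongs to layer `0`, so `O - H = (O - H) P` for its projection `P`.
As `O - H` is a contraction, only the norm of `P` counts. -/
theorem hsNormSq_layer_sub_le (hN : 2 ≤ N) (hq : 1 ≤ q) (ht : 1 ≤ t) :
    hsNormSq (hsBasis (Fin t → Fin N → Fin q))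
      (layer N q t 0 - groupTwirl t (MonoidHom.id (unitaryGroup (Fin N → Fin q) ℂ))) ≤
      ((q : ℝ) ^ (N * t)) ^ 2 / (q : ℝ) ^ 4 := by
  set H := groupTwirl t (MonoidHom.id (unitaryGroup (Fin N → Fin q) ℂ)) with hHdef
  let i : Fin (N - 1) := ⟨0, by omega⟩
  set P := groupTwirl t (gateHom (q := q) i) with hPdef
  have hP : P.IsSymmetricProjection := isSymmetricProjection_gate i
  have hO := isSymmetricProjection_layer (N := N) (q := q) (t := t) 0
  have hH : H.IsSymmetricProjection := isSymmetricProjection_haar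
  have hOP : layer N q t 0 * P = layer N q t 0 :=
    eq_mul_of_symmetric hO.isSymmetric hP.isSymmetric (gate_apply_layer rfl)
  have hHP : H * P = H :=
    eq_mul_of_symmetric hH.isSymmetric hP.isSymmetric (groupTwirl_gateHom_mul_groupTwirl_id i)
  have hHO : H * layer N q t 0 = H :=
    eq_mul_of_symmetric hH.isSymmetric hO.isSymmetric (prod_gate_mul_haar _)
  have hfac : layer N q t 0 - H = (layer N q t 0 - H) * P := by rw [sub_mul, hOP, hHP]
  rw [hfac]
  refine (hsNormSq_contraction_mul_le _ (fun v => ?_) _).trans (hsNormSq_gate_le hq ht i)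
  refine le_trans ?_ (norm_symmetricProjection_le hO v)
  have h1 := norm_sq_symmetricProjection hH (layer N q t 0 v)
  rw [← Module.End.mul_apply, hHO] at h1
  rw [LinearMap.sub_apply]
  refine (sq_le_sq₀ (norm_nonneg _) (norm_nonneg _)).mp ?_
  nlinarith [sq_nonneg ‖H v‖]

theorem hsNormSq_brickwork_sub_le (hN : 2 ≤ N) (hq : 2 ≤ q) (ht : 1 ≤ t)
    (h0 : 0 < stairEigenvalue N q t) (ℓ : ℕ) :
    hsNormSq (hsBasis (Fin t → Fin N → Fin q))
      (momentOperator t (circuitEnsemble q (brickwork N ℓ)) - momentOperator t (haar _)) ≤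
      ((q : ℝ) ^ (N * t)) ^ 2 * stairEigenvalue N q t ^ ℓ := by
  -- Positivity of the eigenvalue rules out the commuting cases, so the lower bound `q⁻⁴` is
  -- available.
  have hN3 : 3 ≤ N := by
    by_contra h
    obtain rfl : N = 2 := by omega
    exact h0.ne' stairEigenvalue_two
  have ht2 : 2 ≤ t := by
    by_contra h
    obtain rfl : t = 1 := by omega
    exact h0.ne' stairEigenvalue_one
  rw [momentOperator_brickwork, momentOperator_haar]
  cases ℓ with
  | zero =>
    refine (hsNormSq_one_sub_le _ isSymmetricProjection_haar).trans (le_of_eq ?_)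
    simp [Fintype.card_prod, sq, pow_mul]
  | succ ℓ =>
    refine (hsNormSq_alternating_le (hsBasis (Fin t → Fin N → Fin q)) isSymmetricProjection_layer
      isSymmetricProjection_haar (fun _ => prod_gate_mul_haar _) h0.le
      (norm_sq_layer_mul_sub_le hN hq) ℓ).trans ?_
    have h1 := hsNormSq_layer_sub_le hN (by omega : 1 ≤ q) ht
    have h2 := one_le_stairEigenvalue_mul hN3 hq ht2
    have hq0 : (0 : ℝ) < q := by exact_mod_cast (by omega : 0 < q)
    have h3 : ((q : ℝ) ^ (N * t)) ^ 2 / (q : ℝ) ^ 4 ≤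
        ((q : ℝ) ^ (N * t)) ^ 2 * stairEigenvalue N q t := by
      rw [div_le_iff₀ (by positivity), mul_assoc]
      exact le_mul_of_one_le_right (by positivity) h2
    calc _ ≤ stairEigenvalue N q t ^ ℓ * (((q : ℝ) ^ (N * t)) ^ 2 * stairEigenvalue N q t) :=
          mul_le_mul_of_nonneg_left (h1.trans h3) (by positivity)
      _ = _ := by ring

theorem hsNormSq_brickwork_sub_eq_zero (hN : 2 ≤ N) (hq : 2 ≤ q)
    (h0 : stairEigenvalue N q t = 0) {ℓ : ℕ} (hℓ : 2 ≤ ℓ) :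
    hsNormSq (hsBasis (Fin t → Fin N → Fin q))
      (momentOperator t (circuitEnsemble q (brickwork N ℓ)) - momentOperator t (haar _)) ≤ 0 := by
  obtain ⟨k, rfl⟩ := Nat.exists_eq_add_of_le' hℓ
  rw [momentOperator_brickwork, momentOperator_haar]
  -- With two or more layers the factor `0` occurs at least once; a single layer would leave `0 ^ 0
  -- = 1`.
  refine (hsNormSq_alternating_le (hsBasis (Fin t → Fin N → Fin q)) isSymmetricProjection_layer
    isSymmetricProjection_haar (fun _ => prod_gate_mul_haar _) stairEigenvalue_nonneg
    (norm_sq_layer_mul_sub_le hN hq) (k + 1)).trans ?_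
  rw [h0]
  simp

theorem isDesign_of_hsNormSq_le {ε : ℝ} {μ : Measure (unitaryGroup (Fin N → Fin q) ℂ)}
    [IsProbabilityMeasure μ] (hε : 0 ≤ ε)
    (h : ((q : ℝ) ^ (N * t)) ^ 2 * hsNormSq (hsBasis (Fin t → Fin N → Fin q))
      (momentOperator t μ - momentOperator t (haar _)) ≤ ε ^ 2) :
    IsAdditiveDesign t ε μ ∧ IsMultiplicativeDesign t ε μ := by
  have h1 : (Fintype.card (Fin t → Fin N → Fin q) : ℝ) *
      √(frobSq (choi (momentOperator t μ - momentOperator t (haar (Fin N → Fin q))))) ≤ ε := by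
    rw [← hsNormSq_eq_frobSq_choi]
    have hD : (Fintype.card (Fin t → Fin N → Fin q) : ℝ) = (q : ℝ) ^ (N * t) := by
      simp [pow_mul]
    rw [hD]
    refine abs_le_of_sq_le_sq' ?_ hε |>.2
    rw [mul_pow, Real.sq_sqrt]
    · exact h
    · exact Finset.sum_nonneg fun _ _ => by positivity
  exact ⟨isAdditiveDesign_of_frobSq_le μ h1, isMultiplicativeDesign_of_frobSq_le μ h1⟩

theorem mul_pow_le_sq_of_log_le {lam ε D : ℝ} (h0 : 0 < lam) (h1 : lam < 1) (hε : 0 < ε) (hD : 0 < D)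
    {ℓ : ℕ} (h : 2 / Real.log (1 / lam) * (2 * Real.log D + Real.log (1 / ε)) ≤ ℓ) :
    D ^ 2 * (D ^ 2 * lam ^ ℓ) ≤ ε ^ 2 := by
  have hlog : 0 < Real.log (1 / lam) := Real.log_pos (by rw [lt_div_iff₀ h0]; linarith)
  rw [div_mul_eq_mul_div, div_le_iff₀ hlog] at h
  rw [← Real.log_le_log_iff (by positivity) (by positivity)]
  rw [Real.log_mul (by positivity) (by positivity), Real.log_mul (by positivity) (by positivity),
    Real.log_pow, Real.log_pow, Real.log_pow]
  simp only [one_div, Real.log_inv] at h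
  push_cast
  linarith

theorem isDesign_brickwork (hN : 2 ≤ N) (hq : 2 ≤ q) (ht : 1 ≤ t) {ε : ℝ} (hε : 0 < ε)
    (h0 : 0 < stairEigenvalue N q t) {ℓ : ℕ}
    (h : 2 / Real.log (1 / stairEigenvalue N q t) *
      (2 * N * t * Real.log q + Real.log (1 / ε)) ≤ ℓ) :
    IsAdditiveDesign t ε (circuitEnsemble q (brickwork N ℓ)) ∧
      IsMultiplicativeDesign t ε (circuitEnsemble q (brickwork N ℓ)) := by
  have hq0 : (0 : ℝ) < q := by exact_mod_cast (by omega : 0 < q)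
  refine isDesign_of_hsNormSq_le hε.le ?_
  refine (mul_le_mul_of_nonneg_left (hsNormSq_brickwork_sub_le hN hq ht h0 ℓ)
    (by positivity)).trans ?_
  refine mul_pow_le_sq_of_log_le h0 stairEigenvalue_lt_one hε (by positivity) ?_
  convert h using 3
  rw [Real.log_pow]
  push_cast
  ring

end Convergence

end RandomCircuit

theorem mainTheorem9 (N q t : ℕ) (hN : 2 ≤ N) (hq : 2 ≤ q) (ht : 1 ≤ t) (ε : ℝ) (hε : 0 < ε) :
    RandomCircuit.stairEigenvalue N q t < 1 ∧
    (0 < RandomCircuit.stairEigenvalue N q t →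
      (∀ ℓ : ℕ,
        ⌊1 + 2 / Real.log (1 / RandomCircuit.stairEigenvalue N q t) *
          (2 * N * t * Real.log q + Real.log (1 / ε))⌋ ≤ (ℓ : ℤ) →
        RandomCircuit.IsAdditiveDesign t ε
          (RandomCircuit.circuitEnsemble q (RandomCircuit.brickwork N ℓ))) ∧
      (∀ ℓ : ℕ,
        2 * ⌈1 / Real.log (1 / RandomCircuit.stairEigenvalue N q t) *
          (2 * N * t * Real.log q + Real.log (1 / ε))⌉ ≤ (ℓ : ℤ) →
        RandomCircuit.IsMultiplicativeDesign t ε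
          (RandomCircuit.circuitEnsemble q (RandomCircuit.brickwork N ℓ)))) ∧
    (RandomCircuit.stairEigenvalue N q t = 0 → ∀ ℓ : ℕ, 2 ≤ ℓ →
      RandomCircuit.IsAdditiveDesign t ε
        (RandomCircuit.circuitEnsemble q (RandomCircuit.brickwork N ℓ)) ∧
      RandomCircuit.IsMultiplicativeDesign t ε
        (RandomCircuit.circuitEnsemble q (RandomCircuit.brickwork N ℓ))) := by
  refine ⟨RandomCircuit.stairEigenvalue_lt_one, fun h0 => ⟨fun ℓ hℓ => ?_, fun ℓ hℓ => ?_⟩,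
    fun h0 ℓ hℓ => ?_⟩
  · refine (RandomCircuit.isDesign_brickwork hN hq ht hε h0 ?_).1
    -- That the floor of `1 + x` is at most `ℓ` means `x < ℓ`: the summand `1` is exactly what
    -- rounding down costs.
    have := Int.floor_le_iff.mp hℓ
    push_cast at this
    linarith
  · refine (RandomCircuit.isDesign_brickwork hN hq ht hε h0 ?_).2
    set z := 1 / Real.log (1 / RandomCircuit.stairEigenvalue N q t) *
      (2 * N * t * Real.log q + Real.log (1 / ε)) with hz
    have h1 : (2 : ℝ) * ⌈z⌉ ≤ ℓ := by exact_mod_cast hℓ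
    have h2 := Int.le_ceil z
    calc _ = 2 * z := by rw [hz]; ring
      _ ≤ ℓ := by linarith
  · refine RandomCircuit.isDesign_of_hsNormSq_le hε.le ?_
    have := RandomCircuit.hsNormSq_brickwork_sub_eq_zero (t := t) hN hq h0 hℓ
    exact (mul_nonpos_of_nonneg_of_nonpos (by positivity) this).trans (by positivity)
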